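/- **Setting.** Let $g=\mathrm{diag}(-1,1,1,1)$ be the Minkowski metric on $\mathbb R^{4}=\mathbb R^{1+3}$, and raise and lower indices with $g$. A covector $\xi$ is spacelike if $g(\xi,\xi)=-\xi_0^2+|\xi'|^2>0$. For spacelike $\xi$ put $\eta=\xi/\sqrt{g(\xi,\xi)}$, $\kappa^i_k=\delta^i_k-\eta_k\eta^i$, $\mu_{kl}=g_{kl}-\eta_k\eta_l$, $h^{ij}=g^{ij}-\eta^i\eta^j$, and define the symbol, homogeneous of degree zero, $$P^{ij}_{kl}(\xi)=\kappa^i_k\kappa^j_l-\tfrac13\,\mu_{kl}h^{ij},\qquad (Pf)_{kl}=P^{ij}_{kl}f_{ij}.$$ For an open set $M\subset\mathbb R^4$, $\mathcal E'(M;E)$ denotes the compactly supported distributions on $M$ with values in $E$, where $E=\mathbb C$, $\Lambda^1$ ($1$-forms) or $\mathrm{Sym}^2$ (symmetric $2$-tensors), and $(d^s\omega)_{ij}=\tfrac12(\partial_i\omega_j+\partial_j\omega_i)$. Since $P(\xi)$ is defined only for spacelike $\xi$, $Pf$ is understood microlocally near a given spacelike $(x,\xi)$: $P$ stands for any matrix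 of pseudodifferential operators of order $0$ on $M$ whose full symbol equals $P^{ij}_{kl}(\eta)$ for all $(y,\eta)$ in a conic neighbourhood of $(x,\xi)$ with $|\eta|$ large. Wave front sets are those of Hörmander; pseudodifferential operators are those with symbols in $S^m_{1,0}$, up to operators with smooth kernel. **Lemma.** Let $M\subset\mathbb R^4$ be open and let $(x,\xi)\in T^*M$ be spacelike. Then for all $f\in\mathcal E'(M;\mathrm{Sym}^2)$, $$(x,\xi)\in\mathrm{WF}(Pf)\iff (x,\xi)\in\mathrm{WF}(f+cg+d^s\omega)\ \text{ for all } c\in\mathcal E'(M)\text{ and } \omega\in\mathcal E'(M;\Lambda^1).$$ Furthermore, let $A$ be a pseudodifferential operator on $M$, of any order $m\in\mathbb R$, mapping $\mathcal E'(M;\mathrm{Sym}^2)$ to $\mathcal D'(M;\mathbb C^n)$ for some $n$, such that $A(cg+d^s\omega)=0$ for all $c\in\mathcal E'(M)$ and $\omega\in\mathcal E'(M;\Lambda^1)$. Then $$(x,\xi)\in\mathrm{WF}(APf)\iff(x,\xi)\in\mathrm{WF}(Af).$$ Here, as $Pf$ need not have compact support, $APf$ stands for $A(\varphi Pf)$ with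 any $\varphi\in C_0^\infty(M)$ that equals $1$ near $x$. -/

import Mathlib

open scoped Distributions LineDeriv Topology ContDiff
open TopologicalSpace Distribution MeasureTheory

noncomputable section

namespace LightRay

/-- Space-time `ℝ^{1+3}` with its Euclidean norm; the coordinate `0` is time. Covectors
`(ξ_0, ξ')` are elements of the same space, paired with points by the Euclidean inner product. -/
abbrev E4 := EuclideanSpace ℝ (Fin 4)

/-- Index pairs of 2-tensors. -/
abbrev Ix2 := Fin 4 × Fin 4

/-! ### Functionals on test functions, compact support, wave front sets -/

section Functionals

variable {M : Opens E4}

/-- The function `h` is a real test function on `M`. -/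
def IsTest (M : Opens E4) (h : E4 → ℝ) : Prop :=
  ContDiff ℝ ∞ h ∧ HasCompactSupport h ∧ tsupport h ⊆ (M : Set E4)

open Classical in
/-- The value of a functional at a real function that happens to be a test function on `M`
(and `0` at all other functions). -/
def evalReal (u : 𝓓(M, ℝ) → ℂ) (h : E4 → ℝ) : ℂ :=
  if H : IsTest M h then u ⟨h, H.1, H.2.1, H.2.2⟩ else 0

/-- The complex linear extension of a real linear functional to complex test functions. -/
def evalC (u : 𝓓(M, ℝ) → ℂ) (h : E4 → ℂ) : ℂ :=
  evalReal u (fun y => (h y).re) + Complex.I * evalReal u (fun y => (h y).im)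

/-- `u` has compact support in `M`. -/
def CompactlySupported (u : 𝓓(M, ℝ) → ℂ) : Prop :=
  ∃ K : Set E4, IsCompact K ∧ K ⊆ (M : Set E4) ∧ IsVanishingOn u Kᶜ

/-- `ψ ∈ C_0^∞(M)` equals `1` near a compact set in which `u` is supported. -/
def IsCutoff (ψ : 𝓓(M, ℝ)) (u : 𝓓(M, ℝ) → ℂ) : Prop :=
  ∃ K : Set E4, IsCompact K ∧ K ⊆ (M : Set E4) ∧ IsVanishingOn u Kᶜ ∧ ∀ᶠ y in 𝓝ˢ K, ψ y = 1

open Classical in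
/-- A cutoff `ψ ∈ C_0^∞(M)` that is `1` near the support of the compactly supported `u`. -/
def cutoff (u : 𝓓(M, ℝ) → ℂ) : 𝓓(M, ℝ) :=
  if h : ∃ ψ, IsCutoff ψ u then h.choose else 0

/-- The pairing of a compactly supported `u` with a function `h` that is smooth on `M` but need
not have compact support: `u(ψ h)` with `ψ ∈ C_0^∞(M)` equal to `1` near the support of `u`. -/
def pairSmooth (u : 𝓓(M, ℝ) → ℂ) (h : E4 → ℂ) : ℂ :=
  evalC u (fun y => (cutoff u y : ℂ) * h y)

/-- Every compactly supported functional has a cutoff. -/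
theorem exists_isCutoff {u : 𝓓(M, ℝ) → ℂ} (hu : CompactlySupported u) : ∃ ψ, IsCutoff ψ u := by
  obtain ⟨K, hK, hKM, hv⟩ := hu
  obtain ⟨L, hL, hKL, hLM⟩ := exists_compact_between hK M.isOpen hKM
  obtain ⟨g, hg1, hg0, -⟩ := exists_contMDiffMap_one_nhds_of_subset_interior
    (modelWithCornersSelf ℝ E4) (n := ⊤) hK.isClosed hKL
  have hs : tsupport g ⊆ L := by
    apply closure_minimal _ hL.isClosed
    intro y hy
    by_contra hyL
    exact hy (hg0 y hyL)
  exact ⟨⟨g, g.contMDiff.contDiff, HasCompactSupport.intro' hL hL.isClosed hg0, hs.trans hLM⟩,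
    K, hK, hKM, hv, hg1⟩

/-- The chosen cutoff is a cutoff. -/
theorem isCutoff_cutoff {u : 𝓓(M, ℝ) → ℂ} (hu : CompactlySupported u) : IsCutoff (cutoff u) u := by
  have h := exists_isCutoff hu
  unfold cutoff
  rw [dif_pos h]
  exact h.choose_spec

theorem isTest_mul (ψ : 𝓓(M, ℝ)) {h : E4 → ℝ} (hh : ContDiffOn ℝ ∞ h M) :
    IsTest M (fun y => ψ y * h y) := by
  have hsub : tsupport (fun y => ψ y * h y) ⊆ tsupport ψ := tsupport_mul_subset_left
  refine ⟨?_, ψ.hasCompactSupport.mul_right, hsub.trans ψ.tsupport_subset⟩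
  refine contDiff_iff_contDiffAt.2 fun y => ?_
  by_cases hy : y ∈ M
  · exact ψ.contDiff.contDiffAt.mul (hh.contDiffAt (M.isOpen.mem_nhds hy))
  · have : (fun y => ψ y * h y) =ᶠ[𝓝 y] fun _ => 0 :=
      notMem_tsupport_iff_eventuallyEq.1 fun hy' => hy (ψ.tsupport_subset (hsub hy'))
    exact contDiffAt_const.congr_of_eventuallyEq this

theorem evalReal_congr_mul (u : 𝓓'(M, ℂ)) {ψ₁ ψ₂ : 𝓓(M, ℝ)}
    (h₁ : IsCutoff ψ₁ (fun φ => u φ)) (h₂ : IsCutoff ψ₂ (fun φ => u φ)) {h : E4 → ℝ}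
    (hh : ContDiffOn ℝ ∞ h M) :
    evalReal (fun φ => u φ) (fun y => ψ₁ y * h y) =
      evalReal (fun φ => u φ) (fun y => ψ₂ y * h y) := by
  have key : ∀ (χ ψ : 𝓓(M, ℝ)), IsCutoff ψ (fun φ => u φ) →
      evalReal (fun φ => u φ) (fun y => χ y * h y) =
        evalReal (fun φ => u φ) (fun y => χ y * (ψ y * h y)) := by
    rintro χ ψ ⟨K, -, -, hv, h1⟩
    have t1 := isTest_mul χ hh
    have t2 := isTest_mul χ (ψ.contDiff.contDiffOn.mul hh : ContDiffOn ℝ ∞ (fun y => ψ y * h y) M)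
    rw [evalReal, evalReal, dif_pos t1, dif_pos t2, ← sub_eq_zero, ← map_sub]
    refine hv _ fun y hy hyK => ?_
    refine (notMem_tsupport_iff_eventuallyEq.2 ?_) hy
    filter_upwards [(eventually_nhdsSet_iff_forall.1 h1) y hyK] with z hz
    change χ z * h z - χ z * (ψ z * h z) = 0
    rw [hz]; ring
  rw [key ψ₁ ψ₂ h₂, key ψ₂ ψ₁ h₁]
  congr 1
  funext y
  ring

/-- The pairing does not depend on the choice of the cutoff. -/
theorem pairSmooth_eq (u : 𝓓'(M, ℂ)) {ψ : 𝓓(M, ℝ)} (hψ : IsCutoff ψ (fun φ => u φ))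
    {h : E4 → ℂ} (hh : ContDiffOn ℝ ∞ h M) :
    pairSmooth (fun φ => u φ) h = evalC (fun φ => u φ) (fun y => (ψ y : ℂ) * h y) := by
  have hc : IsCutoff (cutoff (fun φ => u φ)) (fun φ => u φ) := by
    obtain ⟨K, hK, hKM, hv, -⟩ := hψ
    exact isCutoff_cutoff ⟨K, hK, hKM, hv⟩
  have hre : ContDiffOn ℝ ∞ (fun y => (h y).re) M := Complex.reCLM.contDiff.comp_contDiffOn hh
  have him : ContDiffOn ℝ ∞ (fun y => (h y).im) M := Complex.imCLM.contDiff.comp_contDiffOn hh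
  unfold pairSmooth evalC
  simp only [Complex.re_ofReal_mul, Complex.im_ofReal_mul]
  rw [evalReal_congr_mul u hc hψ hre, evalReal_congr_mul u hc hψ him]

/-- The product `φ u` of `φ ∈ C_0^∞(M)` and a functional `u` on test functions. -/
def cutMul (φ : 𝓓(M, ℝ)) (u : 𝓓(M, ℝ) → ℂ) : 𝓓(M, ℝ) → ℂ :=
  fun θ => evalReal u (fun y => φ y * θ y)

/-- The exponential `y ↦ e^{-i y·ξ}`. -/
def waveNeg (ξ y : E4) : ℂ := Complex.exp (-(Complex.I * (inner ℝ y ξ : ℝ)))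

/-- The Fourier transform `û(ξ) = u(e^{-i y·ξ})` of a compactly supported `u`. -/
def fourierCompact (u : 𝓓(M, ℝ) → ℂ) (ξ : E4) : ℂ := pairSmooth u (waveNeg ξ)

/-- Open cones in the space of covectors. -/
def IsOpenCone (Γ : Set E4) : Prop :=
  IsOpen Γ ∧ ∀ η ∈ Γ, ∀ t : ℝ, 0 < t → t • η ∈ Γ

/-- `(x, ξ)` is in the wave front set of the vector `u = (u_k)` of distributions on `M`:
`x ∈ M`, `ξ ≠ 0`, and there are no `φ ∈ C_0^∞(M)` with `φ(x) ≠ 0` and no open cone `Γ ∋ ξ` such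
that the Fourier transform `u(φ e^{-i y·η})` of `φ u` is rapidly decreasing in `Γ`. -/
def InWF {κ : Type*} [Fintype κ] (u : κ → 𝓓(M, ℝ) → ℂ) (x ξ : E4) : Prop :=
  x ∈ M ∧ ξ ≠ 0 ∧
    ¬ ∃ (φ : 𝓓(M, ℂ)) (Γ : Set E4), φ x ≠ 0 ∧ IsOpenCone Γ ∧ ξ ∈ Γ ∧
      ∀ N : ℕ, ∃ C : ℝ, ∀ η ∈ Γ,
        ‖fun k => evalC (u k) (fun y => φ y * waveNeg η y)‖ ≤ C / (1 + ‖η‖) ^ N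

end Functionals

/-! ### Pseudodifferential operators -/

/-- The symbol class `S^m_{1,0}(T^*M)`: `a` is smooth on `M × ℝ⁴`, and its derivatives of order
`j` in `ξ` and `l` in `x` are `O((1 + |ξ|)^{m - j})`, locally uniformly in `x ∈ M`. -/
structure IsSymbol (M : Opens E4) (m : ℝ) (a : E4 → E4 → ℂ) : Prop where
  smooth : ContDiffOn ℝ ∞ (fun p : E4 × E4 => a p.1 p.2) ((M : Set E4) ×ˢ Set.univ)
  bound : ∀ K : Set E4, IsCompact K → K ⊆ (M : Set E4) → ∀ j l : ℕ, ∃ C : ℝ, ∀ x ∈ K, ∀ ξ : E4,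
    ‖iteratedFDeriv ℝ j (fun η => iteratedFDeriv ℝ l (fun y => a y η) x) ξ‖ ≤
      C * (1 + ‖ξ‖) ^ (m - j)

/-- A (scalar) pseudodifferential operator of order `m` on `M`: the sum of the left quantization of
a symbol in `S^m(T^*M)` and an operator with Schwartz kernel in `C^∞(M × M)`. Every
pseudodifferential operator on an open subset of `ℝ⁴` is of this form. -/
structure PsiDO (M : Opens E4) (m : ℝ) where
  /-- the full symbol -/
  symbol : E4 → E4 → ℂ
  /-- the kernel of the smoothing part -/
  kernel : E4 → E4 → ℂ
  isSymbol : IsSymbol M m symbol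
  smooth_kernel :
    ContDiffOn ℝ ∞ (fun p : E4 × E4 => kernel p.1 p.2) ((M : Set E4) ×ˢ (M : Set E4))

section Operators

variable {M : Opens E4} {m : ℝ}

/-- The action of a pseudodifferential operator on a compactly supported `u`. Formally
`A u (x) = (2π)^{-4} ∫ e^{i x·ξ} a(x, ξ) û(ξ) dξ + ∫ K(x, y) u(y) dy`, as a distribution in `x`. -/
def PsiDO.apply (A : PsiDO M m) (u : 𝓓(M, ℝ) → ℂ) : 𝓓(M, ℝ) → ℂ := fun φ =>
  ((2 * Real.pi : ℝ) : ℂ)⁻¹ ^ 4 *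
      (∫ ξ : E4, fourierCompact u ξ *
        ∫ x : E4, Complex.exp (Complex.I * (inner ℝ x ξ : ℝ)) * A.symbol x ξ * (φ x : ℂ)) +
    pairSmooth u (fun y => ∫ x : E4, A.kernel x y * (φ x : ℂ))

/-- A matrix of pseudodifferential operators acting on a vector of compactly supported `u_i`. -/
def applyMatrix {κ ι : Type*} [Fintype ι] (A : κ → ι → PsiDO M m) (u : ι → 𝓓(M, ℝ) → ℂ) :
    κ → 𝓓(M, ℝ) → ℂ :=
  fun k φ => ∑ i, (A k i).apply (u i) φ

end Operators

/-! ### The Minkowski metric and the symbol of the projection -/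

/-- The Minkowski metric `diag(-1, 1, 1, 1)`; the inverse metric `g^{ij}` has the same matrix. -/
def mink (i j : Fin 4) : ℝ := if i = j then (if i = 0 then -1 else 1) else 0

/-- `g(ξ, ξ) = g^{ij} ξ_i ξ_j`. -/
def minkSq (ξ : E4) : ℝ := ∑ i, ∑ j, mink i j * ξ i * ξ j

/-- Spacelike covectors. -/
def Spacelike (ξ : E4) : Prop := 0 < minkSq ξ

/-- The normalized covector `η_k = ξ_k / √g(ξ, ξ)`. -/
def etaLow (ξ : E4) (k : Fin 4) : ℝ := ξ k / Real.sqrt (minkSq ξ)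

/-- `η^i = g^{ij} η_j`. -/
def etaUp (ξ : E4) (i : Fin 4) : ℝ := ∑ j, mink i j * etaLow ξ j

/-- `κ^i_k = δ^i_k - η_k η^i`. -/
def kappa (ξ : E4) (i k : Fin 4) : ℝ := (if i = k then 1 else 0) - etaLow ξ k * etaUp ξ i

/-- `λ^{ij}_{kl} = κ^i_k κ^j_l`. -/
def lam (ξ : E4) (i j k l : Fin 4) : ℝ := kappa ξ i k * kappa ξ j l

/-- `μ_{kl} = g_{kl} - η_k η_l`. -/
def muLow (ξ : E4) (k l : Fin 4) : ℝ := mink k l - etaLow ξ k * etaLow ξ l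

/-- `h^{ij} = g^{ij} - η^i η^j`. -/
def hUp (ξ : E4) (i j : Fin 4) : ℝ := mink i j - etaUp ξ i * etaUp ξ j

/-- The symbol `P = λ - (μ ⊗ h) / 3`, that is, `P^{ij}_{kl} = λ^{ij}_{kl} - μ_{kl} h^{ij} / 3`,
acting by `(P f)_{kl} = P^{ij}_{kl} f_{ij}`. The first index pair below is `(k, l)`. -/
def projSymbol (ξ : E4) (kl ij : Ix2) : ℝ :=
  lam ξ ij.1 ij.2 kl.1 kl.2 - muLow ξ kl.1 kl.2 * hUp ξ ij.1 ij.2 / 3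

/-- The symbol `P` lives only on the cone of spacelike covectors. The matrix `Q` of
pseudodifferential operators of order zero realizes it microlocally near `(x, ξ)`: the full symbol
of `Q` equals `P` in a conic neighbourhood of `(x, ξ)`, for large covectors. -/
def RealizesProjection {M : Opens E4} (Q : Ix2 → Ix2 → PsiDO M 0) (x ξ : E4) : Prop :=
  ∃ U ∈ 𝓝 x, ∃ Γ : Set E4, IsOpenCone Γ ∧ ξ ∈ Γ ∧ ∃ R : ℝ,
    ∀ y ∈ U, ∀ η ∈ Γ, R ≤ ‖η‖ → ∀ kl ij, (Q kl ij).symbol y η = (projSymbol η kl ij : ℂ)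

/-! ### Gauge fields -/

/-- Distributions with values in symmetric 2-tensors, in components. -/
def IsSymTensor {M : Opens E4} (f : Ix2 → 𝓓'(M, ℂ)) : Prop :=
  ∀ i j, f (i, j) = f (j, i)

/-- The symmetric differential `(d^s w)_{ij} = (∂_i w_j + ∂_j w_i) / 2` in Minkowski space. -/
def symDiff {M : Opens E4} (w : Fin 4 → 𝓓'(M, ℂ)) : Ix2 → 𝓓'(M, ℂ) := fun p =>
  (1 / 2 : ℝ) • (∂_{(EuclideanSpace.single p.1 (1 : ℝ) : E4)} (w p.2) +
    ∂_{(EuclideanSpace.single p.2 (1 : ℝ) : E4)} (w p.1))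

/-- The tensor field `c g + d^s w`. -/
def gauge {M : Opens E4} (c : 𝓓'(M, ℂ)) (w : Fin 4 → 𝓓'(M, ℂ)) : Ix2 → 𝓓'(M, ℂ) := fun p =>
  mink p.1 p.2 • c + symDiff w p

/-- The functional underlying each component of a vector of distributions. -/
def toFunctional {M : Opens E4} {κ : Type*} (f : κ → 𝓓'(M, ℂ)) : κ → 𝓓(M, ℝ) → ℂ :=
  fun k φ => f k φ

/-- `A (c g + d^s w) = 0` for all compactly supported distributions `c` and `w`. -/
def AnnihilatesGauge {M : Opens E4} {m : ℝ} {κ : Type*} (A : κ → Ix2 → PsiDO M m) : Prop :=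
  ∀ (c : 𝓓'(M, ℂ)) (w : Fin 4 → 𝓓'(M, ℂ)), CompactlySupported (fun φ => c φ) →
    (∀ i, CompactlySupported (fun φ => w i φ)) →
      applyMatrix A (toFunctional (gauge c w)) = 0

end LightRay

end

/-!
Near a spacelike covector the symbol `P(ζ)` is a projection whose kernel on symmetric tensors is
exactly the range of the symbol of `(c, w) ↦ c g + d^s w`. This is linear algebra at each `ζ`: the
projection kills the gauge symbol (`sum_projSymbol_mul_gaugeSymbol`), and every symmetric `f` is
`P f` plus the gauge symbol of an explicit `c` and `w` (`projSymbol_add_gaugeSymbol`), with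
coefficients that are of polynomial growth in `ζ` where `g(ζ, ζ) ≥ 1`. Since `P`, `c` and `w`
depend on the covector alone, these identities turn into statements on distributions without
any symbolic calculus: localizing `A u` by a test function `φ` and taking the Fourier transform
gives
`η ↦ (2π)^{-4} ∫ û(ζ) (φ a(·, ζ))^(η - ζ) dζ`, plus a rapidly decreasing term from the smooth kernel.
The integrand decreases rapidly in `η - ζ`, so that for `η` in a narrow cone around `ξ` only the
values of `û(ζ)` and `a(·, ζ)` for large `ζ` in a slightly wider cone matter (`rapidOn_integral`).
If the sum of such integrands vanishes there, the result is microlocally smooth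
(`rapidOn_integral_sum`).

Two facts follow. Gauge fields are mapped by `P` to fields that are smooth at `(x, ξ)`
(`microSmooth_projection_gauge`). And for each `f` there are compactly supported `c` and `w` such
that `P f - f + (c g + d^s w)` is smooth at `(x, ξ)` (`exists_gauge_correction`); they are obtained
by applying to `f` the Fourier multipliers of the decomposition, cut off sharply to
`g(ζ, ζ) ≥ 1`, and multiplying by a test function that is `1` near `x`. The cutoff may be sharp since
the multipliers need no smoothness in `ζ` for the argument above.

The other ingredient is that pseudodifferential operators do not enlarge wave front sets
(`PsiDO.microSmooth_act`). In its proof `u` is split into a part supported near `x`, for which the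
cone argument suffices, and a part supported away from `x`. For the latter the kernel of the operator
is smooth, by integrations by parts in the covector (`rapidOn_of_disjoint`). Interchanging
distributions and integrals rests on writing a distribution, on a compact set, as a continuous
functional of finitely many derivatives (`exists_jet_functional`, `evalC_mul_eq_integral`).

The theorem is then algebra. If `f + (c g + d^s w)` is smooth at `(x, ξ)`, so are its image under `P`
and hence `P f`; conversely, if `P f` is smooth there, so is `f - (c g + d^s w)` for the gauge field
found above. An operator `A` that annihilates gauge fields maps `φ P f - f` to
`A (φ P f - f + (c g + d^s w))`, which is smooth at `(x, ξ)`.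
-/

open scoped Distributions LineDeriv Topology ContDiff
open TopologicalSpace Distribution MeasureTheory

noncomputable section

namespace LightRay

/-! ### Iterated directional derivatives -/

section Directional

variable {V W : Type*} [NormedAddCommGroup V] [NormedSpace ℝ V] [NormedAddCommGroup W]
  [NormedSpace ℝ W]

/-- The directional derivative of `f` along `v`. -/
def dd (v : V) (f : V → ℂ) : V → ℂ := fun x => fderiv ℝ f x v

/-- The iterated directional derivative of `f` along the vectors of a list, the head first. -/
def dds : List V → (V → ℂ) → V → ℂ
  | [], f => f
  | v :: l, f => dds l (dd v f)

variable {O : Set V} {f g : V → ℂ}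

theorem contDiffOn_dd (hO : IsOpen O) (hf : ContDiffOn ℝ ∞ f O) (v : V) :
    ContDiffOn ℝ ∞ (dd v f) O :=
  (hf.fderiv_of_isOpen hO (by simp)).clm_apply contDiffOn_const

theorem contDiffOn_dds (hO : IsOpen O) (l : List V) :
    ∀ {f : V → ℂ}, ContDiffOn ℝ ∞ f O → ContDiffOn ℝ ∞ (dds l f) O := by
  induction l with
  | nil => exact fun hf => hf
  | cons v l ih => exact fun hf => ih (contDiffOn_dd hO hf v)

theorem contDiff_dd (hf : ContDiff ℝ ∞ f) (v : V) : ContDiff ℝ ∞ (dd v f) :=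
  contDiffOn_univ.1 (contDiffOn_dd isOpen_univ hf.contDiffOn v)

theorem contDiff_dds (hf : ContDiff ℝ ∞ f) (l : List V) : ContDiff ℝ ∞ (dds l f) :=
  contDiffOn_univ.1 (contDiffOn_dds isOpen_univ l hf.contDiffOn)

theorem differentiableAt_of_contDiffOn (hO : IsOpen O) (hf : ContDiffOn ℝ ∞ f O) {x : V}
    (hx : x ∈ O) : DifferentiableAt ℝ f x :=
  (hf.contDiffAt (hO.mem_nhds hx)).differentiableAt (by simp)

theorem dd_eqOn (hO : IsOpen O) (h : Set.EqOn f g O) (v : V) : Set.EqOn (dd v f) (dd v g) O := by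
  intro x hx
  simp only [dd]
  rw [Filter.EventuallyEq.fderiv_eq (Filter.eventuallyEq_of_mem (hO.mem_nhds hx) h)]

theorem dds_eqOn (hO : IsOpen O) (l : List V) :
    ∀ {f g : V → ℂ}, Set.EqOn f g O → Set.EqOn (dds l f) (dds l g) O := by
  induction l with
  | nil => exact fun h => h
  | cons v l ih => exact fun h => ih (dd_eqOn hO h v)

theorem dd_add_eqOn (hO : IsOpen O) (hf : ContDiffOn ℝ ∞ f O) (hg : ContDiffOn ℝ ∞ g O) (v : V) :
    Set.EqOn (dd v (f + g)) (dd v f + dd v g) O := by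
  intro x hx
  simp only [dd, Pi.add_apply]
  rw [fderiv_add (differentiableAt_of_contDiffOn hO hf hx)
    (differentiableAt_of_contDiffOn hO hg hx)]
  rfl

theorem dds_add_eqOn (hO : IsOpen O) (l : List V) :
    ∀ {f g : V → ℂ}, ContDiffOn ℝ ∞ f O → ContDiffOn ℝ ∞ g O →
      Set.EqOn (dds l (f + g)) (dds l f + dds l g) O := by
  induction l with
  | nil => exact fun _ _ _ _ => rfl
  | cons v l ih =>
    intro f g hf hg x hx
    exact (dds_eqOn hO l (dd_add_eqOn hO hf hg v) hx).trans
      (ih (contDiffOn_dd hO hf v) (contDiffOn_dd hO hg v) hx)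

theorem dd_mul_eqOn (hO : IsOpen O) (hf : ContDiffOn ℝ ∞ f O) (hg : ContDiffOn ℝ ∞ g O) (v : V) :
    Set.EqOn (dd v (f * g)) (dd v f * g + f * dd v g) O := by
  intro x hx
  simp only [dd, Pi.add_apply, Pi.mul_apply]
  rw [fderiv_mul (differentiableAt_of_contDiffOn hO hf hx)
    (differentiableAt_of_contDiffOn hO hg hx)]
  simp only [add_apply, smul_apply, smul_eq_mul]
  ring

theorem dd_const_mul (c : ℂ) (f : V → ℂ) (hf : ContDiff ℝ ∞ f) (v : V) :
    dd v (fun x => c * f x) = fun x => c * dd v f x := by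
  funext x
  simp only [dd]
  rw [fderiv_const_mul (hf.differentiable (by simp) x)]
  simp

theorem dds_const_mul (c : ℂ) (l : List V) : ∀ {f : V → ℂ}, ContDiff ℝ ∞ f →
    dds l (fun x => c * f x) = fun x => c * dds l f x := by
  induction l with
  | nil => exact fun _ => rfl
  | cons v l ih =>
    intro f hf
    simp only [dds]
    rw [dd_const_mul c f hf v, ih (contDiff_dd hf v)]

theorem dds_add (hf : ContDiff ℝ ∞ f) (hg : ContDiff ℝ ∞ g) (l : List V) :
    dds l (f + g) = dds l f + dds l g :=
  funext fun x => dds_add_eqOn isOpen_univ l hf.contDiffOn hg.contDiffOn (Set.mem_univ x)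

theorem dd_mul (hf : ContDiff ℝ ∞ f) (hg : ContDiff ℝ ∞ g) (v : V) :
    dd v (f * g) = dd v f * g + f * dd v g :=
  funext fun x => dd_mul_eqOn isOpen_univ hf.contDiffOn hg.contDiffOn v (Set.mem_univ x)

theorem dds_zero (l : List V) : dds l (fun _ : V => (0 : ℂ)) = fun _ => 0 := by
  induction l with
  | nil => rfl
  | cons v l ih =>
    have : dd v (fun _ : V => (0 : ℂ)) = fun _ => 0 := by
      funext x; simp [dd]
    simp only [dds, this, ih]

theorem dd_comm_eqOn (hO : IsOpen O) (hf : ContDiffOn ℝ ∞ f O) (v w : V) :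
    Set.EqOn (dd v (dd w f)) (dd w (dd v f)) O := by
  intro x hx
  have hd : DifferentiableAt ℝ (fderiv ℝ f) x :=
    ((hf.fderiv_of_isOpen (m := ∞) hO (by simp)).contDiffAt (hO.mem_nhds hx)).differentiableAt
      (by simp)
  have key : ∀ a b : V, dd a (dd b f) x = fderiv ℝ (fderiv ℝ f) x a b := by
    intro a b
    change fderiv ℝ (fun y => fderiv ℝ f y b) x a = _
    rw [fderiv_clm_apply hd (differentiableAt_const b)]
    simp
  rw [key, key]
  have hs : IsSymmSndFDerivAt ℝ f x :=
    (hf.contDiffAt (hO.mem_nhds hx)).isSymmSndFDerivAt (by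
      rw [minSmoothness_of_isRCLikeNormedField]
      exact WithTop.coe_le_coe.2 (le_top : (2 : ℕ∞) ≤ ⊤))
  exact hs v w

theorem dds_dd_eqOn (hO : IsOpen O) (v : V) (l : List V) :
    ∀ {f : V → ℂ}, ContDiffOn ℝ ∞ f O → Set.EqOn (dds l (dd v f)) (dd v (dds l f)) O := by
  induction l with
  | nil => exact fun _ _ _ => rfl
  | cons w l ih =>
    intro f hf x hx
    exact (dds_eqOn hO l (dd_comm_eqOn hO hf w v) hx).trans (ih (contDiffOn_dd hO hf w) hx)

theorem dds_comp_eqOn {O' : Set W} (hO : IsOpen O) (hO' : IsOpen O') (T : W →L[ℝ] V)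
    (hT : Set.MapsTo T O' O) (l : List W) : ∀ {f : V → ℂ}, ContDiffOn ℝ ∞ f O →
      Set.EqOn (dds l (fun y => f (T y))) (fun y => dds (l.map T) f (T y)) O' := by
  induction l with
  | nil => exact fun _ _ _ => rfl
  | cons w l ih =>
    intro f hf
    have h1 : Set.EqOn (dd w (fun y => f (T y))) (fun y => dd (T w) f (T y)) O' := by
      intro y hy
      have h := (differentiableAt_of_contDiffOn hO hf (hT hy)).hasFDerivAt.comp y T.hasFDerivAt
      have h' : fderiv ℝ (fun y => f (T y)) y = (fderiv ℝ f (T y)).comp T := h.fderiv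
      simp only [dd, h']
      rfl
    intro y hy
    exact (dds_eqOn hO' l h1 hy).trans (ih (contDiffOn_dd hO hf (T w)) hy)

theorem dds_eq_zero_of_eqOn (hO : IsOpen O) (l : List V) (h : Set.EqOn f (fun _ => 0) O) :
    Set.EqOn (dds l f) (fun _ => 0) O := fun x hx => by
  rw [dds_eqOn hO l h hx, dds_zero]

theorem tsupport_dds_subset (l : List V) : ∀ f : V → ℂ, tsupport (dds l f) ⊆ tsupport f := by
  intro f
  refine closure_minimal (fun x hx => ?_) isClosed_closure
  by_contra h
  exact hx (dds_eq_zero_of_eqOn (isClosed_tsupport f).isOpen_compl l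
    (fun y hy => image_eq_zero_of_notMem_tsupport hy) h)

end Directional

/-! ### Families of symbols -/

section Symbols

variable {X Y ι : Type*} [NormedAddCommGroup X] [NormedSpace ℝ X] [NormedAddCommGroup Y]
  [NormedSpace ℝ Y]

/-- Directional derivatives in the space variables of a function on `X × E4`. -/
def dX (l : List X) (a : X × E4 → ℂ) : X × E4 → ℂ := dds (l.map fun u => (u, (0 : E4))) a

/-- Directional derivatives in the covector of a function on `X × E4`. -/
def dZ (l : List E4) (a : X × E4 → ℂ) : X × E4 → ℂ := dds (l.map fun v => ((0 : X), v)) a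

/-- A family `a_i` of symbols of order `m` with space variables in the open set `O`, for which the
symbol estimates hold uniformly in `i` and in the space variables in `K ⊆ O`. Derivatives are
iterated directional ones, those in the space variables being taken first. -/
structure SymOn (O K : Set X) (m : ℝ) (a : ι → X × E4 → ℂ) : Prop where
  isOpen : IsOpen O
  subset : K ⊆ O
  smooth : ∀ i, ContDiffOn ℝ ∞ (a i) (O ×ˢ Set.univ)
  bound : ∀ (zs : List E4) (xs : List X), ∃ C : ℝ, ∀ i p, p.1 ∈ K →
    ‖dZ zs (dX xs (a i)) p‖ ≤ C * (1 + ‖p.2‖) ^ (m - zs.length)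

namespace SymOn

variable {O K : Set X} {m m' : ℝ} {a b : ι → X × E4 → ℂ}

theorem isOpen' (h : SymOn O K m a) : IsOpen (O ×ˢ (Set.univ : Set E4)) := h.isOpen.prod isOpen_univ

theorem mem (h : SymOn O K m a) {p : X × E4} (hp : p.1 ∈ K) : p ∈ O ×ˢ (Set.univ : Set E4) :=
  ⟨h.subset hp, Set.mem_univ _⟩

theorem bound_self (h : SymOn O K m a) : ∃ C : ℝ, 0 ≤ C ∧ ∀ i p, p.1 ∈ K →
    ‖a i p‖ ≤ C * (1 + ‖p.2‖) ^ m := by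
  obtain ⟨C, hC⟩ := h.bound [] []
  refine ⟨max C 0, le_max_right _ _, fun i p hp => ?_⟩
  have := hC i p hp
  simp only [List.length_nil, Nat.cast_zero, sub_zero] at this
  refine this.trans (mul_le_mul_of_nonneg_right (le_max_left _ _) (by positivity))

theorem dx (h : SymOn O K m a) (u : X) : SymOn O K m (fun i => dd (u, (0 : E4)) (a i)) :=
  ⟨h.isOpen, h.subset, fun i => contDiffOn_dd h.isOpen' (h.smooth i) _,
    fun zs xs => h.bound zs (u :: xs)⟩

theorem dz (h : SymOn O K m a) (v : E4) : SymOn O K (m - 1) (fun i => dd ((0 : X), v) (a i)) := by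
  refine ⟨h.isOpen, h.subset, fun i => contDiffOn_dd h.isOpen' (h.smooth i) _, fun zs xs => ?_⟩
  obtain ⟨C, hC⟩ := h.bound (v :: zs) xs
  refine ⟨C, fun i p hp => ?_⟩
  have e : dZ zs (dX xs (dd ((0 : X), v) (a i))) p = dZ (v :: zs) (dX xs (a i)) p :=
    dds_eqOn h.isOpen' _ (dds_dd_eqOn h.isOpen' _ _ (h.smooth i)) (h.mem hp)
  rw [e]
  refine (hC i p hp).trans (le_of_eq ?_)
  congr 2
  push_cast [List.length_cons]
  ring

theorem mul_bound_dZ (zs : List E4) : ∀ {m m' : ℝ} {a b : ι → X × E4 → ℂ}, SymOn O K m a →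
    SymOn O K m' b → ∃ C : ℝ, ∀ i p, p.1 ∈ K →
      ‖dZ zs (a i * b i) p‖ ≤ C * (1 + ‖p.2‖) ^ (m + m' - zs.length) := by
  induction zs with
  | nil =>
    intro m m' a b ha hb
    obtain ⟨C, hC0, hC⟩ := ha.bound_self
    obtain ⟨D, hD0, hD⟩ := hb.bound_self
    refine ⟨C * D, fun i p hp => ?_⟩
    have e : dZ [] (a i * b i) p = a i p * b i p := rfl
    have h1 : (0 : ℝ) < 1 + ‖p.2‖ := by positivity
    simp only [e, norm_mul, List.length_nil, Nat.cast_zero, sub_zero]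
    rw [Real.rpow_add h1]
    calc ‖a i p‖ * ‖b i p‖ ≤ (C * (1 + ‖p.2‖) ^ m) * (D * (1 + ‖p.2‖) ^ m') :=
          mul_le_mul (hC i p hp) (hD i p hp) (norm_nonneg _) (by positivity)
      _ = _ := by ring
  | cons v zs ih =>
    intro m m' a b ha hb
    obtain ⟨C, hC⟩ := ih (ha.dz v) hb
    obtain ⟨D, hD⟩ := ih ha (hb.dz v)
    refine ⟨C + D, fun i p hp => ?_⟩
    have e : dZ (v :: zs) (a i * b i) p =
        dZ zs (dd ((0 : X), v) (a i) * b i) p + dZ zs (a i * dd ((0 : X), v) (b i)) p :=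
      (dds_eqOn ha.isOpen' _ (dd_mul_eqOn ha.isOpen' (ha.smooth i) (hb.smooth i) _)
        (ha.mem hp)).trans (dds_add_eqOn ha.isOpen' _
          (((ha.dz v).smooth i).mul (hb.smooth i)) ((ha.smooth i).mul ((hb.dz v).smooth i))
          (ha.mem hp))
    have e1 : m - 1 + m' - (zs.length : ℝ) = m + m' - ((v :: zs).length : ℝ) := by
      push_cast [List.length_cons]; ring
    have e2 : m + (m' - 1) - (zs.length : ℝ) = m + m' - ((v :: zs).length : ℝ) := by
      push_cast [List.length_cons]; ring
    rw [e, add_mul]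
    have hC' := hC i p hp
    have hD' := hD i p hp
    rw [e1] at hC'
    rw [e2] at hD'
    exact (norm_add_le _ _).trans (add_le_add hC' hD')

theorem mul (ha : SymOn O K m a) (hb : SymOn O K m' b) :
    SymOn O K (m + m') (fun i => a i * b i) := by
  refine ⟨ha.isOpen, ha.subset, fun i => (ha.smooth i).mul (hb.smooth i), fun zs xs => ?_⟩
  induction xs generalizing a b with
  | nil => exact mul_bound_dZ zs ha hb
  | cons u xs ih =>
    obtain ⟨C, hC⟩ := ih (ha.dx u) hb
    obtain ⟨D, hD⟩ := ih ha (hb.dx u)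
    refine ⟨C + D, fun i p hp => ?_⟩
    have s1 := ((ha.dx u).smooth i).mul (hb.smooth i)
    have s2 := (ha.smooth i).mul ((hb.dx u).smooth i)
    have e0 : Set.EqOn (dX (u :: xs) (a i * b i))
        (dX xs (dd (u, (0 : E4)) (a i) * b i) + dX xs (a i * dd (u, (0 : E4)) (b i)))
        (O ×ˢ Set.univ) := fun q hq =>
      (dds_eqOn ha.isOpen' _ (dd_mul_eqOn ha.isOpen' (ha.smooth i) (hb.smooth i) _) hq).trans
        (dds_add_eqOn ha.isOpen' _ s1 s2 hq)
    have e : dZ zs (dX (u :: xs) (a i * b i)) p =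
        dZ zs (dX xs (dd (u, (0 : E4)) (a i) * b i)) p +
          dZ zs (dX xs (a i * dd (u, (0 : E4)) (b i))) p :=
      (dds_eqOn ha.isOpen' _ e0 (ha.mem hp)).trans (dds_add_eqOn ha.isOpen' _
          (contDiffOn_dds ha.isOpen' _ s1) (contDiffOn_dds ha.isOpen' _ s2) (ha.mem hp))
    rw [e, add_mul]
    exact (norm_add_le _ _).trans (add_le_add (hC i p hp) (hD i p hp))

theorem mono {O' K' : Set X} (h : SymOn O K m a) (hO' : IsOpen O') (hOO : O' ⊆ O) (hK : K' ⊆ K)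
    (hK' : K' ⊆ O') : SymOn O' K' m a :=
  ⟨hO', hK', fun i => (h.smooth i).mono (Set.prod_mono hOO le_rfl), fun zs xs => by
    obtain ⟨C, hC⟩ := h.bound zs xs
    exact ⟨C, fun i p hp => hC i p (hK hp)⟩⟩

theorem comp (h : SymOn O K m a) (T : Y →L[ℝ] X) :
    SymOn (T ⁻¹' O) (T ⁻¹' K) m (fun i p => a i (T p.1, p.2)) := by
  have hO' : IsOpen (T ⁻¹' O) := h.isOpen.preimage T.continuous
  have hO'' : IsOpen ((T ⁻¹' O) ×ˢ (Set.univ : Set E4)) := hO'.prod isOpen_univ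
  let S : Y × E4 →L[ℝ] X × E4 := T.prodMap (ContinuousLinearMap.id ℝ E4)
  have hS : Set.MapsTo S ((T ⁻¹' O) ×ˢ Set.univ) (O ×ˢ Set.univ) := fun p hp => ⟨hp.1, trivial⟩
  refine ⟨hO', Set.preimage_mono h.subset,
    fun i => (h.smooth i).comp S.contDiff.contDiffOn hS, fun zs xs => ?_⟩
  obtain ⟨C, hC⟩ := h.bound zs (xs.map T)
  refine ⟨C, fun i p hp => ?_⟩
  have e1 : Set.EqOn (dX xs (fun p => a i (S p))) (fun p => dX (xs.map T) (a i) (S p))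
      ((T ⁻¹' O) ×ˢ Set.univ) := fun q hq => by
    refine (dds_comp_eqOn h.isOpen' hO'' S hS _ (h.smooth i) hq).trans ?_
    simp [dX, S, Function.comp_def]
  have e : dZ zs (dX xs (fun p => a i (S p))) p = dZ zs (dX (xs.map T) (a i)) (S p) := by
    have hp' : p ∈ (T ⁻¹' O) ×ˢ (Set.univ : Set E4) := ⟨h.subset hp, trivial⟩
    refine (dds_eqOn hO'' _ e1 hp').trans ?_
    refine (dds_comp_eqOn h.isOpen' hO'' S hS _
      (contDiffOn_dds h.isOpen' _ (h.smooth i)) hp').trans ?_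
    simp [dZ, dX, S, Function.comp_def]
  exact e ▸ hC i (S p) hp

end SymOn

/-- A family of functions of the space variables with uniformly bounded derivatives is a family of
symbols of order zero. -/
theorem symOn_of_bdd {O K : Set X} (hO : IsOpen O) (hK : K ⊆ O) {f : ι → X → ℂ}
    (hf : ∀ i, ContDiffOn ℝ ∞ (f i) O)
    (hb : ∀ l : List X, ∃ C : ℝ, ∀ i, ∀ x ∈ K, ‖dds l (f i) x‖ ≤ C) :
    SymOn O K 0 (fun i p => f i p.1) := by
  have hO' : IsOpen (O ×ˢ (Set.univ : Set E4)) := hO.prod isOpen_univ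
  let S : X × E4 →L[ℝ] X := ContinuousLinearMap.fst ℝ X E4
  have hS : Set.MapsTo S (O ×ˢ Set.univ) O := fun p hp => hp.1
  have hmap : ∀ xs : List X, (xs.map fun u => (u, (0 : E4))).map S = xs := fun xs => by
    simp [S, Function.comp_def]
  have hmapZ : ∀ zs : List E4, (zs.map fun v => ((0 : X), v)).map S = zs.map fun _ => 0 :=
    fun zs => by simp [S, Function.comp_def]
  refine ⟨hO, hK, fun i => (hf i).comp S.contDiff.contDiffOn hS, fun zs xs => ?_⟩
  obtain ⟨C, hC⟩ := hb xs
  refine ⟨C, fun i p hp => ?_⟩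
  have hp' : p ∈ O ×ˢ (Set.univ : Set E4) := ⟨hK hp, trivial⟩
  have e1 : Set.EqOn (dX xs (fun p => f i (S p))) (fun p => dds xs (f i) (S p))
      (O ×ˢ Set.univ) := fun q hq => by
    refine (dds_comp_eqOn hO hO' S hS _ (hf i) hq).trans ?_
    simp only [hmap]
  have e : dZ zs (dX xs (fun p => f i (S p))) p =
      dds (zs.map fun _ => 0) (dds xs (f i)) (S p) := by
    refine (dds_eqOn hO' _ e1 hp').trans ?_
    refine (dds_comp_eqOn hO hO' S hS _ (contDiffOn_dds hO _ (hf i)) hp').trans ?_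
    simp only [hmapZ]
  change ‖dZ zs (dX xs (fun p => f i (S p))) p‖ ≤ _
  have hC0 : 0 ≤ C := (norm_nonneg _).trans (hC i p.1 hp)
  rw [e]
  cases zs with
  | nil => simpa [dds, S] using hC i p.1 hp
  | cons v zs =>
    have : dd (0 : X) (dds xs (f i)) = fun _ => 0 := by funext x; simp [dd]
    simp only [List.map_cons, dds, this, dds_zero, norm_zero]
    positivity

/-- A function that is smooth near a compact set of space variables is a symbol of order zero. -/
theorem symOn_of_contDiffOn {O K : Set X} (hO : IsOpen O) (hK : K ⊆ O) (hKc : IsCompact K)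
    {f : X → ℂ} (hf : ContDiffOn ℝ ∞ f O) : SymOn O K 0 (fun (_ : ι) p => f p.1) := by
  refine symOn_of_bdd hO hK (fun _ => hf) fun l => ?_
  obtain ⟨C, hC⟩ := hKc.exists_bound_of_continuousOn
    ((contDiffOn_dds hO l hf).continuousOn.mono hK)
  exact ⟨C, fun _ => hC⟩

end Symbols

/-! ### Symbols of pseudodifferential operators -/

section IsSymbol

variable {V F : Type*} [NormedAddCommGroup V] [NormedSpace ℝ V]

/-- Iterated directional derivatives are values of the iterated Fréchet derivative. -/
theorem exists_dds_eq_iteratedFDeriv {O : Set V} (hO : IsOpen O) (l : List V) :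
    ∃ v : Fin l.length → V, ∀ f : V → ℂ, ContDiffOn ℝ ∞ f O → ∀ x ∈ O,
      dds l f x = iteratedFDeriv ℝ l.length f x v := by
  induction l with
  | nil => exact ⟨Fin.elim0, fun f _ x _ => by simp [dds]⟩
  | cons w l ih =>
    obtain ⟨v, hv⟩ := ih
    refine ⟨Fin.snoc v w, fun f hf x hx => ?_⟩
    have hd : ContDiffAt ℝ ∞ (fderiv ℝ f) x :=
      (hf.fderiv_of_isOpen (m := ∞) hO (by simp)).contDiffAt (hO.mem_nhds hx)
    change dds l (dd w f) x = iteratedFDeriv ℝ (l.length + 1) f x (Fin.snoc v w)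
    rw [iteratedFDeriv_succ_apply_right, hv _ (contDiffOn_dd hO hf w) x hx]
    simp only [Fin.init_snoc, Fin.snoc_last]
    have h := (ContinuousLinearMap.apply ℝ ℂ w).iteratedFDeriv_comp_left hd
      (i := l.length) (WithTop.coe_le_coe.2 le_top)
    exact congrArg (fun q => q v) h

theorem norm_dds_le_iteratedFDeriv {O : Set V} (hO : IsOpen O) (l : List V) :
    ∃ C : ℝ, 0 ≤ C ∧ ∀ f : V → ℂ, ContDiffOn ℝ ∞ f O → ∀ x ∈ O,
      ‖dds l f x‖ ≤ C * ‖iteratedFDeriv ℝ l.length f x‖ := by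
  obtain ⟨v, hv⟩ := exists_dds_eq_iteratedFDeriv hO l
  refine ⟨∏ i, ‖v i‖, Finset.prod_nonneg fun _ _ => norm_nonneg _, fun f hf x hx => ?_⟩
  rw [hv f hf x hx, mul_comm]
  exact (iteratedFDeriv ℝ l.length f x).le_opNorm v

theorem dX_apply {O : Set V} (hO : IsOpen O) (l : List V) (ζ : E4) : ∀ {a : V × E4 → ℂ},
    ContDiffOn ℝ ∞ a (O ×ˢ Set.univ) → ∀ x ∈ O, dX l a (x, ζ) = dds l (fun y => a (y, ζ)) x := by
  induction l with
  | nil => exact fun _ _ _ => rfl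
  | cons u l ih =>
    intro a ha x hx
    have hO' : IsOpen (O ×ˢ (Set.univ : Set E4)) := hO.prod isOpen_univ
    refine (ih (contDiffOn_dd hO' ha _) x hx).trans (dds_eqOn hO l (fun y hy => ?_) hx)
    have h1 : HasFDerivAt a (fderiv ℝ a (y, ζ)) (y, ζ) :=
      (differentiableAt_of_contDiffOn hO' ha (x := (y, ζ)) ⟨hy, trivial⟩).hasFDerivAt
    have h := (h1.comp (f := fun y => (y, ζ)) y (hasFDerivAt_prodMk_left y ζ)).fderiv
    change _ = fderiv ℝ (a ∘ fun y => (y, ζ)) y u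
    rw [h]
    simp [dd]

theorem dZ_apply {O : Set V} (hO : IsOpen O) (l : List E4) (x : V) (hx : x ∈ O) :
    ∀ {a : V × E4 → ℂ}, ContDiffOn ℝ ∞ a (O ×ˢ Set.univ) → ∀ ζ,
      dZ l a (x, ζ) = dds l (fun η => a (x, η)) ζ := by
  induction l with
  | nil => exact fun _ _ => rfl
  | cons u l ih =>
    intro a ha ζ
    have hO' : IsOpen (O ×ˢ (Set.univ : Set E4)) := hO.prod isOpen_univ
    refine (ih (contDiffOn_dd hO' ha _) ζ).trans
      (congrFun (congrArg (dds l) (funext fun η => ?_)) ζ)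
    have h1 : HasFDerivAt a (fderiv ℝ a (x, η)) (x, η) :=
      (differentiableAt_of_contDiffOn hO' ha (x := (x, η)) ⟨hx, trivial⟩).hasFDerivAt
    have h := (h1.comp (f := fun η => (x, η)) η (hasFDerivAt_prodMk_right x η)).fderiv
    change _ = fderiv ℝ (a ∘ fun η => (x, η)) η u
    rw [h]
    simp [dd]

theorem contDiffOn_iteratedFDeriv_left {O : Set V} (hO : IsOpen O) {a : V × E4 → ℂ}
    (ha : ContDiffOn ℝ ∞ a (O ×ˢ Set.univ)) (l : ℕ) :
    ContDiffOn ℝ ∞ (fun p : V × E4 => iteratedFDeriv ℝ l (fun y => a (y, p.2)) p.1)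
      (O ×ˢ Set.univ) := by
  have hO' : IsOpen (O ×ˢ (Set.univ : Set E4)) := hO.prod isOpen_univ
  induction l with
  | zero =>
    have e : (fun p : V × E4 => iteratedFDeriv ℝ 0 (fun y => a (y, p.2)) p.1) =
        fun p => (continuousMultilinearCurryFin0 ℝ V ℂ).symm (a p) := by
      funext p; rw [iteratedFDeriv_zero_eq_comp]; rfl
    rw [e]
    exact (LinearIsometryEquiv.contDiff _).comp_contDiffOn ha
  | succ l ih =>
    intro p hp
    apply ContDiffAt.contDiffWithinAt
    have e : (fun p : V × E4 => iteratedFDeriv ℝ (l + 1) (fun y => a (y, p.2)) p.1) =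
        fun p => (continuousMultilinearCurryLeftEquiv ℝ (fun _ : Fin (l + 1) => V) ℂ).symm
          (fderiv ℝ (fun y => iteratedFDeriv ℝ l (fun y => a (y, p.2)) y) p.1) := by
      funext p; rw [iteratedFDeriv_succ_eq_comp_left]; rfl
    rw [e]
    refine (LinearIsometryEquiv.contDiff (𝕜 := ℝ) (E := V →L[ℝ] (V [×l]→L[ℝ] ℂ))
      (F := V [×(l + 1)]→L[ℝ] ℂ) (continuousMultilinearCurryLeftEquiv ℝ
      (fun _ : Fin (l + 1) => V) ℂ).symm).contDiffAt.comp p ?_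
    refine ContDiffAt.fderiv (n := ∞)
      (f := fun (p : V × E4) y => iteratedFDeriv ℝ l (fun y => a (y, p.2)) y) (g := Prod.fst)
      ?_ contDiff_fst.contDiffAt (by simp)
    have h1 : ContDiffAt ℝ ∞ (fun p : V × E4 => iteratedFDeriv ℝ l (fun y => a (y, p.2)) p.1)
        (p.1, p.2) := ih.contDiffAt (hO'.mem_nhds hp)
    have h2 : ContDiff ℝ ∞ (fun q : (V × E4) × V => (q.2, q.1.2)) := by fun_prop
    exact ContDiffAt.comp ((p, p.1) : (V × E4) × V) (f := fun q => (q.2, q.1.2)) h1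
      h2.contDiffAt

/-- A symbol of order `m` satisfies the estimates of `SymOn` on compact sets. -/
theorem IsSymbol.symOn {ι : Type*} {M : Opens E4} {m : ℝ} {a : E4 → E4 → ℂ} (ha : IsSymbol M m a)
    {K : Set E4} (hK : IsCompact K) (hKM : K ⊆ (M : Set E4)) :
    SymOn (M : Set E4) K m (fun (_ : ι) p => a p.1 p.2) := by
  refine ⟨M.isOpen, hKM, fun _ => ha.smooth, fun zs xs => ?_⟩
  obtain ⟨v, hv⟩ := exists_dds_eq_iteratedFDeriv M.isOpen xs
  obtain ⟨D, hD0, hD⟩ := norm_dds_le_iteratedFDeriv (isOpen_univ (X := E4)) zs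
  obtain ⟨C, hC⟩ := ha.bound K hK hKM zs.length xs.length
  let L := ContinuousMultilinearMap.apply ℝ (fun _ : Fin xs.length => E4) ℂ v
  have hO' : IsOpen ((M : Set E4) ×ˢ (Set.univ : Set E4)) := M.isOpen.prod isOpen_univ
  refine ⟨D * (‖L‖ * C), fun _ p hp => ?_⟩
  have hpM := hKM hp
  have hsm := contDiffOn_iteratedFDeriv_left M.isOpen (V := E4)
    (a := fun p : E4 × E4 => a p.1 p.2) ha.smooth xs.length
  have h1 : ContDiff ℝ ∞ (fun η : E4 => iteratedFDeriv ℝ xs.length (fun y => a y η) p.1) := by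
    rw [← contDiffOn_univ]
    exact hsm.comp (s := Set.univ) (f := fun η : E4 => (p.1, η)) (by fun_prop)
      (fun η _ => ⟨hpM, trivial⟩)
  have h2 : (fun η => dX xs (fun p : E4 × E4 => a p.1 p.2) (p.1, η)) =
      L ∘ fun η => iteratedFDeriv ℝ xs.length (fun y => a y η) p.1 := by
    funext η
    rw [dX_apply M.isOpen xs η ha.smooth p.1 hpM]
    refine hv _ ?_ p.1 hpM
    exact ha.smooth.comp (f := fun y : E4 => (y, η)) (by fun_prop) (fun y hy => ⟨hy, trivial⟩)
  have e : dZ zs (dX xs (fun p : E4 × E4 => a p.1 p.2)) p =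
      dds zs (L ∘ fun η => iteratedFDeriv ℝ xs.length (fun y => a y η) p.1) p.2 := by
    rw [← h2]
    exact dZ_apply M.isOpen zs p.1 hpM (contDiffOn_dds hO' _ ha.smooth) p.2
  rw [e]
  calc _ ≤ D * ‖iteratedFDeriv ℝ zs.length
        (L ∘ fun η => iteratedFDeriv ℝ xs.length (fun y => a y η) p.1) p.2‖ :=
        hD _ (L.contDiff.comp h1).contDiffOn _ trivial
    _ ≤ D * (‖L‖ * (C * (1 + ‖p.2‖) ^ (m - zs.length))) := by
        gcongr
        refine (L.norm_iteratedFDeriv_comp_left h1.contDiffAt (N := ∞)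
          (WithTop.coe_le_coe.2 le_top)).trans ?_
        gcongr
        exact hC p.1 hp p.2
    _ = _ := by ring

end IsSymbol

/-! ### Amplitudes and their partial Fourier transforms -/

section Amplitudes

variable {X ι : Type*} [NormedAddCommGroup X] [NormedSpace ℝ X]

/-- A family of symbols whose space variables are confined to the compact set `K`. -/
structure Amp (K : Set X) (m : ℝ) (a : ι → X × E4 → ℂ) : Prop where
  compact : IsCompact K
  sym : SymOn Set.univ K m a
  zero : ∀ i p, p.1 ∉ K → a i p = 0

namespace Amp

variable {K : Set X} {m m' : ℝ} {a b : ι → X × E4 → ℂ}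

theorem of_symOn {O : Set X} (h : SymOn O K m a) (hK : IsCompact K)
    (hz : ∀ i p, p.1 ∉ K → a i p = 0) : Amp K m a := by
  refine ⟨hK, ⟨isOpen_univ, Set.subset_univ _, fun i => ?_, h.bound⟩, hz⟩
  refine ContDiff.contDiffOn (contDiff_iff_contDiffAt.2 fun p => ?_)
  by_cases hp : p.1 ∈ K
  · exact (h.smooth i).contDiffAt (h.isOpen'.mem_nhds (h.mem hp))
  · have hO : IsOpen (Kᶜ ×ˢ (Set.univ : Set E4)) := hK.isClosed.isOpen_compl.prod isOpen_univ
    have : a i =ᶠ[𝓝 p] fun _ => 0 :=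
      Filter.eventuallyEq_of_mem (hO.mem_nhds ⟨hp, trivial⟩) fun q hq => hz i q hq.1
    exact contDiffAt_const.congr_of_eventuallyEq this

theorem smooth (h : Amp K m a) (i : ι) : ContDiff ℝ ∞ (a i) := by
  have := h.sym.smooth i
  rwa [Set.univ_prod_univ, contDiffOn_univ] at this

theorem dd_zero (h : Amp K m a) (v : X × E4) (i : ι) (p : X × E4) (hp : p.1 ∉ K) :
    dd v (a i) p = 0 := by
  have hO : IsOpen (Kᶜ ×ˢ (Set.univ : Set E4)) :=
    h.compact.isClosed.isOpen_compl.prod isOpen_univ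
  exact dds_eq_zero_of_eqOn hO [v] (fun q hq => h.zero i q hq.1) (x := p) ⟨hp, trivial⟩

theorem dx (h : Amp K m a) (u : X) : Amp K m (fun i => dd (u, (0 : E4)) (a i)) :=
  ⟨h.compact, h.sym.dx u, h.dd_zero _⟩

theorem dz (h : Amp K m a) (v : E4) : Amp K (m - 1) (fun i => dd ((0 : X), v) (a i)) :=
  ⟨h.compact, h.sym.dz v, h.dd_zero _⟩

theorem mul (h : SymOn Set.univ K m' b) (ha : Amp K m a) :
    Amp K (m' + m) (fun i => b i * a i) :=
  ⟨ha.compact, h.mul ha.sym, fun i p hp => by simp [ha.zero i p hp]⟩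

theorem slice_contDiff (h : Amp K m a) (i : ι) (ζ : E4) : ContDiff ℝ ∞ fun x => a i (x, ζ) :=
  (h.smooth i).comp (by fun_prop)

theorem slice_hasCompactSupport (h : Amp K m a) (i : ι) (ζ : E4) :
    HasCompactSupport fun x => a i (x, ζ) :=
  HasCompactSupport.intro h.compact fun x hx => h.zero i (x, ζ) hx

end Amp

variable [MeasureSpace X]

/-- The Fourier transform of `a(x, ζ)` in the space variable `x`, at the frequency `θ`. -/
def ampFourier (a : X × E4 → ℂ) (θ : X →L[ℝ] ℝ) (ζ : E4) : ℂ :=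
  ∫ x, Complex.exp (-(Complex.I * (θ x : ℝ))) * a (x, ζ)

theorem norm_exp_neg_I_mul (r : ℝ) : ‖Complex.exp (-(Complex.I * (r : ℝ)))‖ = 1 := by
  rw [Complex.norm_exp]; simp

variable [FiniteDimensional ℝ X] [BorelSpace X] [(volume : Measure X).IsAddHaarMeasure]

theorem integral_exp_mul_dd (θ : X →L[ℝ] ℝ) {f : X → ℂ} (hf : ContDiff ℝ ∞ f)
    (hc : HasCompactSupport f) (u : X) :
    ∫ x, Complex.exp (-(Complex.I * (θ x : ℝ))) * dd u f x =
      Complex.I * (θ u : ℝ) * ∫ x, Complex.exp (-(Complex.I * (θ x : ℝ))) * f x := by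
  have he : ContDiff ℝ ∞ fun x => Complex.exp (-(Complex.I * (θ x : ℝ))) :=
    (contDiff_const.mul (Complex.ofRealCLM.contDiff.comp θ.contDiff)).neg.cexp
  have hder : ∀ x, fderiv ℝ (fun x => Complex.exp (-(Complex.I * (θ x : ℝ)))) x u =
      -(Complex.I * (θ u : ℝ)) * Complex.exp (-(Complex.I * (θ x : ℝ))) := by
    intro x
    have h1 : HasFDerivAt (fun x => ((θ x : ℝ) : ℂ)) (Complex.ofRealCLM.comp θ) x :=
      (Complex.ofRealCLM.comp θ).hasFDerivAt
    have h2 : HasFDerivAt (fun x => Complex.exp (-(Complex.I * (θ x : ℝ)))) _ x :=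
      ((h1.const_mul Complex.I).neg).cexp
    rw [h2.fderiv]
    simp
    ring
  have hdc : HasCompactSupport (dd u f) :=
    hc.mono' (subset_closure.trans (tsupport_dds_subset [u] f))
  have i1 : Integrable fun x => fderiv ℝ (fun x => Complex.exp (-(Complex.I * (θ x : ℝ)))) x u *
      f x := by
    refine Continuous.integrable_of_hasCompactSupport ?_ hc.mul_left
    exact (contDiff_dd he u).continuous.mul hf.continuous
  have i2 : Integrable fun x => Complex.exp (-(Complex.I * (θ x : ℝ))) * fderiv ℝ f x u :=
    Continuous.integrable_of_hasCompactSupport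
      (he.continuous.mul (contDiff_dd hf u).continuous) hdc.mul_left
  have i3 : Integrable fun x => Complex.exp (-(Complex.I * (θ x : ℝ))) * f x :=
    Continuous.integrable_of_hasCompactSupport (he.continuous.mul hf.continuous) hc.mul_left
  have h := integral_mul_fderiv_eq_neg_fderiv_mul_of_integrable (v := u) i1 i2 i3
    (fun x _ => he.differentiable (by simp) x) (fun x _ => hf.differentiable (by simp) x)
  simp only [dd]
  rw [h, ← integral_neg, ← integral_const_mul]
  refine integral_congr_ae (Filter.Eventually.of_forall fun x => ?_)
  simp only [hder]
  ring

namespace Amp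

variable {K : Set X} {m m' : ℝ} {a b : ι → X × E4 → ℂ}

theorem ampFourier_dx (h : Amp K m a) (i : ι) (θ : X →L[ℝ] ℝ) (ζ : E4) (u : X) :
    ampFourier (dd (u, (0 : E4)) (a i)) θ ζ = Complex.I * (θ u : ℝ) * ampFourier (a i) θ ζ := by
  have e : (fun x => dd (u, (0 : E4)) (a i) (x, ζ)) = dd u fun x => a i (x, ζ) := by
    funext x
    exact dX_apply isOpen_univ [u] ζ (by simpa using (h.smooth i).contDiffOn) x trivial
  have := integral_exp_mul_dd θ (h.slice_contDiff i ζ) (h.slice_hasCompactSupport i ζ) u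
  rw [← e] at this
  exact this

/-- The Fourier transform of an amplitude in the space variables is rapidly decreasing, and
bounded by the symbol weight in the covector. -/
theorem norm_ampFourier_le (h : Amp K m a) (N : ℕ) : ∃ C : ℝ, 0 ≤ C ∧ ∀ i θ ζ,
    ‖ampFourier (a i) θ ζ‖ * (1 + ‖θ‖) ^ N ≤ C * (1 + ‖ζ‖) ^ m := by
  induction N generalizing a with
  | zero =>
    obtain ⟨C, hC0, hC⟩ := h.sym.bound_self
    refine ⟨C * volume.real K, by positivity, fun i θ ζ => ?_⟩
    have h1 : ampFourier (a i) θ ζ =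
        ∫ x in K, Complex.exp (-(Complex.I * (θ x : ℝ))) * a i (x, ζ) := by
      refine (setIntegral_eq_integral_of_forall_compl_eq_zero fun x hx => ?_).symm
      rw [h.zero i (x, ζ) hx, mul_zero]
    rw [h1, pow_zero, mul_one]
    refine (norm_setIntegral_le_of_norm_le_const h.compact.measure_lt_top
      (C := C * (1 + ‖ζ‖) ^ m) fun x hx => ?_).trans (le_of_eq (by ring))
    rw [norm_mul, norm_exp_neg_I_mul, one_mul]
    exact hC i (x, ζ) hx
  | succ N ih =>
    let B := Module.finBasis ℝ X
    obtain ⟨D, hD0, hD⟩ := B.exists_opNorm_le (F := ℝ) (𝕜 := ℝ)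
    obtain ⟨C, hC0, hC⟩ := ih h
    choose C' hC'0 hC' using fun j => ih (h.dx (B j))
    refine ⟨C + D * ∑ j, C' j, add_nonneg hC0 (mul_nonneg hD0.le
      (Finset.sum_nonneg fun j _ => hC'0 j)), fun i θ ζ => ?_⟩
    have h1 : ‖θ‖ ≤ D * ∑ j, ‖θ (B j)‖ :=
      hD (Finset.sum_nonneg fun j _ => norm_nonneg _) fun j =>
        Finset.single_le_sum (f := fun j => ‖θ (B j)‖) (fun j _ => norm_nonneg _)
          (Finset.mem_univ j)
    have h2 : ∀ j, ‖θ (B j)‖ * ‖ampFourier (a i) θ ζ‖ * (1 + ‖θ‖) ^ N ≤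
        C' j * (1 + ‖ζ‖) ^ m := fun j => by
      have := hC' j i θ ζ
      rw [h.ampFourier_dx] at this
      simpa using this
    have h0 : 0 ≤ ‖ampFourier (a i) θ ζ‖ * (1 + ‖θ‖) ^ N := by positivity
    calc ‖ampFourier (a i) θ ζ‖ * (1 + ‖θ‖) ^ (N + 1)
        = ‖ampFourier (a i) θ ζ‖ * (1 + ‖θ‖) ^ N +
          ‖θ‖ * (‖ampFourier (a i) θ ζ‖ * (1 + ‖θ‖) ^ N) := by ring
      _ ≤ C * (1 + ‖ζ‖) ^ m +
          (D * ∑ j, ‖θ (B j)‖) * (‖ampFourier (a i) θ ζ‖ * (1 + ‖θ‖) ^ N) :=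
          add_le_add (hC i θ ζ) (mul_le_mul_of_nonneg_right h1 h0)
      _ = C * (1 + ‖ζ‖) ^ m +
          D * ∑ j, ‖θ (B j)‖ * ‖ampFourier (a i) θ ζ‖ * (1 + ‖θ‖) ^ N := by
          rw [mul_assoc, Finset.sum_mul]
          simp only [mul_assoc]
      _ ≤ C * (1 + ‖ζ‖) ^ m + D * ∑ j, C' j * (1 + ‖ζ‖) ^ m := by
          exact add_le_add le_rfl (mul_le_mul_of_nonneg_left
            (Finset.sum_le_sum fun j _ => h2 j) hD0.le)
      _ = _ := by rw [← Finset.sum_mul]; ring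

/-- The Fourier transform of an amplitude is jointly continuous. -/
theorem continuous_ampFourier (h : Amp K m a) (i : ι) :
    Continuous fun q : (X →L[ℝ] ℝ) × E4 => ampFourier (a i) q.1 q.2 := by
  have h1 : (fun q : (X →L[ℝ] ℝ) × E4 => ampFourier (a i) q.1 q.2) = fun q =>
      ∫ x in K, Complex.exp (-(Complex.I * (q.1 x : ℝ))) * a i (x, q.2) := by
    funext q
    refine (setIntegral_eq_integral_of_forall_compl_eq_zero fun x hx => ?_).symm
    rw [h.zero i (x, q.2) hx, mul_zero]
  rw [h1]
  refine continuous_parametric_integral_of_continuous ?_ h.compact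
  have h2 : Continuous fun p : ((X →L[ℝ] ℝ) × E4) × X => p.1.1 p.2 :=
    (continuous_fst.comp continuous_fst).clm_apply continuous_snd
  have h3 := (h.smooth i).continuous
  unfold Function.uncurry
  fun_prop

end Amp

end Amplitudes

/-! ### Complex test functions -/

section TestFunctions

variable {M : Opens E4}

/-- The function `h` is a complex test function on `M`. -/
structure IsTestC (M : Opens E4) (h : E4 → ℂ) : Prop where
  smooth : ContDiff ℝ ∞ h
  compact : HasCompactSupport h
  subset : tsupport h ⊆ (M : Set E4)

namespace IsTestC

variable {h k : E4 → ℂ}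

theorem comp_clm (hh : IsTestC M h) (L : ℂ →L[ℝ] ℝ) : IsTest M (fun y => L (h y)) := by
  have hs : tsupport (fun y => L (h y)) ⊆ tsupport h :=
    closure_mono fun y hy hy' => hy (by simp [hy'])
  exact ⟨L.contDiff.comp hh.smooth, hh.compact.mono' (subset_closure.trans hs),
    hs.trans hh.subset⟩

theorem re (hh : IsTestC M h) : IsTest M (fun y => (h y).re) := hh.comp_clm Complex.reCLM

theorem im (hh : IsTestC M h) : IsTest M (fun y => (h y).im) := hh.comp_clm Complex.imCLM

theorem add (hh : IsTestC M h) (hk : IsTestC M k) : IsTestC M (fun y => h y + k y) :=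
  ⟨hh.smooth.add hk.smooth, hh.compact.add hk.compact,
    (tsupport_add h k).trans (Set.union_subset hh.subset hk.subset)⟩

theorem mul_right (hh : IsTestC M h) (hk : ContDiff ℝ ∞ k) : IsTestC M (fun y => h y * k y) :=
  ⟨hh.smooth.mul hk, hh.compact.mul_right, tsupport_mul_subset_left.trans hh.subset⟩

theorem mul_left (hh : IsTestC M h) (hk : ContDiff ℝ ∞ k) : IsTestC M (fun y => k y * h y) := by
  simpa only [mul_comm] using hh.mul_right hk

theorem sub (hh : IsTestC M h) (hk : IsTestC M k) : IsTestC M (fun y => h y - k y) := by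
  simpa [sub_eq_add_neg] using hh.add (hk.mul_left (k := fun _ => -1) contDiff_const)

theorem dd (hh : IsTestC M h) (v : E4) : IsTestC M (LightRay.dd v h) :=
  ⟨contDiff_dd hh.smooth v, hh.compact.mono' (subset_closure.trans (tsupport_dds_subset [v] h)),
    (tsupport_dds_subset [v] h).trans hh.subset⟩

end IsTestC

theorem isTestC_coe (φ : 𝓓(M, ℂ)) : IsTestC M φ :=
  ⟨φ.contDiff, φ.hasCompactSupport, φ.tsupport_subset⟩

theorem tsupport_ofReal (φ : E4 → ℝ) : tsupport (fun y => (φ y : ℂ)) = tsupport φ := by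
  unfold tsupport
  congr 1
  ext y
  simp

theorem IsTest.ofReal {φ : E4 → ℝ} (h : IsTest M φ) : IsTestC M (fun y => (φ y : ℂ)) :=
  ⟨Complex.ofRealCLM.contDiff.comp h.1,
    h.2.1.mono' (subset_closure.trans (tsupport_ofReal φ).le),
    (tsupport_ofReal φ).le.trans h.2.2⟩

theorem isTest_coe (φ : 𝓓(M, ℝ)) : IsTest M φ :=
  ⟨φ.contDiff, φ.hasCompactSupport, φ.tsupport_subset⟩

theorem isTestC_ofReal (φ : 𝓓(M, ℝ)) : IsTestC M (fun y => (φ y : ℂ)) := (isTest_coe φ).ofReal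

/-- The complex test function given by a function with the required properties. -/
def mkTest (h : E4 → ℂ) (hh : IsTestC M h) : 𝓓(M, ℂ) := ⟨h, hh.smooth, hh.compact, hh.subset⟩

@[simp] theorem mkTest_apply (h : E4 → ℂ) (hh : IsTestC M h) (y : E4) : mkTest h hh y = h y := rfl

/-- A smooth cutoff function that is `1` near a compact set. -/
theorem exists_cutoff {K O : Set E4} (hK : IsCompact K) (hO : IsOpen O) (hKO : K ⊆ O)
    (hOM : O ⊆ (M : Set E4)) : ∃ χ : 𝓓(M, ℝ), (∀ᶠ y in 𝓝ˢ K, χ y = 1) ∧ tsupport χ ⊆ O := by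
  obtain ⟨L, hL, hKL, hLO⟩ := exists_compact_between hK hO hKO
  obtain ⟨g, hg1, hg0, -⟩ := exists_contMDiffMap_one_nhds_of_subset_interior
    (modelWithCornersSelf ℝ E4) (n := ⊤) hK.isClosed hKL
  have hs : tsupport g ⊆ L := by
    apply closure_minimal _ hL.isClosed
    intro y hy
    by_contra hyL
    exact hy (hg0 y hyL)
  exact ⟨⟨g, g.contMDiff.contDiff, HasCompactSupport.intro' hL hL.isClosed hg0,
    (hs.trans hLO).trans hOM⟩, hg1, hs.trans hLO⟩

theorem evalReal_eq (u : 𝓓(M, ℝ) → ℂ) (φ : 𝓓(M, ℝ)) : evalReal u (fun y => φ y) = u φ := by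
  rw [evalReal, dif_pos (isTest_coe φ)]
  rfl

theorem evalReal_zero (u : 𝓓'(M, ℂ)) : evalReal (fun φ => u φ) (fun _ => 0) = 0 :=
  (evalReal_eq (fun φ => u φ) (0 : 𝓓(M, ℝ))).trans (map_zero u)

theorem evalReal_add (u : 𝓓'(M, ℂ)) {h k : E4 → ℝ} (hh : IsTest M h) (hk : IsTest M k) :
    evalReal (fun φ => u φ) (fun y => h y + k y) =
      evalReal (fun φ => u φ) h + evalReal (fun φ => u φ) k := by
  let φ : 𝓓(M, ℝ) := ⟨h, hh.1, hh.2.1, hh.2.2⟩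
  let ψ : 𝓓(M, ℝ) := ⟨k, hk.1, hk.2.1, hk.2.2⟩
  have h1 : evalReal (fun φ => u φ) (fun y => h y + k y) = u (φ + ψ) :=
    evalReal_eq (fun φ => u φ) (φ + ψ)
  have h2 : evalReal (fun φ => u φ) h = u φ := evalReal_eq (fun φ => u φ) φ
  have h3 : evalReal (fun φ => u φ) k = u ψ := evalReal_eq (fun φ => u φ) ψ
  rw [h1, h2, h3, map_add]

theorem evalReal_const_mul (u : 𝓓'(M, ℂ)) (c : ℝ) {h : E4 → ℝ} (hh : IsTest M h) :
    evalReal (fun φ => u φ) (fun y => c * h y) = c * evalReal (fun φ => u φ) h := by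
  let φ : 𝓓(M, ℝ) := ⟨h, hh.1, hh.2.1, hh.2.2⟩
  have h1 : evalReal (fun φ => u φ) (fun y => c * h y) = u (c • φ) :=
    evalReal_eq (fun φ => u φ) (c • φ)
  have h2 : evalReal (fun φ => u φ) h = u φ := evalReal_eq (fun φ => u φ) φ
  rw [h1, h2, map_smul, Complex.real_smul]

theorem IsTest.const_mul {h : E4 → ℝ} (hh : IsTest M h) (c : ℝ) : IsTest M (fun y => c * h y) :=
  ⟨contDiff_const.mul hh.1, hh.2.1.mul_left, (tsupport_mul_subset_right).trans hh.2.2⟩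

theorem evalC_add (u : 𝓓'(M, ℂ)) {h k : E4 → ℂ} (hh : IsTestC M h) (hk : IsTestC M k) :
    evalC (fun φ => u φ) (fun y => h y + k y) =
      evalC (fun φ => u φ) h + evalC (fun φ => u φ) k := by
  simp only [evalC, Complex.add_re, Complex.add_im]
  rw [evalReal_add u hh.re hk.re, evalReal_add u hh.im hk.im]
  ring

theorem evalC_const_mul (u : 𝓓'(M, ℂ)) (c : ℂ) {h : E4 → ℂ} (hh : IsTestC M h) :
    evalC (fun φ => u φ) (fun y => c * h y) = c * evalC (fun φ => u φ) h := by
  have e1 : (fun y => (c * h y).re) = fun y => c.re * (h y).re + (-c.im) * (h y).im := by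
    funext y; rw [Complex.mul_re]; ring
  have e2 : (fun y => (c * h y).im) = fun y => c.re * (h y).im + c.im * (h y).re := by
    funext y; rw [Complex.mul_im]
  simp only [evalC]
  rw [e1, e2, evalReal_add u (hh.re.const_mul _) (hh.im.const_mul _),
    evalReal_add u (hh.im.const_mul _) (hh.re.const_mul _), evalReal_const_mul u _ hh.re,
    evalReal_const_mul u _ hh.im, evalReal_const_mul u _ hh.im, evalReal_const_mul u _ hh.re]
  conv_rhs => rw [← Complex.re_add_im c]
  push_cast
  linear_combination (-(c.im : ℂ) * evalReal (fun φ => u φ) fun y => (h y).im) * Complex.I_mul_I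

theorem evalC_ofReal (u : 𝓓'(M, ℂ)) (φ : 𝓓(M, ℝ)) :
    evalC (fun φ => u φ) (fun y => (φ y : ℂ)) = u φ := by
  simp only [evalC, Complex.ofReal_re, Complex.ofReal_im]
  rw [evalReal_zero, evalReal_eq (fun φ => u φ) φ]
  simp

theorem evalC_sub (u : 𝓓'(M, ℂ)) {h k : E4 → ℂ} (hh : IsTestC M h) (hk : IsTestC M k) :
    evalC (fun φ => u φ) (fun y => h y - k y) =
      evalC (fun φ => u φ) h - evalC (fun φ => u φ) k := by
  have e : (fun y => h y - k y) = fun y => h y + (-1) * k y := by funext y; ring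
  rw [e, evalC_add u hh (hk.mul_left contDiff_const), evalC_const_mul u _ hk]
  ring

/-- A functional that vanishes off `K` does not see test functions supported off `K`. -/
theorem evalC_eq_zero {u : 𝓓'(M, ℂ)} {s : Set E4} (hu : IsVanishingOn (fun φ => u φ) s)
    {h : E4 → ℂ} (hh : IsTestC M h) (hs : tsupport h ⊆ s) : evalC (fun φ => u φ) h = 0 := by
  have key : ∀ L : ℂ →L[ℝ] ℝ, evalReal (fun φ => u φ) (fun y => L (h y)) = 0 := by
    intro L
    have ht := hh.comp_clm L
    rw [evalReal, dif_pos ht]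
    have hsub : tsupport (fun y => L (h y)) ⊆ tsupport h :=
      closure_mono fun y hy hy' => hy (by simp [hy'])
    exact hu _ (hsub.trans hs)
  have h1 := key Complex.reCLM
  have h2 := key Complex.imCLM
  simp only [Complex.reCLM_apply, Complex.imCLM_apply] at h1 h2
  simp [evalC, h1, h2]

theorem evalC_cutoff_mul {u : 𝓓'(M, ℂ)} {ψ : 𝓓(M, ℝ)} (hψ : IsCutoff ψ (fun φ => u φ))
    {h : E4 → ℂ} (hh : IsTestC M h) :
    evalC (fun φ => u φ) (fun y => (ψ y : ℂ) * h y) = evalC (fun φ => u φ) h := by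
  obtain ⟨K, -, -, hv, h1⟩ := hψ
  have hψh : IsTestC M (fun y => (ψ y : ℂ) * h y) := hh.mul_left (isTestC_ofReal ψ).smooth
  rw [← sub_eq_zero, ← evalC_sub u hψh hh]
  refine evalC_eq_zero hv (hψh.sub hh) fun y hy hyK => ?_
  refine (notMem_tsupport_iff_eventuallyEq.2 ?_) hy
  filter_upwards [(eventually_nhdsSet_iff_forall.1 h1) y hyK] with z hz
  simp [hz]

end TestFunctions

/-! ### Fourier inversion for test functions -/

section Inversion

instance instIsAddHaarMeasureProdE4 : (volume : Measure (E4 × E4)).IsAddHaarMeasure :=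
  inferInstanceAs (volume.prod volume).IsAddHaarMeasure

/-- The Fourier transform `∫ e^{-i y·ζ} h(y) dy`. -/
def ft (h : E4 → ℂ) (ζ : E4) : ℂ := ∫ y, waveNeg ζ y * h y

/-- The constant `(2π)^{-4}` of Fourier inversion. -/
def c0 : ℂ := ((2 * Real.pi : ℝ) : ℂ)⁻¹ ^ 4

theorem norm_waveNeg (ζ y : E4) : ‖waveNeg ζ y‖ = 1 := norm_exp_neg_I_mul _

theorem contDiff_waveNeg : ContDiff ℝ ∞ fun p : E4 × E4 => waveNeg p.1 p.2 := by
  have h1 : ContDiff ℝ ∞ fun p : E4 × E4 => (inner ℝ p.2 p.1 : ℝ) :=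
    contDiff_snd.inner ℝ contDiff_fst
  have h2 : ContDiff ℝ ∞ fun p : E4 × E4 => ((inner ℝ p.2 p.1 : ℝ) : ℂ) :=
    Complex.ofRealCLM.contDiff.comp h1
  have h3 : ContDiff ℝ ∞ fun p : E4 × E4 => -(Complex.I * ((inner ℝ p.2 p.1 : ℝ) : ℂ)) :=
    (contDiff_const.mul h2).neg
  exact h3.cexp

theorem contDiff_waveNeg_right (ζ : E4) : ContDiff ℝ ∞ (waveNeg ζ) :=
  (contDiff_waveNeg.comp ((contDiff_const (c := ζ)).prodMk contDiff_id) :)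

theorem waveNeg_add (ζ η y : E4) : waveNeg (ζ + η) y = waveNeg ζ y * waveNeg η y := by
  simp only [waveNeg, inner_add_right, ← Complex.exp_add]
  push_cast
  ring_nf

theorem dd_waveNeg (ζ v : E4) :
    dd v (waveNeg ζ) = fun y => -(Complex.I * (inner ℝ v ζ : ℝ)) * waveNeg ζ y := by
  funext y
  have h1 : HasFDerivAt (fun y : E4 => ((inner ℝ y ζ : ℝ) : ℂ))
      (Complex.ofRealCLM.comp (innerSL ℝ ζ)) y := by
    have e : (fun y : E4 => ((inner ℝ y ζ : ℝ) : ℂ)) =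
        fun y => Complex.ofRealCLM.comp (innerSL ℝ ζ) y := by
      funext y; simp [real_inner_comm]
    rw [e]
    exact (Complex.ofRealCLM.comp (innerSL ℝ ζ)).hasFDerivAt
  have h2 : HasFDerivAt (waveNeg ζ) _ y := ((h1.const_mul Complex.I).neg).cexp
  simp only [dd]
  rw [h2.fderiv]
  simp [waveNeg, real_inner_comm]
  ring

theorem ft_eq_ampFourier (h : E4 → ℂ) (ζ η : E4) :
    ft h ζ = ampFourier (fun p : E4 × E4 => h p.1) (innerSL ℝ ζ) η := by
  simp only [ft, ampFourier, waveNeg, innerSL_apply_apply, real_inner_comm]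

theorem amp_of_test {ι X : Type*} [NormedAddCommGroup X] [NormedSpace ℝ X] {h : X → ℂ}
    (hs : ContDiff ℝ ∞ h) (hc : HasCompactSupport h) :
    Amp (tsupport h) 0 (fun (_ : ι) p => h p.1) :=
  ⟨hc, symOn_of_contDiffOn isOpen_univ (Set.subset_univ _) hc hs.contDiffOn,
    fun _ _ hp => image_eq_zero_of_notMem_tsupport hp⟩

theorem norm_ft_le {h : E4 → ℂ} (hs : ContDiff ℝ ∞ h) (hc : HasCompactSupport h) (N : ℕ) :
    ∃ C : ℝ, 0 ≤ C ∧ ∀ ζ, ‖ft h ζ‖ * (1 + ‖ζ‖) ^ N ≤ C := by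
  obtain ⟨C, hC0, hC⟩ := (amp_of_test (ι := Unit) hs hc).norm_ampFourier_le N
  refine ⟨C, hC0, fun ζ => ?_⟩
  have := hC () (innerSL ℝ ζ) 0
  rw [← ft_eq_ampFourier] at this
  simpa using this

theorem continuous_ft {h : E4 → ℂ} (hs : ContDiff ℝ ∞ h) (hc : HasCompactSupport h) :
    Continuous (ft h) := by
  have h1 := (amp_of_test (ι := Unit) hs hc).continuous_ampFourier ()
  have h2 : ft h = fun ζ => ampFourier (fun p : E4 × E4 => h p.1) (innerSL ℝ ζ) 0 := by
    funext ζ; exact ft_eq_ampFourier h ζ 0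
  rw [h2]
  exact h1.comp (f := fun ζ : E4 => (innerSL ℝ ζ, (0 : E4))) (by fun_prop)

theorem integrable_weight : Integrable fun ζ : E4 => ((1 + ‖ζ‖) ^ 5)⁻¹ := by
  have h := integrable_one_add_norm (E := E4) (μ := volume) (r := 5) (by simp; norm_num)
  refine h.congr (Filter.Eventually.of_forall fun ζ => ?_)
  simp only
  rw [Real.rpow_neg (by positivity)]
  norm_cast

/-- A function bounded by a multiple of `(1 + |ζ|)^{-5}` is integrable on the four-dimensional
space of covectors. -/
theorem integrable_of_weight {F : Type*} [NormedAddCommGroup F] {f : E4 → F}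
    (hf : AEStronglyMeasurable f) {C : ℝ} (h : ∀ ζ, ‖f ζ‖ * (1 + ‖ζ‖) ^ 5 ≤ C) :
    Integrable f := by
  refine (integrable_weight.const_mul C).mono' hf (Filter.Eventually.of_forall fun ζ => ?_)
  rw [← div_eq_mul_inv, le_div_iff₀ (by positivity)]
  exact h ζ

theorem integrable_ft {h : E4 → ℂ} (hs : ContDiff ℝ ∞ h) (hc : HasCompactSupport h) :
    Integrable (ft h) := by
  obtain ⟨C, -, hC⟩ := norm_ft_le hs hc 5
  exact integrable_of_weight (continuous_ft hs hc).aestronglyMeasurable hC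

open scoped FourierTransform in
theorem fourier_inversion {h : E4 → ℂ} (hs : ContDiff ℝ ∞ h) (hc : HasCompactSupport h) (y : E4) :
    h y = c0 * ∫ ζ, waveNeg ζ y * ft h (-ζ) := by
  have h1 : ∀ w, 𝓕 h w = ft h ((2 * Real.pi) • w) := by
    intro w
    rw [Real.fourier_eq', ft]
    refine integral_congr_ae (Filter.Eventually.of_forall fun v => ?_)
    simp only [smul_eq_mul, waveNeg, inner_smul_right]
    congr 2
    push_cast
    ring
  have hpi : (2 * Real.pi) ≠ 0 := by positivity
  have h2 : Integrable (𝓕 h) := by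
    rw [show 𝓕 h = fun w => ft h ((2 * Real.pi) • w) from funext h1]
    exact (integrable_ft hs hc).comp_smul hpi
  have h3 := Continuous.fourierInv_fourier_eq hs.continuous
    (hs.continuous.integrable_of_hasCompactSupport hc) h2
  have h4 : h y = ∫ v, waveNeg ((-(2 * Real.pi)) • v) y * ft h (-((-(2 * Real.pi)) • v)) := by
    conv_lhs => rw [← h3, Real.fourierInv_eq']
    refine integral_congr_ae (Filter.Eventually.of_forall fun v => ?_)
    simp only [smul_eq_mul, waveNeg, h1, neg_smul, neg_neg]
    congr 2
    rw [inner_neg_right, inner_smul_right, real_inner_comm]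
    push_cast
    ring
  rw [h4, Measure.integral_comp_smul volume (fun ζ => waveNeg ζ y * ft h (-ζ))]
  have h5 : |((-(2 * Real.pi)) ^ Module.finrank ℝ E4)⁻¹| = (2 * Real.pi)⁻¹ ^ 4 := by
    have : Module.finrank ℝ E4 = 4 := by simp
    rw [this, abs_of_nonneg]
    · ring
    · positivity
  rw [h5, Complex.real_smul, c0]
  push_cast
  rfl

end Inversion

/-! ### Distributions on superpositions of exponentials -/

section Superposition

variable {V : Type*} [NormedAddCommGroup V] [NormedSpace ℝ V] [FiniteDimensional ℝ V]

/-- In finite dimension, Fréchet derivatives are controlled by finitely many iterated directional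
derivatives. -/
theorem norm_iteratedFDeriv_le_dds (j : ℕ) : ∃ (W : Finset (List V)) (C : ℝ), 0 ≤ C ∧
    ∀ f : V → ℂ, ContDiff ℝ ∞ f → ∀ x, ‖iteratedFDeriv ℝ j f x‖ ≤ C * ∑ w ∈ W, ‖dds w f x‖ := by
  classical
  induction j with
  | zero => exact ⟨{[]}, 1, zero_le_one, fun f _ x => by simp [dds]⟩
  | succ j ih =>
    obtain ⟨W, C, hC0, hC⟩ := ih
    let B := Module.finBasis ℝ V
    let L : ∀ i, ℂ →L[ℝ] (V →L[ℝ] ℂ) := fun i =>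
      ContinuousLinearMap.smulRightL ℝ V ℂ (LinearMap.toContinuousLinearMap (B.coord i))
    have hL : ∀ f : V → ℂ, fderiv ℝ f = fun x => ∑ i, (L i ∘ dd (B i) f) x := by
      intro f
      funext x
      ext v
      conv_lhs => rw [← B.sum_repr v, map_sum]
      simp [L, dd]
    refine ⟨Finset.univ.biUnion fun i => W.image (List.cons (B i)), (∑ i, ‖L i‖) * C,
      mul_nonneg (Finset.sum_nonneg fun i _ => norm_nonneg (L i)) hC0, fun f hf x => ?_⟩
    have hsm : ∀ i, ContDiff ℝ ∞ (L i ∘ dd (B i) f) := fun i =>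
      (L i).contDiff.comp (contDiff_dd hf _)
    rw [← norm_iteratedFDeriv_fderiv, hL f, iteratedFDeriv_sum fun i _ =>
      (hsm i).of_le (WithTop.coe_le_coe.2 le_top), Finset.sum_apply]
    refine (norm_sum_le _ _).trans ?_
    rw [Finset.sum_mul, Finset.sum_mul]
    refine Finset.sum_le_sum fun i _ => ?_
    calc ‖iteratedFDeriv ℝ j (L i ∘ dd (B i) f) x‖
        ≤ ‖L i‖ * ‖iteratedFDeriv ℝ j (dd (B i) f) x‖ :=
          (L i).norm_iteratedFDeriv_comp_left (contDiff_dd hf _).contDiffAt (N := ∞)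
            (WithTop.coe_le_coe.2 le_top)
      _ ≤ ‖L i‖ * (C * ∑ w ∈ W, ‖dds w (dd (B i) f) x‖) := by
          gcongr; exact hC _ (contDiff_dd hf _) x
      _ = ‖L i‖ * C * ∑ w ∈ W.image (List.cons (B i)), ‖dds w f x‖ := by
          rw [Finset.sum_image (by intro a _ b _ h; exact (List.cons.inj h).2), mul_assoc]
          rfl
      _ ≤ _ := by
          gcongr
          exact Finset.subset_biUnion_of_mem (fun i => W.image (List.cons (B i)))
            (Finset.mem_univ i)

end Superposition

section Superposition

variable {M : Opens E4}

theorem dds_clm_comp {V : Type*} [NormedAddCommGroup V] [NormedSpace ℝ V] (L : ℂ →L[ℝ] ℂ)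
    (l : List V) : ∀ {f : V → ℂ}, ContDiff ℝ ∞ f →
      dds l (fun x => L (f x)) = fun x => L (dds l f x) := by
  induction l with
  | nil => exact fun _ => rfl
  | cons v l ih =>
    intro f hf
    have h1 : dd v (fun x => L (f x)) = fun x => L (dd v f x) := by
      funext x
      have h := (L.hasFDerivAt.comp x (hf.differentiable (by simp) x).hasFDerivAt).fderiv
      change fderiv ℝ (L ∘ f) x v = _
      rw [h]
      rfl
    simp only [dds]
    rw [h1, ih (contDiff_dd hf v)]

/-- The seminorm estimate that expresses the continuity of a distribution on a compact set, in terms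
of iterated directional derivatives. -/
theorem norm_real_le {K : Compacts E4} (hK : (K : Set E4) ⊆ (M : Set E4)) (U : 𝓓'(M, ℂ)) :
    ∃ (W : Finset (List E4)) (C : ℝ), 0 ≤ C ∧ ∀ (f : 𝓓_{K}(E4, ℝ)) (B : ℝ), 0 ≤ B →
      (∀ w ∈ W, ∀ y, ‖dds w (fun y => (f y : ℂ)) y‖ ≤ B) →
        ‖U (TestFunction.ofSupportedIn hK f)‖ ≤ C * B := by
  classical
  let T : 𝓓_{K}(E4, ℝ) →L[ℝ] ℂ :=
    ContinuousLinearMap.comp (U : 𝓓(M, ℝ) →L[ℝ] ℂ) (TestFunction.ofSupportedInCLM ℝ hK)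
  have hq : Continuous ((normSeminorm ℝ ℂ).comp (T : 𝓓_{K}(E4, ℝ) →ₗ[ℝ] ℂ)) :=
    continuous_norm.comp T.continuous
  obtain ⟨s, C, -, hC⟩ := Seminorm.bound_of_continuous
    (ContDiffMapSupportedIn.withSeminorms ℝ E4 ℝ ⊤ K) _ hq
  choose W D hD0 hD using fun j => norm_iteratedFDeriv_le_dds (V := E4) j
  refine ⟨s.biUnion W, C * ∑ i ∈ s, D i * (W i).card, mul_nonneg C.2
    (Finset.sum_nonneg fun i _ => mul_nonneg (hD0 i) (Nat.cast_nonneg _)), fun f B hB hf => ?_⟩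
  have h1 := hC f
  change ‖U (TestFunction.ofSupportedIn hK f)‖ ≤ C * _ at h1
  refine h1.trans ?_
  rw [mul_assoc]
  refine mul_le_mul_of_nonneg_left ?_ C.2
  have hsum : 0 ≤ (∑ i ∈ s, D i * (W i).card) * B := mul_nonneg
    (Finset.sum_nonneg fun i _ => mul_nonneg (hD0 i) (Nat.cast_nonneg _)) hB
  refine Seminorm.finset_sup_apply_le hsum fun i hi => ?_
  rw [ContDiffMapSupportedIn.seminorm_top_le_iff ℝ hsum]
  intro x _
  have hfs : ContDiff ℝ ∞ (f : E4 → ℝ) := f.contDiff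
  have e : ‖iteratedFDeriv ℝ i f x‖ = ‖iteratedFDeriv ℝ i (fun y => (f y : ℂ)) x‖ :=
    (Complex.ofRealLI.norm_iteratedFDeriv_comp_left hfs.contDiffAt
      (WithTop.coe_le_coe.2 le_top)).symm
  rw [e]
  calc _ ≤ D i * ∑ w ∈ W i, ‖dds w (fun y => (f y : ℂ)) x‖ :=
        hD i _ (Complex.ofRealCLM.contDiff.comp hfs) x
    _ ≤ D i * ∑ w ∈ W i, B := by
        refine mul_le_mul_of_nonneg_left (Finset.sum_le_sum fun w hw => ?_) (hD0 i)
        exact hf w (Finset.mem_biUnion.2 ⟨i, hi, hw⟩) x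
    _ = D i * (W i).card * B := by rw [Finset.sum_const, nsmul_eq_mul, mul_assoc]
    _ ≤ _ := by
        refine mul_le_mul_of_nonneg_right ?_ hB
        exact Finset.single_le_sum (f := fun i => D i * ((W i).card : ℝ))
          (fun j _ => mul_nonneg (hD0 j) (Nat.cast_nonneg _)) hi

/-- Distributions are of finite order on compact sets. -/
theorem norm_evalC_le {K : Set E4} (hKc : IsCompact K) (hK : K ⊆ (M : Set E4)) (U : 𝓓'(M, ℂ)) :
    ∃ (W : Finset (List E4)) (C : ℝ), 0 ≤ C ∧ ∀ h : E4 → ℂ, ContDiff ℝ ∞ h → tsupport h ⊆ K →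
      ∀ B : ℝ, 0 ≤ B → (∀ w ∈ W, ∀ y, ‖dds w h y‖ ≤ B) → ‖evalC (fun φ => U φ) h‖ ≤ C * B := by
  obtain ⟨W, C, hC0, hC⟩ := norm_real_le (K := ⟨K, hKc⟩) hK U
  refine ⟨W, C + C, by positivity, fun h hs ht B hB hh => ?_⟩
  have key : ∀ L : ℂ →L[ℝ] ℝ, ‖L‖ ≤ 1 →
      ‖evalReal (fun φ => U φ) (fun y => L (h y))‖ ≤ C * B := by
    intro L hL
    have hz : Function.support (fun y => L (h y)) ⊆ K := fun y hy =>
      ht (subset_closure (fun hy' => hy (by simp [hy'])))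
    let f : 𝓓_{⟨K, hKc⟩}(E4, ℝ) :=
      ContDiffMapSupportedIn.of_support_subset (f := fun y => L (h y)) (L.contDiff.comp hs) hz
    have e : evalReal (fun φ => U φ) (fun y => L (h y)) = U (TestFunction.ofSupportedIn hK f) :=
      evalReal_eq (fun φ => U φ) (TestFunction.ofSupportedIn hK f)
    rw [e]
    refine hC f B hB fun w hw y => ?_
    have e2 : (fun y => (f y : ℂ)) = fun y => (Complex.ofRealCLM.comp L) (h y) := rfl
    rw [e2, dds_clm_comp _ _ hs]
    refine (ContinuousLinearMap.le_opNorm _ _).trans ?_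
    refine le_trans ?_ (hh w hw y)
    refine mul_le_of_le_one_left (norm_nonneg _) ?_
    refine (ContinuousLinearMap.opNorm_comp_le _ _).trans ?_
    exact mul_le_one₀ (by simp) (norm_nonneg _) hL
  have h1 := key Complex.reCLM (by simp)
  have h2 := key Complex.imCLM (by simp)
  rw [evalC, add_mul]
  refine (norm_add_le _ _).trans (add_le_add h1 ?_)
  rw [norm_mul, Complex.norm_I, one_mul]
  exact h2

/-- A linear functional bounded through a linear map into a normed space factors through it
continuously. -/
theorem exists_clm_of_norm_le {E X : Type*} [AddCommGroup E] [Module ℂ E] [NormedAddCommGroup X]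
    [NormedSpace ℂ X] (L : E →ₗ[ℂ] ℂ) (J : E →ₗ[ℂ] X) {C : ℝ} (hLJ : ∀ f, ‖L f‖ ≤ C * ‖J f‖) :
    ∃ V : X →L[ℂ] ℂ, ∀ f, L f = V (J f) := by
  obtain ⟨g, hg⟩ := LinearMap.exists_rightInverse_of_surjective J.rangeRestrict
    (LinearMap.range_eq_top.2 J.surjective_rangeRestrict)
  have hg' : ∀ z, J (g z) = z := fun z => congrArg Subtype.val (LinearMap.congr_fun hg z)
  let f₀ : J.range →L[ℂ] ℂ := (L.comp g).mkContinuous C fun z => by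
    have := hLJ (g z)
    rw [hg'] at this
    exact this
  obtain ⟨V, hV, -⟩ := exists_extension_norm_eq J.range f₀
  refine ⟨V, fun f => ?_⟩
  have h1 : V (J f) = L (g (J.rangeRestrict f)) := hV (J.rangeRestrict f)
  have h2 : L (g (J.rangeRestrict f)) = L f := by
    rw [← sub_eq_zero, ← map_sub, ← norm_le_zero_iff]
    refine (hLJ _).trans ?_
    rw [map_sub, hg']
    simp
  exact (h1.trans h2).symm

/-- The restrictions to `K` of finitely many iterated derivatives of a smooth function. -/
def jet (K : Set E4) (W : Finset (List E4)) (h : E4 → ℂ) (hh : ContDiff ℝ ∞ h) : W → C(K, ℂ) :=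
  fun w => ⟨fun y => dds w.1 h y, (contDiff_dds hh _).continuous.comp continuous_subtype_val⟩

/-- By the Hahn-Banach theorem, a distribution is on a compact set a continuous linear functional
of finitely many derivatives, taken in the space of continuous functions. -/
theorem exists_jet_functional {K : Set E4} (hKc : IsCompact K) (hK : K ⊆ (M : Set E4))
    (U : 𝓓'(M, ℂ)) : letI := isCompact_iff_compactSpace.1 hKc
    ∃ (W : Finset (List E4)) (V : (W → C(K, ℂ)) →L[ℂ] ℂ), ∀ (h : E4 → ℂ) (hh : ContDiff ℝ ∞ h),
      tsupport h ⊆ K → evalC (fun φ => U φ) h = V (jet K W h hh) := by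
  have := isCompact_iff_compactSpace.1 hKc
  obtain ⟨W, C, hC0, hC⟩ := norm_evalC_le hKc hK U
  have htest : ∀ f : 𝓓_{⟨K, hKc⟩}(E4, ℂ), IsTestC M f := fun f =>
    ⟨f.contDiff, f.hasCompactSupport, f.tsupport_subset.trans hK⟩
  have hsm : ∀ f : 𝓓_{⟨K, hKc⟩}(E4, ℂ), ContDiff ℝ ∞ f := fun f => f.contDiff
  let L : 𝓓_{⟨K, hKc⟩}(E4, ℂ) →ₗ[ℂ] ℂ :=
    { toFun := fun f => evalC (fun φ => U φ) f
      map_add' := fun f g => evalC_add U (htest f) (htest g)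
      map_smul' := fun c f => evalC_const_mul U c (htest f) }
  let J : 𝓓_{⟨K, hKc⟩}(E4, ℂ) →ₗ[ℂ] (W → C(K, ℂ)) :=
    { toFun := fun f => jet K W f (hsm f)
      map_add' := fun f g => by
        funext w; ext y
        exact congrFun (dds_add (hsm f) (hsm g) w.1) y
      map_smul' := fun c f => by
        funext w; ext y
        exact congrFun (dds_const_mul c w.1 (hsm f)) y }
  have hLJ : ∀ f, ‖L f‖ ≤ C * ‖J f‖ := fun f => by
    refine hC f (hsm f) f.tsupport_subset _ (norm_nonneg _) fun w hw y => ?_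
    by_cases hy : y ∈ K
    · have h1 : ‖J f ⟨w, hw⟩ ⟨y, hy⟩‖ ≤ ‖J f ⟨w, hw⟩‖ := ContinuousMap.norm_coe_le_norm _ _
      exact h1.trans (norm_le_pi_norm (J f) ⟨w, hw⟩)
    · have : dds w f y = 0 := by
        by_contra h0
        exact hy (f.tsupport_subset (tsupport_dds_subset w f (subset_closure h0)))
      rw [this, norm_zero]
      exact norm_nonneg _
  obtain ⟨V, hV⟩ := exists_clm_of_norm_le L J hLJ
  refine ⟨W, V, fun h hh ht => ?_⟩
  let f : 𝓓_{⟨K, hKc⟩}(E4, ℂ) :=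
    ContDiffMapSupportedIn.of_support_subset (f := h) hh (subset_closure.trans ht)
  exact hV f

theorem dd_mul_waveNeg {φ : E4 → ℂ} (hφ : ContDiff ℝ ∞ φ) (ζ v : E4) :
    dd v (fun y => φ y * waveNeg ζ y) = (fun y => dd v φ y * waveNeg ζ y) +
      fun y => -(Complex.I * (inner ℝ v ζ : ℝ)) * (φ y * waveNeg ζ y) := by
  have h := dd_mul hφ (contDiff_waveNeg_right ζ) v
  rw [dd_waveNeg] at h
  change dd v (φ * waveNeg ζ) = _
  rw [h]
  funext y
  simp only [Pi.add_apply, Pi.mul_apply]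
  ring

theorem contDiff_mul_waveNeg {φ : E4 → ℂ} (hφ : ContDiff ℝ ∞ φ) (ζ : E4) :
    ContDiff ℝ ∞ fun y => φ y * waveNeg ζ y := hφ.mul (contDiff_waveNeg_right ζ)

theorem dds_cons_mul_waveNeg {φ : E4 → ℂ} (hφ : ContDiff ℝ ∞ φ) (ζ v : E4) (w : List E4)
    (y : E4) : dds (v :: w) (fun y => φ y * waveNeg ζ y) y =
      dds w (fun y => dd v φ y * waveNeg ζ y) y +
        -(Complex.I * (inner ℝ v ζ : ℝ)) * dds w (fun y => φ y * waveNeg ζ y) y := by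
  have h1 := contDiff_mul_waveNeg hφ ζ
  have h2 := contDiff_mul_waveNeg (contDiff_dd hφ v) ζ
  rw [dds, dd_mul_waveNeg hφ, dds_add h2 (contDiff_const.mul h1), dds_const_mul _ _ h1]
  rfl

theorem continuous_dds_mul_waveNeg (w : List E4) : ∀ {φ : E4 → ℂ}, ContDiff ℝ ∞ φ →
    Continuous fun q : E4 × E4 => dds w (fun y => φ y * waveNeg q.1 y) q.2 := by
  induction w with
  | nil => exact fun hφ => (hφ.continuous.comp continuous_snd).mul contDiff_waveNeg.continuous
  | cons v w ih =>
    intro φ hφ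
    simp only [dds_cons_mul_waveNeg hφ]
    have h1 := ih hφ
    have h2 := ih (contDiff_dd hφ v)
    have h3 : Continuous fun q : E4 × E4 => ((inner ℝ v q.1 : ℝ) : ℂ) :=
      Complex.continuous_ofReal.comp (continuous_const.inner continuous_fst)
    exact h2.add ((continuous_const.mul h3).neg.mul h1)

theorem norm_dds_mul_waveNeg_le (w : List E4) : ∀ {φ : E4 → ℂ}, ContDiff ℝ ∞ φ →
    HasCompactSupport φ → ∃ C : ℝ, 0 ≤ C ∧ ∀ ζ y,
      ‖dds w (fun y => φ y * waveNeg ζ y) y‖ ≤ C * (1 + ‖ζ‖) ^ w.length := by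
  induction w with
  | nil =>
    intro φ hφ hc
    obtain ⟨C, hC⟩ := hc.exists_bound_of_continuous hφ.continuous
    refine ⟨C, (norm_nonneg _).trans (hC 0), fun ζ y => ?_⟩
    simpa [dds, norm_waveNeg] using hC y
  | cons v w ih =>
    intro φ hφ hc
    obtain ⟨C, hC0, hC⟩ := ih hφ hc
    obtain ⟨D, hD0, hD⟩ := ih (contDiff_dd hφ v)
      (hc.mono' (subset_closure.trans (tsupport_dds_subset [v] φ)))
    refine ⟨D + ‖v‖ * C, by positivity, fun ζ y => ?_⟩
    rw [dds_cons_mul_waveNeg hφ, List.length_cons, pow_succ]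
    have h0 : (1 : ℝ) ≤ 1 + ‖ζ‖ := by linarith [norm_nonneg ζ]
    have hp : (0 : ℝ) ≤ (1 + ‖ζ‖) ^ w.length := by positivity
    calc _ ≤ D * (1 + ‖ζ‖) ^ w.length + (‖v‖ * ‖ζ‖) * (C * (1 + ‖ζ‖) ^ w.length) := by
          refine (norm_add_le _ _).trans (add_le_add (hD ζ y) ?_)
          rw [norm_mul]
          refine mul_le_mul ?_ (hC ζ y) (norm_nonneg _) (by positivity)
          simpa using abs_real_inner_le_norm v ζ
      _ ≤ D * ((1 + ‖ζ‖) ^ w.length * (1 + ‖ζ‖)) +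
          (‖v‖ * (1 + ‖ζ‖)) * (C * (1 + ‖ζ‖) ^ w.length) := by
          gcongr
          · exact le_mul_of_one_le_right hp h0
          · linarith
      _ = _ := by ring

theorem ft_dd {h : E4 → ℂ} (hs : ContDiff ℝ ∞ h) (hc : HasCompactSupport h) (v ζ : E4) :
    ft (dd v h) ζ = Complex.I * (inner ℝ v ζ : ℝ) * ft h ζ := by
  have := integral_exp_mul_dd (innerSL ℝ ζ) hs hc v
  simpa only [innerSL_apply_apply, real_inner_comm, ft, waveNeg] using this

/-- A polynomially bounded measurable function times the Fourier transform of a test function is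
integrable. -/
theorem integrable_mul_ft {g : E4 → ℂ} (hg : AEStronglyMeasurable g) {C : ℝ} {k : ℕ}
    (hb : ∀ ζ, ‖g ζ‖ ≤ C * (1 + ‖ζ‖) ^ k) {h : E4 → ℂ} (hs : ContDiff ℝ ∞ h)
    (hc : HasCompactSupport h) : Integrable fun ζ => g ζ * ft h (-ζ) := by
  obtain ⟨D, hD0, hD⟩ := norm_ft_le hs hc (k + 5)
  refine integrable_of_weight (C := C * D)
    (hg.mul ((continuous_ft hs hc).comp continuous_neg).aestronglyMeasurable) fun ζ => ?_
  have h1 := hD (-ζ)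
  rw [norm_neg] at h1
  rw [norm_mul]
  have hC : 0 ≤ C * (1 + ‖ζ‖) ^ k := (norm_nonneg _).trans (hb ζ)
  have hC0 : 0 ≤ C := nonneg_of_mul_nonneg_left hC (by positivity)
  calc ‖g ζ‖ * ‖ft h (-ζ)‖ * (1 + ‖ζ‖) ^ 5
      ≤ (C * (1 + ‖ζ‖) ^ k) * ‖ft h (-ζ)‖ * (1 + ‖ζ‖) ^ 5 := by gcongr; exact hb ζ
    _ = C * (‖ft h (-ζ)‖ * (1 + ‖ζ‖) ^ (k + 5)) := by ring
    _ ≤ C * D := by gcongr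

/-- Fourier inversion for `h`, multiplied by `φ` and differentiated. -/
theorem dds_mul_eq_integral (w : List E4) : ∀ {φ h : E4 → ℂ}, ContDiff ℝ ∞ φ →
    HasCompactSupport φ → ContDiff ℝ ∞ h → HasCompactSupport h → ∀ y,
      dds w (fun y => φ y * h y) y =
        c0 * ∫ ζ, dds w (fun y => φ y * waveNeg ζ y) y * ft h (-ζ) := by
  induction w with
  | nil =>
    intro φ h hφ _ hs hc y
    simp only [dds]
    rw [fourier_inversion hs hc y, mul_left_comm, ← integral_const_mul]
    simp only [mul_assoc]
  | cons v w ih =>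
    intro φ h hφ hφc hs hc y
    have hdc : ∀ {f : E4 → ℂ}, HasCompactSupport f → HasCompactSupport (dd v f) := fun {f} hf =>
      hf.mono' (subset_closure.trans (tsupport_dds_subset [v] f))
    have e1 : dd v (fun y => φ y * h y) = (fun y => dd v φ y * h y) + fun y => φ y * dd v h y :=
      dd_mul hφ hs v
    have i1 : ∀ {φ h : E4 → ℂ}, ContDiff ℝ ∞ φ → HasCompactSupport φ → ContDiff ℝ ∞ h →
        HasCompactSupport h →
        Integrable fun ζ => dds w (fun y => φ y * waveNeg ζ y) y * ft h (-ζ) := by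
      intro φ h hφ hφc hs hc
      obtain ⟨C, -, hC⟩ := norm_dds_mul_waveNeg_le w hφ hφc
      refine integrable_mul_ft ?_ (fun ζ => hC ζ y) hs hc
      exact ((continuous_dds_mul_waveNeg w hφ).comp
        (f := fun ζ : E4 => (ζ, y)) (by fun_prop)).aestronglyMeasurable
    rw [dds, e1, dds_add ((contDiff_dd hφ v).mul hs) (hφ.mul (contDiff_dd hs v)), Pi.add_apply,
      ih (contDiff_dd hφ v) (hdc hφc) hs hc, ih hφ hφc (contDiff_dd hs v) (hdc hc), ← mul_add,
      ← integral_add (i1 (contDiff_dd hφ v) (hdc hφc) hs hc)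
        (i1 hφ hφc (contDiff_dd hs v) (hdc hc))]
    congr 1
    refine integral_congr_ae (Filter.Eventually.of_forall fun ζ => ?_)
    simp only [dds_cons_mul_waveNeg hφ, ft_dd hs hc, inner_neg_right]
    push_cast
    ring

theorem IsTestC.mul_waveNeg {φ : E4 → ℂ} (hφ : IsTestC M φ) (ζ : E4) :
    IsTestC M fun y => φ y * waveNeg ζ y := hφ.mul_right (contDiff_waveNeg_right ζ)

theorem tsupport_mul_waveNeg {φ : E4 → ℂ} (ζ : E4) :
    tsupport (fun y => φ y * waveNeg ζ y) ⊆ tsupport φ := tsupport_mul_subset_left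

theorem continuous_jet {K : Set E4} (hKc : IsCompact K) (W : Finset (List E4)) {φ : E4 → ℂ}
    (hφ : ContDiff ℝ ∞ φ) : letI := isCompact_iff_compactSpace.1 hKc
    Continuous fun ζ => jet K W (fun y => φ y * waveNeg ζ y) (contDiff_mul_waveNeg hφ ζ) := by
  have := isCompact_iff_compactSpace.1 hKc
  refine continuous_pi fun w => ContinuousMap.continuous_of_continuous_uncurry _ ?_
  exact (continuous_dds_mul_waveNeg w.1 hφ).comp
    (f := fun q : E4 × K => (q.1, (q.2 : E4))) (by fun_prop)

theorem continuous_evalC_waveNeg (U : 𝓓'(M, ℂ)) {φ : E4 → ℂ} (hφ : IsTestC M φ) :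
    Continuous fun ζ => evalC (fun θ => U θ) (fun y => φ y * waveNeg ζ y) := by
  have hKc : IsCompact (tsupport φ) := hφ.compact
  have := isCompact_iff_compactSpace.1 hKc
  obtain ⟨W, V, hV⟩ := exists_jet_functional hKc hφ.subset U
  simp only [fun ζ => hV _ (contDiff_mul_waveNeg hφ.smooth ζ) (tsupport_mul_waveNeg ζ)]
  exact V.continuous.comp (continuous_jet hKc W hφ.smooth)

theorem norm_evalC_waveNeg_le (U : 𝓓'(M, ℂ)) {φ : E4 → ℂ} (hφ : IsTestC M φ) :
    ∃ (C : ℝ) (k : ℕ), 0 ≤ C ∧ ∀ ζ,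
      ‖evalC (fun θ => U θ) (fun y => φ y * waveNeg ζ y)‖ ≤ C * (1 + ‖ζ‖) ^ k := by
  obtain ⟨W, C, hC0, hC⟩ := norm_evalC_le hφ.compact hφ.subset U
  choose D hD0 hD using fun w => norm_dds_mul_waveNeg_le w hφ.smooth hφ.compact
  refine ⟨C * ∑ w ∈ W, D w, ∑ w ∈ W, w.length, mul_nonneg hC0
    (Finset.sum_nonneg fun w _ => hD0 w), fun ζ => ?_⟩
  have h0 : (1 : ℝ) ≤ 1 + ‖ζ‖ := by linarith [norm_nonneg ζ]
  rw [mul_assoc]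
  refine hC _ (contDiff_mul_waveNeg hφ.smooth ζ) (tsupport_mul_waveNeg ζ) _
    (mul_nonneg (Finset.sum_nonneg fun w _ => hD0 w) (by positivity)) fun w hw y => ?_
  refine (hD w ζ y).trans (mul_le_mul ?_ ?_ (by positivity)
    (Finset.sum_nonneg fun w _ => hD0 w))
  · exact Finset.single_le_sum (fun w _ => hD0 w) hw
  · exact pow_le_pow_right₀ h0 (Finset.single_le_sum (f := List.length)
      (fun w _ => Nat.zero_le _) hw)

/-- A distribution may be applied under the integral sign of the Fourier inversion formula. -/
theorem evalC_mul_eq_integral (U : 𝓓'(M, ℂ)) {φ h : E4 → ℂ} (hφ : IsTestC M φ)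
    (hs : ContDiff ℝ ∞ h) (hc : HasCompactSupport h) :
    evalC (fun θ => U θ) (fun y => φ y * h y) =
      c0 * ∫ ζ, evalC (fun θ => U θ) (fun y => φ y * waveNeg ζ y) * ft h (-ζ) := by
  have hKc : IsCompact (tsupport φ) := hφ.compact
  have := isCompact_iff_compactSpace.1 hKc
  obtain ⟨W, V, hV⟩ := exists_jet_functional hKc hφ.subset U
  let Φ : E4 → W → C(tsupport φ, ℂ) := fun ζ =>
    jet (tsupport φ) W (fun y => φ y * waveNeg ζ y) (contDiff_mul_waveNeg hφ.smooth ζ)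
  have hΦ : Continuous Φ := continuous_jet hKc W hφ.smooth
  have hft : Continuous fun ζ => ft h (-ζ) := (continuous_ft hs hc).comp continuous_neg
  have hint : Integrable fun ζ => ft h (-ζ) • Φ ζ := by
    choose D hD0 hD using fun w => norm_dds_mul_waveNeg_le w hφ.smooth hφ.compact
    obtain ⟨B, hB0, hB⟩ := norm_ft_le hs hc (∑ w ∈ W, w.length + 5)
    refine integrable_of_weight (C := B * ∑ w ∈ W, D w)
      (hft.smul hΦ).aestronglyMeasurable fun ζ => ?_
    have h0 : (1 : ℝ) ≤ 1 + ‖ζ‖ := by linarith [norm_nonneg ζ]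
    have hS : 0 ≤ ∑ w ∈ W, D w := Finset.sum_nonneg fun w _ => hD0 w
    have h1 : ‖Φ ζ‖ ≤ (∑ w ∈ W, D w) * (1 + ‖ζ‖) ^ (∑ w ∈ W, w.length) := by
      have hp : 0 ≤ (∑ w ∈ W, D w) * (1 + ‖ζ‖) ^ (∑ w ∈ W, w.length) :=
        mul_nonneg hS (by positivity)
      refine (pi_norm_le_iff_of_nonneg hp).2 fun w => ?_
      refine (ContinuousMap.norm_le _ hp).2 fun y => ?_
      refine (hD w.1 ζ y).trans (mul_le_mul ?_ ?_ (by positivity) hS)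
      · exact Finset.single_le_sum (fun w _ => hD0 w) w.2
      · exact pow_le_pow_right₀ h0 (Finset.single_le_sum (f := List.length)
          (fun w _ => Nat.zero_le _) w.2)
    have h2 := hB (-ζ)
    rw [norm_neg] at h2
    rw [norm_smul]
    calc ‖ft h (-ζ)‖ * ‖Φ ζ‖ * (1 + ‖ζ‖) ^ 5
        ≤ ‖ft h (-ζ)‖ * ((∑ w ∈ W, D w) * (1 + ‖ζ‖) ^ (∑ w ∈ W, w.length)) *
          (1 + ‖ζ‖) ^ 5 := by gcongr
      _ = ‖ft h (-ζ)‖ * (1 + ‖ζ‖) ^ (∑ w ∈ W, w.length + 5) * ∑ w ∈ W, D w := by ring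
      _ ≤ B * ∑ w ∈ W, D w := by gcongr
  have hφh : ContDiff ℝ ∞ fun y => φ y * h y := hφ.smooth.mul hs
  have hjet : jet (tsupport φ) W (fun y => φ y * h y) hφh = c0 • ∫ ζ, ft h (-ζ) • Φ ζ := by
    funext w
    ext y
    let E : (W → C(tsupport φ, ℂ)) →L[ℂ] ℂ :=
      (ContinuousMap.evalCLM ℂ y).comp (ContinuousLinearMap.proj w)
    have h1 : (∫ ζ, ft h (-ζ) • Φ ζ) w y = E (∫ ζ, ft h (-ζ) • Φ ζ) := rfl
    rw [Pi.smul_apply, ContinuousMap.smul_apply, h1, ← E.integral_comp_comm hint, smul_eq_mul]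
    refine (dds_mul_eq_integral w.1 hφ.smooth hφ.compact hs hc y).trans ?_
    congr 1
    refine integral_congr_ae (Filter.Eventually.of_forall fun ζ => ?_)
    exact mul_comm _ _
  rw [hV _ hφh tsupport_mul_subset_left, hjet, map_smul, ← V.integral_comp_comm hint, smul_eq_mul]
  congr 1
  refine integral_congr_ae (Filter.Eventually.of_forall fun ζ => ?_)
  simp only [map_smul, smul_eq_mul]
  rw [hV _ (contDiff_mul_waveNeg hφ.smooth ζ) (tsupport_mul_waveNeg ζ), mul_comm]

end Superposition

/-! ### Functionals bounded on bounded sets of test functions -/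

section Bounded

variable {M : Opens E4} {ι : Type*}

/-- A family of test functions supported in the compact set `K` that is bounded together with all
its derivatives. -/
structure BddTest (K : Set E4) (h : ι → E4 → ℂ) : Prop where
  compact : IsCompact K
  smooth : ∀ i, ContDiff ℝ ∞ (h i)
  zero : ∀ i, ∀ x ∉ K, h i x = 0
  bound : ∀ l : List E4, ∃ C : ℝ, ∀ i x, ‖dds l (h i) x‖ ≤ C

theorem BddTest.isTestC {K : Set E4} {h : ι → E4 → ℂ} (hb : BddTest K h)
    (hK : K ⊆ (M : Set E4)) (i : ι) : IsTestC M (h i) := by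
  have hs : tsupport (h i) ⊆ K := closure_minimal (fun x hx => by
    by_contra hxK
    exact hx (hb.zero i x hxK)) hb.compact.isClosed
  exact ⟨hb.smooth i, HasCompactSupport.intro hb.compact (hb.zero i), hs.trans hK⟩

theorem IsTestC.bddTest {h : E4 → ℂ} (hh : IsTestC M h) :
    BddTest (tsupport h) (fun (_ : ι) => h) := by
  refine ⟨hh.compact, fun _ => hh.smooth, fun _ x hx => image_eq_zero_of_notMem_tsupport hx,
    fun l => ?_⟩
  obtain ⟨C, hC⟩ := HasCompactSupport.exists_bound_of_continuous
    (hh.compact.mono' (subset_closure.trans (tsupport_dds_subset l h)))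
    (contDiff_dds hh.smooth l).continuous
  exact ⟨C, fun _ => hC⟩

theorem BddTest.symOn {K O : Set E4} {h : ι → E4 → ℂ} (hb : BddTest K h) (hO : IsOpen O)
    (hK : K ⊆ O) : SymOn O K 0 (fun i p => h i p.1) :=
  symOn_of_bdd hO hK (fun i => (hb.smooth i).contDiffOn) fun l => by
    obtain ⟨C, hC⟩ := hb.bound l
    exact ⟨C, fun i x _ => hC i x⟩

/-- The product of a symbol on `M` with a bounded family of test functions is an amplitude. -/
theorem IsSymbol.amp {m : ℝ} {a : E4 → E4 → ℂ} (ha : IsSymbol M m a) {K : Set E4}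
    {h : ι → E4 → ℂ} (hb : BddTest K h) (hK : K ⊆ (M : Set E4)) :
    Amp K m (fun i p => a p.1 p.2 * h i p.1) := by
  have h1 := (ha.symOn (ι := ι) hb.compact hK).mul (hb.symOn M.isOpen hK)
  rw [add_zero] at h1
  exact Amp.of_symOn h1 hb.compact fun i p hp => by
    rw [hb.zero i p.1 hp, mul_zero]

/-- A complex linear functional on test functions that is bounded on bounded families is a
distribution. -/
theorem exists_distribution (G : (E4 → ℂ) → ℂ)
    (hadd : ∀ h k, IsTestC M h → IsTestC M k → G (fun y => h y + k y) = G h + G k)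
    (hmul : ∀ (c : ℂ) h, IsTestC M h → G (fun y => c * h y) = c * G h)
    (hbdd : ∀ (ι : Type) (K : Set E4) (h : ι → E4 → ℂ), K ⊆ (M : Set E4) → BddTest K h →
      ∃ C, ∀ i, ‖G (h i)‖ ≤ C) :
    ∃ U : 𝓓'(M, ℂ), (∀ φ : 𝓓(M, ℝ), U φ = G (fun y => (φ y : ℂ))) ∧
      ∀ h, IsTestC M h → evalC (fun φ => U φ) h = G h := by
  have h1 : ∀ f g : 𝓓(M, ℝ), G (fun y => ((f + g) y : ℂ)) =
      G (fun y => (f y : ℂ)) + G (fun y => (g y : ℂ)) := fun f g => by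
    rw [← hadd _ _ (isTestC_ofReal f) (isTestC_ofReal g)]
    congr 1
    funext y
    exact Complex.ofReal_add _ _
  have h2 : ∀ (c : ℝ) (f : 𝓓(M, ℝ)), G (fun y => ((c • f) y : ℂ)) =
      c • G (fun y => (f y : ℂ)) := fun c f => by
    rw [Complex.real_smul, ← hmul _ _ (isTestC_ofReal f)]
    congr 1
    funext y
    exact Complex.ofReal_mul _ _
  have hcont : ∀ (K : Compacts E4) (hK : (K : Set E4) ⊆ (M : Set E4)),
      Continuous ((fun f : 𝓓(M, ℝ) => G (fun y => (f y : ℂ))) ∘ TestFunction.ofSupportedIn hK) := by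
    intro K hK
    let T : 𝓓_{K}(E4, ℝ) →ₗ[ℝ] ℂ :=
      { toFun := fun f => G (fun y => (f y : ℂ))
        map_add' := fun f g =>
          h1 (TestFunction.ofSupportedIn hK f) (TestFunction.ofSupportedIn hK g)
        map_smul' := fun c f => h2 c (TestFunction.ofSupportedIn hK f) }
    have hws := ContDiffMapSupportedIn.withSeminorms ℝ E4 ℝ ⊤ K
    have := hws.firstCountableTopology
    refine T.continuous_of_locally_bounded (𝕜 := ℝ) fun s hs => ?_
    rw [hws.isVonNBounded_iff_seminorm_bounded] at hs
    rw [NormedSpace.isVonNBounded_iff, isBounded_iff_forall_norm_le]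
    have hb : BddTest (K : Set E4) (fun (f : s) y => ((f.1 y : ℝ) : ℂ)) := by
      refine ⟨K.isCompact, fun f => Complex.ofRealCLM.contDiff.comp
        (show ContDiff ℝ ∞ f.1 from f.1.contDiff), fun f x hx => ?_, fun l => ?_⟩
      · have : f.1 x = 0 := f.1.zero_on_compl hx
        simp [this]
      · obtain ⟨C, hC0, hC⟩ := norm_dds_le_iteratedFDeriv (isOpen_univ (X := E4)) l
        obtain ⟨r, -, hr⟩ := hs l.length
        refine ⟨C * r, fun f x => ?_⟩
        have hfs : ContDiff ℝ ∞ f.1 := f.1.contDiff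
        refine (hC _ (Complex.ofRealCLM.contDiff.comp hfs).contDiffOn x trivial).trans ?_
        refine mul_le_mul_of_nonneg_left ?_ hC0
        have e : ‖iteratedFDeriv ℝ l.length (Complex.ofRealCLM ∘ f.1) x‖ =
            ‖iteratedFDeriv ℝ l.length f.1 x‖ :=
          Complex.ofRealLI.norm_iteratedFDeriv_comp_left hfs.contDiffAt
            (WithTop.coe_le_coe.2 le_top)
        rw [e]
        exact (ContDiffMapSupportedIn.norm_iteratedFDeriv_apply_le_seminorm_top ℝ).trans
          (hr f.1 f.2).le
    obtain ⟨C, hC⟩ := hbdd s K _ hK hb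
    exact ⟨C, by rintro _ ⟨f, hf, rfl⟩; exact hC ⟨f, hf⟩⟩
  let U : 𝓓'(M, ℂ) := TestFunction.mkCLM ℝ (fun f : 𝓓(M, ℝ) => G (fun y => (f y : ℂ))) h1 h2 hcont
  have hU : ∀ φ : 𝓓(M, ℝ), U φ = G (fun y => (φ y : ℂ)) := fun φ => rfl
  refine ⟨U, hU, fun h hh => ?_⟩
  have key : ∀ f : E4 → ℝ, IsTest M f → evalReal (fun φ => U φ) f = G (fun y => (f y : ℂ)) := by
    intro f hf
    rw [evalReal, dif_pos hf]
    exact hU _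
  rw [evalC, key _ hh.re, key _ hh.im, ← hmul _ _ hh.im.ofReal,
    ← hadd _ _ hh.re.ofReal (hh.im.ofReal.mul_left contDiff_const)]
  congr 1
  funext y
  rw [mul_comm]
  exact Complex.re_add_im (h y)

end Bounded

/-! ### Fourier transforms of products with symbols and kernels -/

section SymbolFourier

variable {M : Opens E4} {ι : Type*}

/-- The Fourier transform of `a(·, ζ) h` at the frequency `θ`. -/
def symFt (a : E4 → E4 → ℂ) (h : E4 → ℂ) (θ ζ : E4) : ℂ :=
  ampFourier (fun p : E4 × E4 => a p.1 p.2 * h p.1) (innerSL ℝ θ) ζ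

theorem symFt_eq (a : E4 → E4 → ℂ) (h : E4 → ℂ) (θ ζ : E4) :
    symFt a h θ ζ = ft (fun x => a x ζ * h x) θ := by
  simp only [symFt, ft, ampFourier, waveNeg, innerSL_apply_apply, real_inner_comm]

theorem ft_mul_waveNeg (h : E4 → ℂ) (η θ : E4) :
    ft (fun y => h y * waveNeg η y) θ = ft h (η + θ) := by
  simp only [ft, waveNeg_add]
  refine integral_congr_ae (Filter.Eventually.of_forall fun y => ?_)
  simp only
  ring

theorem symFt_mul_waveNeg (a : E4 → E4 → ℂ) (h : E4 → ℂ) (η θ ζ : E4) :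
    symFt a (fun y => h y * waveNeg η y) θ ζ = symFt a h (η + θ) ζ := by
  rw [symFt_eq, symFt_eq, ← ft_mul_waveNeg]
  simp only [mul_assoc]

theorem one_le_one_add_norm {V : Type*} [NormedAddCommGroup V] (ζ : V) : (1 : ℝ) ≤ 1 + ‖ζ‖ := by
  linarith [norm_nonneg ζ]

theorem rpow_le_pow_ceil (m : ℝ) (ζ : E4) : (1 + ‖ζ‖) ^ m ≤ (1 + ‖ζ‖) ^ ⌈m⌉₊ := by
  rw [← Real.rpow_natCast]
  exact Real.rpow_le_rpow_of_exponent_le (one_le_one_add_norm ζ) (Nat.le_ceil m)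

theorem norm_symFt_le {m : ℝ} {a : E4 → E4 → ℂ} (ha : IsSymbol M m a) {K : Set E4}
    {h : ι → E4 → ℂ} (hb : BddTest K h) (hK : K ⊆ (M : Set E4)) (N : ℕ) :
    ∃ C : ℝ, 0 ≤ C ∧ ∀ i θ ζ,
      ‖symFt a (h i) θ ζ‖ * (1 + ‖θ‖) ^ N ≤ C * (1 + ‖ζ‖) ^ ⌈m⌉₊ := by
  obtain ⟨C, hC0, hC⟩ := (ha.amp hb hK).norm_ampFourier_le N
  refine ⟨C, hC0, fun i θ ζ => ?_⟩
  have h1 := hC i (innerSL ℝ θ) ζ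
  rw [innerSL_apply_norm] at h1
  exact h1.trans (mul_le_mul_of_nonneg_left (rpow_le_pow_ceil m ζ) hC0)

theorem continuous_symFt {m : ℝ} {a : E4 → E4 → ℂ} (ha : IsSymbol M m a) {h : E4 → ℂ}
    (hh : IsTestC M h) : Continuous fun q : E4 × E4 => symFt a h q.1 q.2 :=
  ((ha.amp (hh.bddTest (ι := Unit)) hh.subset).continuous_ampFourier ()).comp
    (f := fun q : E4 × E4 => (innerSL ℝ q.1, q.2)) (by fun_prop)

theorem integrable_symFt_integrand {m : ℝ} {a : E4 → E4 → ℂ} (ha : IsSymbol M m a) {h : E4 → ℂ}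
    (hh : IsTestC M h) (θ ζ : E4) : Integrable fun x => waveNeg θ x * (a x ζ * h x) := by
  have hA := ha.amp (hh.bddTest (ι := Unit)) hh.subset
  have h1 := hA.slice_contDiff () ζ
  have h2 := hA.slice_hasCompactSupport () ζ
  exact ((contDiff_waveNeg_right θ).continuous.mul h1.continuous).integrable_of_hasCompactSupport
    h2.mul_left

theorem symFt_add {m : ℝ} {a : E4 → E4 → ℂ} (ha : IsSymbol M m a) {h k : E4 → ℂ}
    (hh : IsTestC M h) (hk : IsTestC M k) (θ ζ : E4) :
    symFt a (fun y => h y + k y) θ ζ = symFt a h θ ζ + symFt a k θ ζ := by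
  simp only [symFt_eq, ft, mul_add]
  exact integral_add (integrable_symFt_integrand ha hh θ ζ) (integrable_symFt_integrand ha hk θ ζ)

theorem symFt_const_mul (a : E4 → E4 → ℂ) (c : ℂ) (h : E4 → ℂ) (θ ζ : E4) :
    symFt a (fun y => c * h y) θ ζ = c * symFt a h θ ζ := by
  simp only [symFt_eq, ft]
  rw [← integral_const_mul]
  refine integral_congr_ae (Filter.Eventually.of_forall fun y => ?_)
  simp only
  ring

/-- The linear form `(x, y) ↦ x·θ + y·σ`. -/
def pairCLM (θ σ : E4) : E4 × E4 →L[ℝ] ℝ := (innerSL ℝ θ).coprod (innerSL ℝ σ)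

theorem pairCLM_apply (θ σ : E4) (p : E4 × E4) :
    pairCLM θ σ p = inner ℝ p.1 θ + inner ℝ p.2 σ := by
  simp [pairCLM, real_inner_comm]

theorem norm_left_le_pairCLM (θ σ : E4) : ‖θ‖ ≤ ‖pairCLM θ σ‖ := by
  have h1 : innerSL ℝ θ = (pairCLM θ σ).comp (ContinuousLinearMap.inl ℝ E4 E4) := by
    ext x; simp [pairCLM]
  rw [← innerSL_apply_norm (𝕜 := ℝ) θ, h1]
  exact (ContinuousLinearMap.opNorm_comp_le _ _).trans
    (mul_le_of_le_one_right (norm_nonneg _) (ContinuousLinearMap.norm_inl_le_one ℝ E4 E4))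

theorem norm_right_le_pairCLM (θ σ : E4) : ‖σ‖ ≤ ‖pairCLM θ σ‖ := by
  have h1 : innerSL ℝ σ = (pairCLM θ σ).comp (ContinuousLinearMap.inr ℝ E4 E4) := by
    ext x; simp [pairCLM]
  rw [← innerSL_apply_norm (𝕜 := ℝ) σ, h1]
  exact (ContinuousLinearMap.opNorm_comp_le _ _).trans
    (mul_le_of_le_one_right (norm_nonneg _) (ContinuousLinearMap.norm_inr_le_one ℝ E4 E4))

theorem exp_pairCLM (θ σ : E4) (p : E4 × E4) :
    Complex.exp (-(Complex.I * (pairCLM θ σ p : ℝ))) = waveNeg θ p.1 * waveNeg σ p.2 := by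
  rw [pairCLM_apply, waveNeg, waveNeg, ← Complex.exp_add]
  push_cast
  ring_nf

/-- The Fourier transform on `E4 × E4` is an iterated one. -/
theorem ampFourier_pairCLM {K : Set (E4 × E4)} {m : ℝ} {a : ι → (E4 × E4) × E4 → ℂ}
    (h : Amp K m a) (i : ι) (θ σ ζ : E4) :
    ampFourier (a i) (pairCLM θ σ) ζ =
      ∫ y, waveNeg σ y * ∫ x, waveNeg θ x * a i ((x, y), ζ) := by
  have hint : Integrable fun p : E4 × E4 =>
      waveNeg θ p.1 * waveNeg σ p.2 * a i (p, ζ) := by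
    refine Continuous.integrable_of_hasCompactSupport ?_ (h.slice_hasCompactSupport i ζ).mul_left
    exact (((contDiff_waveNeg_right θ).continuous.comp continuous_fst).mul
      ((contDiff_waveNeg_right σ).continuous.comp continuous_snd)).mul
        (h.slice_contDiff i ζ).continuous
  simp only [ampFourier, exp_pairCLM]
  rw [Measure.volume_eq_prod] at hint ⊢
  rw [integral_prod_symm _ hint]
  refine integral_congr_ae (Filter.Eventually.of_forall fun y => ?_)
  simp only
  rw [← integral_const_mul]
  refine integral_congr_ae (Filter.Eventually.of_forall fun x => ?_)
  simp only
  ring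

theorem contDiff_integral_param {g : E4 × E4 → ℂ} (hg : ContDiff ℝ ∞ g) {K : Set E4}
    (hK : IsCompact K) (hz : ∀ p : E4 × E4, p.1 ∉ K → g p = 0) :
    ContDiff ℝ ∞ fun y => ∫ x, g (x, y) := by
  have h := contDiffOn_convolution_right_with_param_comp (n := ⊤) (μ := (volume : Measure E4))
    (ContinuousLinearMap.mul ℝ ℂ) (s := (Set.univ : Set E4)) (v := fun _ => (0 : E4))
    contDiffOn_const (f := fun _ => (1 : ℂ)) (g := fun y t => g (-t, y)) (k := -K) isOpen_univ
    hK.neg (fun y t _ ht => hz _ (by simpa using ht)) (by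
      exact (locallyIntegrable_const (1 : ℂ))) (by
      have : ContDiff ℝ ∞ fun q : E4 × E4 => g (-q.2, q.1) := by fun_prop
      exact this.contDiffOn)
  rw [contDiffOn_univ] at h
  have e : (fun y => ∫ x, g (x, y)) = fun y => convolution (fun _ => (1 : ℂ))
      (fun t => g (-t, y)) (ContinuousLinearMap.mul ℝ ℂ) volume 0 := by
    funext y
    simp [convolution]
  rw [e]
  exact h

/-- The product of a smooth kernel on `M × M` with test functions in both variables is an
amplitude. -/
theorem amp_kernel {κ : E4 → E4 → ℂ}
    (hκ : ContDiffOn ℝ ∞ (fun p : E4 × E4 => κ p.1 p.2) ((M : Set E4) ×ˢ (M : Set E4)))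
    {K : Set E4} {h : ι → E4 → ℂ} (hb : BddTest K h) (hK : K ⊆ (M : Set E4)) {ψ : E4 → ℂ}
    (hψ : IsTestC M ψ) :
    Amp (K ×ˢ tsupport ψ) 0
      (fun i (p : (E4 × E4) × E4) => h i p.1.1 * κ p.1.1 p.1.2 * ψ p.1.2) := by
  have hc : IsCompact (K ×ˢ tsupport ψ) := hb.compact.prod hψ.compact
  have hO : IsOpen ((M : Set E4) ×ˢ (M : Set E4)) := M.isOpen.prod M.isOpen
  have hsub : K ×ˢ tsupport ψ ⊆ (M : Set E4) ×ˢ (M : Set E4) := Set.prod_mono hK hψ.subset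
  have h1 := ((hb.symOn isOpen_univ (Set.subset_univ _)).comp
    (ContinuousLinearMap.fst ℝ E4 E4)).mono hO (by simp) (fun p hp => hp.1) hsub
  have h2 := symOn_of_contDiffOn (ι := ι) hO hsub hc hκ
  have h3 := symOn_of_contDiffOn (ι := ι) hO hsub hc (f := fun p : E4 × E4 => ψ p.2)
    (hψ.smooth.comp contDiff_snd).contDiffOn
  have h4 := (h1.mul h2).mul h3
  simp only [add_zero] at h4
  refine Amp.of_symOn h4 hc fun i p hp => ?_
  by_cases hp1 : p.1.1 ∈ K
  · rw [image_eq_zero_of_notMem_tsupport (f := ψ) (fun hp2 => hp ⟨hp1, hp2⟩), mul_zero]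
  · rw [hb.zero i _ hp1, zero_mul, zero_mul]

end SymbolFourier

/-! ### The action of pseudodifferential operators on compactly supported distributions -/

section Action

variable {M : Opens E4} {ι : Type*} {m : ℝ}

/-- The Fourier transform of `ψ U`, for a test function `ψ`. -/
def locFt (U : 𝓓'(M, ℂ)) (ψ : E4 → ℂ) (ζ : E4) : ℂ :=
  evalC (fun θ => U θ) (fun y => ψ y * waveNeg ζ y)

theorem norm_integral_le_weight {f : E4 → ℂ} {C : ℝ} (h : ∀ ζ, ‖f ζ‖ * (1 + ‖ζ‖) ^ 5 ≤ C) :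
    ‖∫ ζ, f ζ‖ ≤ C * ∫ ζ : E4, ((1 + ‖ζ‖) ^ 5)⁻¹ := by
  rw [← integral_const_mul]
  refine norm_integral_le_of_norm_le (integrable_weight.const_mul C)
    (Filter.Eventually.of_forall fun ζ => ?_)
  rw [← div_eq_mul_inv, le_div_iff₀ (by positivity)]
  exact h ζ

/-- A polynomially bounded factor is absorbed by rapid decrease of the other one, which is allowed to
be relative to a weight `(1 + |ζ|)^l`. -/
theorem locFt_weight {u : E4 → ℂ} {C : ℝ} {k : ℕ} (hu : ∀ ζ, ‖u ζ‖ ≤ C * (1 + ‖ζ‖) ^ k)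
    {b : E4 → ℂ} {D : ℝ} {l : ℕ} (hb : ∀ ζ, ‖b ζ‖ * (1 + ‖ζ‖) ^ (k + l + 5) ≤ D * (1 + ‖ζ‖) ^ l)
    (ζ : E4) : ‖u ζ * b ζ‖ * (1 + ‖ζ‖) ^ 5 ≤ C * D := by
  have h0 : (0 : ℝ) < (1 + ‖ζ‖) ^ l := by positivity
  have hC0 : 0 ≤ C := nonneg_of_mul_nonneg_left ((norm_nonneg _).trans (hu ζ)) (by positivity)
  rw [norm_mul]
  refine le_of_mul_le_mul_right ?_ h0
  calc ‖u ζ‖ * ‖b ζ‖ * (1 + ‖ζ‖) ^ 5 * (1 + ‖ζ‖) ^ l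
      ≤ (C * (1 + ‖ζ‖) ^ k) * ‖b ζ‖ * (1 + ‖ζ‖) ^ 5 * (1 + ‖ζ‖) ^ l := by gcongr; exact hu ζ
    _ = C * (‖b ζ‖ * (1 + ‖ζ‖) ^ (k + l + 5)) := by ring
    _ ≤ C * (D * (1 + ‖ζ‖) ^ l) := mul_le_mul_of_nonneg_left (hb ζ) hC0
    _ = _ := by ring

theorem continuous_locFt (U : 𝓓'(M, ℂ)) {ψ : E4 → ℂ} (hψ : IsTestC M ψ) :
    Continuous (locFt U ψ) := continuous_evalC_waveNeg U hψ

theorem norm_locFt_le (U : 𝓓'(M, ℂ)) {ψ : E4 → ℂ} (hψ : IsTestC M ψ) :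
    ∃ (C : ℝ) (k : ℕ), 0 ≤ C ∧ ∀ ζ, ‖locFt U ψ ζ‖ ≤ C * (1 + ‖ζ‖) ^ k :=
  norm_evalC_waveNeg_le U hψ

/-- The double Fourier transform of `h(x) κ(x, y) ψ(y)`. -/
def kerFt (κ : E4 → E4 → ℂ) (ψ h : E4 → ℂ) (θ σ : E4) : ℂ :=
  ampFourier (fun p : (E4 × E4) × E4 => h p.1.1 * κ p.1.1 p.1.2 * ψ p.1.2) (pairCLM θ σ) 0

theorem kerFt_mul_waveNeg (κ : E4 → E4 → ℂ) (ψ h : E4 → ℂ) (η θ σ : E4) :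
    kerFt κ ψ (fun y => h y * waveNeg η y) θ σ = kerFt κ ψ h (η + θ) σ := by
  simp only [kerFt, ampFourier, exp_pairCLM, waveNeg_add]
  refine integral_congr_ae (Filter.Eventually.of_forall fun y => ?_)
  simp only
  ring

/-- The part of the action given by the symbol. -/
def opMain (a : E4 → E4 → ℂ) (U : 𝓓'(M, ℂ)) (ψ h : E4 → ℂ) : ℂ :=
  c0 * ∫ ζ, locFt U ψ ζ * symFt a h (-ζ) ζ

/-- The part of the action given by the smooth kernel. -/
def opKer (κ : E4 → E4 → ℂ) (U : 𝓓'(M, ℂ)) (ψ h : E4 → ℂ) : ℂ :=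
  evalC (fun θ => U θ) (fun y => ψ y * ∫ x, κ x y * h x)

/-- The value of `A U` at a complex test function `h`, for a cutoff `ψ` of `U`. -/
def PsiDO.act (A : PsiDO M m) (U : 𝓓'(M, ℂ)) (ψ h : E4 → ℂ) : ℂ :=
  opMain A.symbol U ψ h + opKer A.kernel U ψ h

theorem norm_pow_mul_pow_le (θ σ : E4) (N : ℕ) :
    (1 + ‖θ‖) ^ N * (1 + ‖σ‖) ^ N ≤ (1 + ‖pairCLM θ σ‖) ^ (2 * N) := by
  rw [two_mul, pow_add]
  gcongr
  · exact norm_left_le_pairCLM θ σ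
  · exact norm_right_le_pairCLM θ σ

theorem continuous_pairCLM : Continuous fun q : E4 × E4 => pairCLM q.1 q.2 := by
  have e : (fun q : E4 × E4 => pairCLM q.1 q.2) = fun q =>
      (innerSL ℝ q.1).comp (ContinuousLinearMap.fst ℝ E4 E4) +
        (innerSL ℝ q.2).comp (ContinuousLinearMap.snd ℝ E4 E4) := by
    funext q
    ext p <;> simp [pairCLM]
  rw [e]
  fun_prop

theorem mul_integral_kernel (κ : E4 → E4 → ℂ) (ψ h : E4 → ℂ) (y : E4) :
    ψ y * ∫ x, κ x y * h x = ∫ x, h x * κ x y * ψ y := by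
  rw [← integral_const_mul]
  refine integral_congr_ae (Filter.Eventually.of_forall fun x => ?_)
  simp only
  ring

theorem isTestC_kernel {κ : E4 → E4 → ℂ}
    (hκ : ContDiffOn ℝ ∞ (fun p : E4 × E4 => κ p.1 p.2) ((M : Set E4) ×ˢ (M : Set E4)))
    {ψ h : E4 → ℂ} (hψ : IsTestC M ψ) (hh : IsTestC M h) :
    IsTestC M (fun y => ψ y * ∫ x, κ x y * h x) := by
  have hA := amp_kernel hκ (hh.bddTest (ι := Unit)) hh.subset hψ
  have hs : tsupport (fun y => ψ y * ∫ x, κ x y * h x) ⊆ tsupport ψ := tsupport_mul_subset_left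
  refine ⟨?_, hψ.compact.mul_right, hs.trans hψ.subset⟩
  simp only [mul_integral_kernel]
  exact contDiff_integral_param (hA.slice_contDiff () 0) hh.compact fun p hp => by
    simp [image_eq_zero_of_notMem_tsupport hp]

theorem norm_kerFt_le {κ : E4 → E4 → ℂ}
    (hκ : ContDiffOn ℝ ∞ (fun p : E4 × E4 => κ p.1 p.2) ((M : Set E4) ×ˢ (M : Set E4)))
    {K : Set E4} {h : ι → E4 → ℂ} (hb : BddTest K h) (hK : K ⊆ (M : Set E4)) {ψ : E4 → ℂ}
    (hψ : IsTestC M ψ) (N : ℕ) : ∃ C : ℝ, 0 ≤ C ∧ ∀ i θ σ,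
      ‖kerFt κ ψ (h i) θ σ‖ * ((1 + ‖θ‖) ^ N * (1 + ‖σ‖) ^ N) ≤ C := by
  obtain ⟨C, hC0, hC⟩ := (amp_kernel hκ hb hK hψ).norm_ampFourier_le (2 * N)
  refine ⟨C, hC0, fun i θ σ => ?_⟩
  have h1 := hC i (pairCLM θ σ) 0
  rw [norm_zero, add_zero, Real.one_rpow, mul_one] at h1
  exact (mul_le_mul_of_nonneg_left (norm_pow_mul_pow_le θ σ N) (norm_nonneg _)).trans h1

theorem ft_kernel {κ : E4 → E4 → ℂ}
    (hκ : ContDiffOn ℝ ∞ (fun p : E4 × E4 => κ p.1 p.2) ((M : Set E4) ×ˢ (M : Set E4)))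
    {ψ h : E4 → ℂ} (hψ : IsTestC M ψ) (hh : IsTestC M h) (σ : E4) :
    ft (fun y => ψ y * ∫ x, κ x y * h x) σ = kerFt κ ψ h 0 σ := by
  rw [kerFt, ampFourier_pairCLM (amp_kernel hκ (hh.bddTest (ι := Unit)) hh.subset hψ) ()]
  simp only [ft, mul_integral_kernel, waveNeg, inner_zero_right, Complex.ofReal_zero, mul_zero,
    neg_zero, Complex.exp_zero, one_mul]

/-- The action of a smooth kernel in terms of the Fourier transforms of `ψ U` and of the kernel. -/
theorem opKer_eq {κ : E4 → E4 → ℂ}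
    (hκ : ContDiffOn ℝ ∞ (fun p : E4 × E4 => κ p.1 p.2) ((M : Set E4) ×ˢ (M : Set E4)))
    {U : 𝓓'(M, ℂ)} {ψ : 𝓓(M, ℝ)} (hψ : IsCutoff ψ (fun θ => U θ)) {h : E4 → ℂ}
    (hh : IsTestC M h) : opKer κ U (fun y => (ψ y : ℂ)) h =
      c0 * ∫ τ, locFt U (fun y => (ψ y : ℂ)) τ * kerFt κ (fun y => (ψ y : ℂ)) h 0 (-τ) := by
  have h1 := isTestC_kernel hκ (isTestC_ofReal ψ) hh
  rw [opKer, ← evalC_cutoff_mul hψ h1,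
    evalC_mul_eq_integral U (isTestC_ofReal ψ) h1.smooth h1.compact]
  simp only [ft_kernel hκ (isTestC_ofReal ψ) hh, locFt]

theorem contDiffOn_integral_kernel {κ : E4 → E4 → ℂ}
    (hκ : ContDiffOn ℝ ∞ (fun p : E4 × E4 => κ p.1 p.2) ((M : Set E4) ×ˢ (M : Set E4)))
    {h : E4 → ℂ} (hh : IsTestC M h) : ContDiffOn ℝ ∞ (fun y => ∫ x, κ x y * h x) M := by
  intro y hy
  obtain ⟨χ, h1, -⟩ := exists_cutoff (M := M) (isCompact_singleton (x := y)) M.isOpen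
    (Set.singleton_subset_iff.2 hy) subset_rfl
  rw [nhdsSet_singleton] at h1
  refine ((isTestC_kernel hκ (isTestC_ofReal χ) hh).smooth.contDiffAt.congr_of_eventuallyEq
    ?_).contDiffWithinAt
  filter_upwards [h1] with z hz
  rw [hz, Complex.ofReal_one, one_mul]

/-- On real test functions, `PsiDO.act` is the action of the operator. -/
theorem PsiDO.apply_eq (A : PsiDO M m) {U : 𝓓'(M, ℂ)} {ψ : 𝓓(M, ℝ)}
    (hψ : IsCutoff ψ (fun θ => U θ)) (φ : 𝓓(M, ℝ)) :
    A.apply (fun θ => U θ) φ = A.act U (fun y => (ψ y : ℂ)) (fun y => (φ y : ℂ)) := by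
  have h1 : ∀ ζ, fourierCompact (fun θ => U θ) ζ = locFt U (fun y => (ψ y : ℂ)) ζ := fun ζ =>
    pairSmooth_eq U hψ (contDiff_waveNeg_right ζ).contDiffOn
  have h2 := pairSmooth_eq U hψ (contDiffOn_integral_kernel A.smooth_kernel (isTestC_ofReal φ))
  rw [PsiDO.apply, h2, PsiDO.act, opMain, opKer]
  simp only [h1, symFt_eq, ft, waveNeg, inner_neg_right, Complex.ofReal_neg, mul_neg, neg_neg,
    mul_assoc, c0]

/-! ### The image of a distribution under a pseudodifferential operator -/

theorem integrable_opMain {a : E4 → E4 → ℂ} (ha : IsSymbol M m a) (U : 𝓓'(M, ℂ)) {ψ h : E4 → ℂ}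
    (hψ : IsTestC M ψ) (hh : IsTestC M h) (η : E4) :
    Integrable fun ζ => locFt U ψ ζ * symFt a h (η - ζ) ζ := by
  obtain ⟨C, k, hC0, hC⟩ := norm_locFt_le U hψ
  have hη := hh.mul_waveNeg η
  obtain ⟨D, hD0, hD⟩ := norm_symFt_le ha (hη.bddTest (ι := Unit)) hη.subset (k + ⌈m⌉₊ + 5)
  have hD' := fun ζ => hD () (-ζ) ζ
  simp only [norm_neg, symFt_mul_waveNeg, ← sub_eq_add_neg] at hD'
  exact integrable_of_weight (((continuous_locFt U hψ).mul
    ((continuous_symFt ha hh).comp (f := fun ζ => (η - ζ, ζ)) (by fun_prop))).aestronglyMeasurable)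
    (locFt_weight hC hD')

theorem exists_norm_opMain_le {a : E4 → E4 → ℂ} (ha : IsSymbol M m a) (U : 𝓓'(M, ℂ)) {ψ : E4 → ℂ}
    (hψ : IsTestC M ψ) {K : Set E4} {h : ι → E4 → ℂ} (hb : BddTest K h) (hK : K ⊆ (M : Set E4)) :
    ∃ C, ∀ i, ‖opMain a U ψ (h i)‖ ≤ C := by
  obtain ⟨C, k, hC0, hC⟩ := norm_locFt_le U hψ
  obtain ⟨D, hD0, hD⟩ := norm_symFt_le ha hb hK (k + ⌈m⌉₊ + 5)
  refine ⟨‖c0‖ * (C * D * ∫ ζ : E4, ((1 + ‖ζ‖) ^ 5)⁻¹), fun i => ?_⟩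
  have hD' := fun ζ => hD i (-ζ) ζ
  simp only [norm_neg] at hD'
  rw [opMain, norm_mul]
  exact mul_le_mul_of_nonneg_left (norm_integral_le_weight (locFt_weight hC hD')) (norm_nonneg _)

theorem exists_norm_opKer_le {κ : E4 → E4 → ℂ}
    (hκ : ContDiffOn ℝ ∞ (fun p : E4 × E4 => κ p.1 p.2) ((M : Set E4) ×ˢ (M : Set E4)))
    {U : 𝓓'(M, ℂ)} {ψ : 𝓓(M, ℝ)} (hψ : IsCutoff ψ (fun θ => U θ)) {K : Set E4} {h : ι → E4 → ℂ}
    (hb : BddTest K h) (hK : K ⊆ (M : Set E4)) :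
    ∃ C, ∀ i, ‖opKer κ U (fun y => (ψ y : ℂ)) (h i)‖ ≤ C := by
  obtain ⟨C, k, hC0, hC⟩ := norm_locFt_le U (isTestC_ofReal ψ)
  obtain ⟨D, hD0, hD⟩ := norm_kerFt_le hκ hb hK (isTestC_ofReal ψ) (k + 0 + 5)
  refine ⟨‖c0‖ * (C * D * ∫ ζ : E4, ((1 + ‖ζ‖) ^ 5)⁻¹), fun i => ?_⟩
  have hD' := fun ζ => hD i 0 (-ζ)
  simp only [norm_neg, norm_zero, add_zero, one_pow, one_mul] at hD'
  rw [opKer_eq hκ hψ (hb.isTestC hK i), norm_mul]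
  refine mul_le_mul_of_nonneg_left (norm_integral_le_weight (locFt_weight (l := 0) hC fun ζ => ?_))
    (norm_nonneg _)
  simpa using hD' ζ

theorem PsiDO.act_add (A : PsiDO M m) (U : 𝓓'(M, ℂ)) {ψ h k : E4 → ℂ} (hψ : IsTestC M ψ)
    (hh : IsTestC M h) (hk : IsTestC M k) :
    A.act U ψ (fun y => h y + k y) = A.act U ψ h + A.act U ψ k := by
  have i1 := integrable_opMain A.isSymbol U hψ hh 0
  have i2 := integrable_opMain A.isSymbol U hψ hk 0
  simp only [zero_sub] at i1 i2
  have hint : ∀ f : E4 → ℂ, IsTestC M f → ∀ y, Integrable fun x => f x * A.kernel x y * ψ y := by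
    intro f hf y
    have hA := amp_kernel A.smooth_kernel (hf.bddTest (ι := Unit)) hf.subset hψ
    refine Continuous.integrable_of_hasCompactSupport
      ((hA.slice_contDiff () 0).continuous.comp (f := fun x => (x, y)) (by fun_prop)) ?_
    exact HasCompactSupport.intro hf.compact fun x hx => by
      simp [image_eq_zero_of_notMem_tsupport hx]
  have h1 : (fun y => ψ y * ∫ x, A.kernel x y * (h x + k x)) = fun y =>
      (ψ y * ∫ x, A.kernel x y * h x) + ψ y * ∫ x, A.kernel x y * k x := by
    funext y
    simp only [mul_integral_kernel]
    rw [← integral_add (hint h hh y) (hint k hk y)]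
    refine integral_congr_ae (Filter.Eventually.of_forall fun x => ?_)
    simp only
    ring
  simp only [mul_add] at h1
  simp only [PsiDO.act, opMain, opKer, symFt_add A.isSymbol hh hk, mul_add]
  rw [integral_add i1 i2, h1, evalC_add U (isTestC_kernel A.smooth_kernel hψ hh)
    (isTestC_kernel A.smooth_kernel hψ hk)]
  ring

theorem PsiDO.act_const_mul (A : PsiDO M m) (U : 𝓓'(M, ℂ)) {ψ h : E4 → ℂ} (hψ : IsTestC M ψ)
    (hh : IsTestC M h) (c : ℂ) : A.act U ψ (fun y => c * h y) = c * A.act U ψ h := by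
  have h1 : (fun y => ψ y * ∫ x, A.kernel x y * (c * h x)) = fun y =>
      c * (ψ y * ∫ x, A.kernel x y * h x) := by
    funext y
    simp only [mul_left_comm _ c, integral_const_mul]
  simp only [PsiDO.act, opMain, opKer, symFt_const_mul, mul_left_comm _ c, integral_const_mul]
  simp only [mul_left_comm _ c, integral_const_mul] at h1
  rw [evalC_const_mul U c (isTestC_kernel A.smooth_kernel hψ hh)]
  ring

/-- A pseudodifferential operator maps compactly supported distributions to distributions. -/
theorem PsiDO.exists_apply (A : PsiDO M m) {U : 𝓓'(M, ℂ)} {ψ : 𝓓(M, ℝ)}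
    (hψ : IsCutoff ψ (fun θ => U θ)) :
    ∃ V : 𝓓'(M, ℂ), (∀ φ, V φ = A.apply (fun θ => U θ) φ) ∧ ∀ h, IsTestC M h →
      evalC (fun θ => V θ) h = A.act U (fun y => (ψ y : ℂ)) h := by
  obtain ⟨V, h1, h2⟩ := exists_distribution (M := M) (A.act U (fun y => (ψ y : ℂ)))
    (fun h k hh hk => A.act_add U (isTestC_ofReal ψ) hh hk)
    (fun c h hh => A.act_const_mul U (isTestC_ofReal ψ) hh c) (fun ι K h hK hb => by
      obtain ⟨C, hC⟩ := exists_norm_opMain_le A.isSymbol U (isTestC_ofReal ψ) hb hK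
      obtain ⟨D, hD⟩ := exists_norm_opKer_le A.smooth_kernel hψ hb hK
      exact ⟨C + D, fun i => (norm_add_le _ _).trans (add_le_add (hC i) (hD i))⟩)
  exact ⟨V, fun φ => (h1 φ).trans (A.apply_eq hψ φ).symm, h2⟩

theorem opMain_mul_waveNeg (a : E4 → E4 → ℂ) (U : 𝓓'(M, ℂ)) (ψ h : E4 → ℂ) (η : E4) :
    opMain a U ψ (fun y => h y * waveNeg η y) = c0 * ∫ ζ, locFt U ψ ζ * symFt a h (η - ζ) ζ := by
  simp only [opMain, symFt_mul_waveNeg, sub_eq_add_neg]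

/-- An operator with smooth kernel yields rapidly decreasing Fourier transforms. -/
theorem norm_opKer_mul_waveNeg_le {κ : E4 → E4 → ℂ}
    (hκ : ContDiffOn ℝ ∞ (fun p : E4 × E4 => κ p.1 p.2) ((M : Set E4) ×ˢ (M : Set E4)))
    {U : 𝓓'(M, ℂ)} {ψ : 𝓓(M, ℝ)} (hψ : IsCutoff ψ (fun θ => U θ)) {h : E4 → ℂ}
    (hh : IsTestC M h) (N : ℕ) : ∃ C : ℝ, ∀ η,
      ‖opKer κ U (fun y => (ψ y : ℂ)) (fun y => h y * waveNeg η y)‖ * (1 + ‖η‖) ^ N ≤ C := by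
  obtain ⟨C, k, hC0, hC⟩ := norm_locFt_le U (isTestC_ofReal ψ)
  obtain ⟨D, hD0, hD⟩ := norm_kerFt_le hκ (hh.bddTest (ι := Unit)) hh.subset (isTestC_ofReal ψ)
    (N + (k + 0 + 5))
  refine ⟨‖c0‖ * (C * D * ∫ ζ : E4, ((1 + ‖ζ‖) ^ 5)⁻¹), fun η => ?_⟩
  have h0 : (0 : ℝ) < (1 + ‖η‖) ^ N := by positivity
  rw [opKer_eq hκ hψ (hh.mul_waveNeg η), norm_mul, mul_assoc]
  refine mul_le_mul_of_nonneg_left ?_ (norm_nonneg _)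
  rw [← le_div_iff₀ h0, mul_div_right_comm]
  refine norm_integral_le_weight fun τ => ?_
  rw [mul_div_assoc]
  refine locFt_weight (l := 0) (b := fun τ => kerFt κ (fun y => (ψ y : ℂ))
    (fun y => h y * waveNeg η y) 0 (-τ)) hC (fun ζ => ?_) τ
  have h1 := hD () η (-ζ)
  rw [norm_neg] at h1
  rw [kerFt_mul_waveNeg, add_zero, pow_zero, mul_one, le_div_iff₀ h0]
  refine le_trans ?_ h1
  rw [mul_assoc, mul_comm (_ ^ (k + 0 + 5))]
  refine mul_le_mul_of_nonneg_left (mul_le_mul ?_ ?_ (by positivity) (by positivity))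
    (norm_nonneg _)
  · exact pow_le_pow_right₀ (one_le_one_add_norm η) (by omega)
  · exact pow_le_pow_right₀ (one_le_one_add_norm ζ) (by omega)

end Action

/-! ### Integrals localized to cones -/

section Cones

/-- The function `F` decreases rapidly in the set `Γ`. -/
def RapidOn (Γ : Set E4) (F : E4 → ℂ) : Prop :=
  ∀ N : ℕ, ∃ C : ℝ, ∀ η ∈ Γ, ‖F η‖ * (1 + ‖η‖) ^ N ≤ C

namespace RapidOn

variable {Γ Γ' : Set E4} {F G : E4 → ℂ}

theorem mono (h : RapidOn Γ F) (hs : Γ' ⊆ Γ) : RapidOn Γ' F := fun N => by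
  obtain ⟨C, hC⟩ := h N
  exact ⟨C, fun η hη => hC η (hs hη)⟩

theorem congr (h : RapidOn Γ F) (hs : ∀ η ∈ Γ, G η = F η) : RapidOn Γ G := fun N => by
  obtain ⟨C, hC⟩ := h N
  exact ⟨C, fun η hη => by rw [hs η hη]; exact hC η hη⟩

theorem add (hF : RapidOn Γ F) (hG : RapidOn Γ G) : RapidOn Γ fun η => F η + G η := fun N => by
  obtain ⟨C, hC⟩ := hF N
  obtain ⟨D, hD⟩ := hG N
  refine ⟨C + D, fun η hη => le_trans ?_ (add_le_add (hC η hη) (hD η hη))⟩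
  rw [← add_mul]
  exact mul_le_mul_of_nonneg_right (norm_add_le _ _) (by positivity)

theorem const_mul (hF : RapidOn Γ F) (c : ℂ) : RapidOn Γ fun η => c * F η := fun N => by
  obtain ⟨C, hC⟩ := hF N
  refine ⟨‖c‖ * C, fun η hη => ?_⟩
  rw [norm_mul, mul_assoc]
  exact mul_le_mul_of_nonneg_left (hC η hη) (norm_nonneg _)

theorem sum {κ : Type*} (s : Finset κ) {F : κ → E4 → ℂ} (h : ∀ k ∈ s, RapidOn Γ (F k)) :
    RapidOn Γ fun η => ∑ k ∈ s, F k η := by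
  classical
  induction s using Finset.induction_on with
  | empty => exact fun N => ⟨0, fun η _ => by simp⟩
  | insert k s hk ih =>
    simp only [Finset.sum_insert hk]
    exact (h k (Finset.mem_insert_self k s)).add
      (ih fun j hj => h j (Finset.mem_insert_of_mem hj))

end RapidOn

theorem IsOpenCone.inter {Γ Γ' : Set E4} (h : IsOpenCone Γ) (h' : IsOpenCone Γ') :
    IsOpenCone (Γ ∩ Γ') :=
  ⟨h.1.inter h'.1, fun η hη t ht => ⟨h.2 η hη.1 t ht, h'.2 η hη.2 t ht⟩⟩

theorem IsOpenCone.iInter {κ : Type*} [Finite κ] {Γ : κ → Set E4} (h : ∀ k, IsOpenCone (Γ k)) :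
    IsOpenCone (⋂ k, Γ k) := by
  refine ⟨isOpen_iInter_of_finite fun k => (h k).1, fun η hη t ht => ?_⟩
  rw [Set.mem_iInter] at hη ⊢
  exact fun k => (h k).2 η (hη k) t ht

/-- A covector in an open cone `Γ` has a conic neighbourhood whose elements `η` have a distance at
least `r |η|` from the complement of `Γ`. -/
theorem IsOpenCone.exists_subcone {Γ : Set E4} (hΓ : IsOpenCone Γ) {ξ : E4} (hξ : ξ ∈ Γ) :
    ∃ Γ' : Set E4, IsOpenCone Γ' ∧ ξ ∈ Γ' ∧ ∃ r : ℝ, 0 < r ∧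
      ∀ η ∈ Γ', ∀ ζ ∉ Γ, r * ‖η‖ ≤ ‖η - ζ‖ := by
  obtain ⟨ε, hε, hb⟩ := Metric.isOpen_iff.1 hΓ.1 ξ hξ
  set δ := ε / 2 with hδ
  have hδ0 : 0 < δ := by positivity
  refine ⟨{η | ∃ t : ℝ, 0 < t ∧ ‖η - t • ξ‖ < δ * t}, ⟨?_, ?_⟩, ⟨1, one_pos, by simpa using hδ0⟩,
    δ / (‖ξ‖ + δ), by positivity, ?_⟩
  · have e : {η : E4 | ∃ t : ℝ, 0 < t ∧ ‖η - t • ξ‖ < δ * t} =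
        ⋃ (t : ℝ) (_ : 0 < t), {η | ‖η - t • ξ‖ < δ * t} := by
      ext η; simp
    rw [e]
    exact isOpen_iUnion fun t => isOpen_iUnion fun _ => isOpen_lt (by fun_prop) continuous_const
  · rintro η ⟨t, ht, hη⟩ s hs
    refine ⟨s * t, by positivity, ?_⟩
    rw [mul_smul, ← smul_sub, norm_smul, Real.norm_of_nonneg hs.le]
    calc s * ‖η - t • ξ‖ < s * (δ * t) := by gcongr
      _ = _ := by ring
  · rintro η ⟨t, ht, hη⟩ ζ hζ
    have h1 : ε * t ≤ ‖ζ - t • ξ‖ := by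
      by_contra! hlt
      refine hζ ?_
      have h2 : t⁻¹ • ζ ∈ Γ := by
        refine hb ?_
        rw [Metric.mem_ball, dist_eq_norm]
        have e : t⁻¹ • ζ - ξ = t⁻¹ • (ζ - t • ξ) := by
          rw [smul_sub, smul_smul, inv_mul_cancel₀ ht.ne', one_smul]
        rw [e, norm_smul, norm_inv, Real.norm_of_nonneg ht.le, inv_mul_lt_iff₀ ht]
        linarith
      have h3 := hΓ.2 _ h2 t ht
      rwa [smul_smul, mul_inv_cancel₀ ht.ne', one_smul] at h3
    have h2 : ‖ζ - t • ξ‖ ≤ ‖η - ζ‖ + ‖η - t • ξ‖ := by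
      have e : ζ - t • ξ = -(η - ζ) + (η - t • ξ) := by abel
      rw [← norm_neg (η - ζ), e]
      exact norm_add_le _ _
    have h3 : ‖η‖ ≤ ‖η - t • ξ‖ + t * ‖ξ‖ := by
      have := norm_add_le (η - t • ξ) (t • ξ)
      rwa [sub_add_cancel, norm_smul, Real.norm_of_nonneg ht.le] at this
    rw [div_mul_eq_mul_div, div_le_iff₀ (by positivity)]
    have h4 : δ * t ≤ ‖η - ζ‖ := by
      have : ε * t = 2 * (δ * t) := by rw [hδ]; ring
      linarith
    have h5 : ‖η‖ ≤ (‖ξ‖ + δ) * t := by linarith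
    calc δ * ‖η‖ ≤ δ * ((‖ξ‖ + δ) * t) := by gcongr
      _ = δ * t * (‖ξ‖ + δ) := by ring
      _ ≤ _ := by gcongr

theorem one_add_norm_le_mul (η ζ : E4) : 1 + ‖η‖ ≤ (1 + ‖η - ζ‖) * (1 + ‖ζ‖) := by
  have h1 : ‖η‖ ≤ ‖η - ζ‖ + ‖ζ‖ := by simpa using norm_add_le (η - ζ) ζ
  nlinarith [norm_nonneg (η - ζ), norm_nonneg ζ, mul_nonneg (norm_nonneg (η - ζ)) (norm_nonneg ζ)]

theorem norm_integral_le_weight_mul {f : E4 → ℂ} {C B : ℝ} (hB : 0 < B)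
    (h : ∀ ζ, ‖f ζ‖ * (B * (1 + ‖ζ‖) ^ 5) ≤ C) :
    ‖∫ ζ, f ζ‖ * B ≤ C * ∫ ζ : E4, ((1 + ‖ζ‖) ^ 5)⁻¹ := by
  rw [← le_div_iff₀ hB, mul_div_right_comm]
  refine norm_integral_le_weight fun ζ => ?_
  rw [le_div_iff₀ hB]
  refine le_trans (le_of_eq ?_) (h ζ)
  ring

/-- Let `Φ(η, ζ)` decrease rapidly away from the diagonal and, for `ζ` in the cone `Γ`, also in
`ζ`. Then `∫ Φ(η, ζ) dζ` decreases rapidly for `η` in a smaller cone. -/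
theorem rapidOn_integral {Γ Γ' : Set E4} {r R : ℝ} {k : ℕ} (hr : 0 < r)
    (hsep : ∀ η ∈ Γ', ∀ ζ ∉ Γ, r * ‖η‖ ≤ ‖η - ζ‖) {Φ : E4 → E4 → ℂ}
    (h1 : ∀ N : ℕ, ∃ C : ℝ, ∀ η ζ, ‖Φ η ζ‖ * (1 + ‖η - ζ‖) ^ N ≤ C * (1 + ‖ζ‖) ^ k)
    (h2 : ∀ N : ℕ, ∃ C : ℝ, ∀ η, ∀ ζ ∈ Γ, R ≤ ‖ζ‖ →
      ‖Φ η ζ‖ * ((1 + ‖η - ζ‖) ^ N * (1 + ‖ζ‖) ^ N) ≤ C) :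
    RapidOn Γ' fun η => ∫ ζ, Φ η ζ := by
  intro N
  suffices h : ∃ C : ℝ, ∀ η ∈ Γ', ∀ ζ, ‖Φ η ζ‖ * ((1 + ‖η‖) ^ N * (1 + ‖ζ‖) ^ 5) ≤ C by
    obtain ⟨C, hC⟩ := h
    exact ⟨_, fun η hη => norm_integral_le_weight_mul (by positivity) (hC η hη)⟩
  obtain ⟨C1, hC1⟩ := h2 (N + 5)
  obtain ⟨C2, hC2⟩ := h1 N
  obtain ⟨C3, hC3⟩ := h1 (N + 5 + k)
  have hC2' : 0 ≤ C2 := by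
    have := (hC2 0 0).trans' (by positivity)
    simpa using this
  have hC3' : 0 ≤ C3 := by
    have := (hC3 0 0).trans' (by positivity)
    simpa using this
  set s : ℝ := 1 + 1 / r with hs
  have hs0 : 0 < s := by positivity
  refine ⟨max C1 (max (C2 * (1 + max R 0) ^ (k + N + 5)) (s ^ N * (s + 1) ^ 5 * (C3 * (s + 1) ^ k))),
    fun η hη ζ => ?_⟩
  have h0 := one_add_norm_le_mul η ζ
  by_cases hζ : ζ ∈ Γ
  · rcases le_total R ‖ζ‖ with hR | hR
    · refine le_max_of_le_left (le_trans ?_ (hC1 η ζ hζ hR))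
      refine mul_le_mul_of_nonneg_left ?_ (norm_nonneg _)
      calc (1 + ‖η‖) ^ N * (1 + ‖ζ‖) ^ 5
          ≤ ((1 + ‖η - ζ‖) * (1 + ‖ζ‖)) ^ N * (1 + ‖ζ‖) ^ 5 := by gcongr
        _ = (1 + ‖η - ζ‖) ^ N * (1 + ‖ζ‖) ^ (N + 5) := by rw [mul_pow]; ring
        _ ≤ (1 + ‖η - ζ‖) ^ (N + 5) * (1 + ‖ζ‖) ^ (N + 5) := by
          gcongr
          · exact one_le_one_add_norm _
          · omega
    · refine le_max_of_le_right (le_max_of_le_left ?_)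
      calc ‖Φ η ζ‖ * ((1 + ‖η‖) ^ N * (1 + ‖ζ‖) ^ 5)
          ≤ ‖Φ η ζ‖ * (((1 + ‖η - ζ‖) * (1 + ‖ζ‖)) ^ N * (1 + ‖ζ‖) ^ 5) := by gcongr
        _ = ‖Φ η ζ‖ * (1 + ‖η - ζ‖) ^ N * (1 + ‖ζ‖) ^ (N + 5) := by rw [mul_pow]; ring
        _ ≤ C2 * (1 + ‖ζ‖) ^ k * (1 + ‖ζ‖) ^ (N + 5) :=
          mul_le_mul_of_nonneg_right (hC2 η ζ) (by positivity)
        _ = C2 * (1 + ‖ζ‖) ^ (k + N + 5) := by ring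
        _ ≤ _ := by
          gcongr
          exact hR.trans (le_max_left _ _)
  · refine le_max_of_le_right (le_max_of_le_right ?_)
    have hd := hsep η hη ζ hζ
    have hη' : ‖η‖ ≤ 1 / r * ‖η - ζ‖ := by
      rw [one_div, ← div_eq_inv_mul, le_div_iff₀ hr, mul_comm]
      exact hd
    have hη1 : 1 + ‖η‖ ≤ s * (1 + ‖η - ζ‖) := by
      have : 0 < 1 / r := by positivity
      rw [hs]
      linarith [norm_nonneg (η - ζ)]
    have hζ1 : 1 + ‖ζ‖ ≤ (s + 1) * (1 + ‖η - ζ‖) := by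
      have h3 : ‖ζ‖ ≤ ‖η‖ + ‖η - ζ‖ := by
        have := norm_sub_le η (η - ζ)
        rwa [sub_sub_cancel] at this
      linarith
    have hpos : (0 : ℝ) < (1 + ‖η - ζ‖) ^ k := by positivity
    have h5 : ‖Φ η ζ‖ * (1 + ‖η - ζ‖) ^ (N + 5) ≤ C3 * (s + 1) ^ k := by
      refine le_of_mul_le_mul_right ?_ hpos
      calc ‖Φ η ζ‖ * (1 + ‖η - ζ‖) ^ (N + 5) * (1 + ‖η - ζ‖) ^ k
          = ‖Φ η ζ‖ * (1 + ‖η - ζ‖) ^ (N + 5 + k) := by ring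
        _ ≤ C3 * (1 + ‖ζ‖) ^ k := hC3 η ζ
        _ ≤ C3 * ((s + 1) * (1 + ‖η - ζ‖)) ^ k := by gcongr
        _ = _ := by rw [mul_pow]; ring
    calc ‖Φ η ζ‖ * ((1 + ‖η‖) ^ N * (1 + ‖ζ‖) ^ 5)
        ≤ ‖Φ η ζ‖ * ((s * (1 + ‖η - ζ‖)) ^ N * ((s + 1) * (1 + ‖η - ζ‖)) ^ 5) := by gcongr
      _ = s ^ N * (s + 1) ^ 5 * (‖Φ η ζ‖ * (1 + ‖η - ζ‖) ^ (N + 5)) := by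
        rw [mul_pow, mul_pow]; ring
      _ ≤ _ := by gcongr

end Cones

/-! ### Microlocal smoothness -/

section MicroSmooth

variable {M : Opens E4} {x ξ : E4}

/-- The functional `G` on complex test functions is microlocally smooth at `(x, ξ)`: for all test
functions `φ` supported near `x`, the function `η ↦ G(φ e^{-i y·η})` decreases rapidly in a fixed
conic neighbourhood of `ξ`. -/
def MicroSmooth (M : Opens E4) (G : (E4 → ℂ) → ℂ) (x ξ : E4) : Prop :=
  ∃ V ∈ 𝓝 x, ∃ Γ : Set E4, IsOpenCone Γ ∧ ξ ∈ Γ ∧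
    ∀ φ : E4 → ℂ, IsTestC M φ → tsupport φ ⊆ V → RapidOn Γ fun η => G fun y => φ y * waveNeg η y

namespace MicroSmooth

variable {G G' : (E4 → ℂ) → ℂ}

theorem congr (h : MicroSmooth M G x ξ) (hG : ∀ φ, IsTestC M φ → G' φ = G φ) :
    MicroSmooth M G' x ξ := by
  obtain ⟨V, hV, Γ, hΓ, hξ, hr⟩ := h
  exact ⟨V, hV, Γ, hΓ, hξ, fun φ hφ hs =>
    (hr φ hφ hs).congr fun η _ => hG _ (hφ.mul_waveNeg η)⟩

theorem const_mul (h : MicroSmooth M G x ξ) (c : ℂ) : MicroSmooth M (fun φ => c * G φ) x ξ := by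
  obtain ⟨V, hV, Γ, hΓ, hξ, hr⟩ := h
  exact ⟨V, hV, Γ, hΓ, hξ, fun φ hφ hs => (hr φ hφ hs).const_mul c⟩

theorem add (h : MicroSmooth M G x ξ) (h' : MicroSmooth M G' x ξ) :
    MicroSmooth M (fun φ => G φ + G' φ) x ξ := by
  obtain ⟨V₁, hV₁, Γ₁, hΓ₁, hξ₁, hr₁⟩ := h
  obtain ⟨V₂, hV₂, Γ₂, hΓ₂, hξ₂, hr₂⟩ := h'
  exact ⟨V₁ ∩ V₂, Filter.inter_mem hV₁ hV₂, Γ₁ ∩ Γ₂, hΓ₁.inter hΓ₂, ⟨hξ₁, hξ₂⟩, fun φ hφ hs =>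
    ((hr₁ φ hφ (hs.trans Set.inter_subset_left)).mono Set.inter_subset_left).add
      ((hr₂ φ hφ (hs.trans Set.inter_subset_right)).mono Set.inter_subset_right)⟩

theorem sub (h : MicroSmooth M G x ξ) (h' : MicroSmooth M G' x ξ) :
    MicroSmooth M (fun φ => G φ - G' φ) x ξ :=
  (h.add (h'.const_mul (-1))).congr fun φ _ => by ring

theorem sum {κ : Type*} [Fintype κ] {G : κ → (E4 → ℂ) → ℂ} (h : ∀ k, MicroSmooth M (G k) x ξ) :
    MicroSmooth M (fun φ => ∑ k, G k φ) x ξ := by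
  choose V hV Γ hΓ hξ hr using h
  exact ⟨⋂ k, V k, Filter.iInter_mem.2 hV, ⋂ k, Γ k, IsOpenCone.iInter hΓ, Set.mem_iInter.2 hξ,
    fun φ hφ hs => RapidOn.sum _ fun k _ =>
      (hr k φ hφ (hs.trans (Set.iInter_subset V k))).mono (Set.iInter_subset Γ k)⟩

end MicroSmooth

/-- The Fourier transform of `φ h U` is the convolution of the Fourier transforms of `φ U` and
`h`. -/
theorem locFt_mul (U : 𝓓'(M, ℂ)) {φ h : E4 → ℂ} (hφ : IsTestC M φ) (hh : ContDiff ℝ ∞ h)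
    (hc : HasCompactSupport h) (η : E4) :
    locFt U (fun y => φ y * h y) η = c0 * ∫ ζ, locFt U φ ζ * ft h (η - ζ) := by
  have h1 := evalC_mul_eq_integral U hφ (contDiff_mul_waveNeg hh η) (hc.mul_right (f' := waveNeg η))
  simp only [ft_mul_waveNeg, ← sub_eq_add_neg] at h1
  simp only [← mul_assoc] at h1
  exact h1

/-- The test function in the definition of the wave front set may be replaced by any one with
support near `x`. -/
theorem microSmooth_of_locFt {U : 𝓓'(M, ℂ)} {φ : E4 → ℂ} {Γ : Set E4} (hφ : IsTestC M φ)
    (hx : φ x ≠ 0) (hΓ : IsOpenCone Γ) (hξ : ξ ∈ Γ) (hr : RapidOn Γ (locFt U φ)) :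
    MicroSmooth M (evalC fun θ => U θ) x ξ := by
  obtain ⟨Γ', hΓ', hξ', r, hr0, hsep⟩ := hΓ.exists_subcone hξ
  obtain ⟨C, k, hC0, hC⟩ := norm_locFt_le U hφ
  have hO : IsOpen {y | φ y ≠ 0} := isOpen_ne_fun hφ.smooth.continuous continuous_const
  refine ⟨{y | φ y ≠ 0}, hO.mem_nhds hx, Γ', hΓ', hξ', fun θ hθ hs => ?_⟩
  -- A test function supported where `φ` does not vanish is a smooth multiple of `φ`.
  have hq : IsTestC M fun y => θ y / φ y := by
    have hs' : tsupport (fun y => θ y / φ y) ⊆ tsupport θ :=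
      closure_mono fun y hy hy' => hy (by simp [hy'])
    refine ⟨contDiff_iff_contDiffAt.2 fun y => ?_, hθ.compact.mono' (subset_closure.trans hs'),
      hs'.trans hθ.subset⟩
    by_cases hy : φ y = 0
    · exact contDiffAt_const.congr_of_eventuallyEq
        (notMem_tsupport_iff_eventuallyEq.1 fun h => hs (hs' h) hy)
    · simp only [div_eq_mul_inv]
      exact hθ.smooth.contDiffAt.mul (hφ.smooth.contDiffAt.inv hy)
  have e : θ = fun y => φ y * (θ y / φ y) := by
    funext y
    by_cases hy : φ y = 0
    · have : θ y = 0 := by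
        by_contra h
        exact hs (subset_tsupport θ h) hy
      simp [this]
    · field_simp
  have e2 : locFt U θ = fun η => c0 * ∫ ζ, locFt U φ ζ * ft (fun y => θ y / φ y) (η - ζ) := by
    funext η
    rw [← locFt_mul U hφ hq.smooth hq.compact, ← e]
  change RapidOn Γ' (locFt U θ)
  rw [e2]
  refine (rapidOn_integral (k := k) (R := 0) hr0 hsep (fun N => ?_) fun N => ?_).const_mul c0
  · obtain ⟨D, hD0, hD⟩ := norm_ft_le hq.smooth hq.compact N
    refine ⟨C * D, fun η ζ => ?_⟩
    calc _ = ‖locFt U φ ζ‖ * (‖ft (fun y => θ y / φ y) (η - ζ)‖ * (1 + ‖η - ζ‖) ^ N) := by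
          rw [norm_mul]; ring
      _ ≤ (C * (1 + ‖ζ‖) ^ k) * D := mul_le_mul (hC ζ) (hD _) (by positivity) (by positivity)
      _ = _ := by ring
  · obtain ⟨D, hD0, hD⟩ := norm_ft_le hq.smooth hq.compact N
    obtain ⟨B, hB⟩ := hr N
    refine ⟨B * D, fun η ζ hζ _ => ?_⟩
    calc _ = ‖locFt U φ ζ‖ * (1 + ‖ζ‖) ^ N *
          (‖ft (fun y => θ y / φ y) (η - ζ)‖ * (1 + ‖η - ζ‖) ^ N) := by
          rw [norm_mul]; ring
      _ ≤ B * D := mul_le_mul (hB ζ hζ) (hD _) (by positivity)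
          ((hB ζ hζ).trans' (by positivity))

/-- For vectors of distributions, microlocal smoothness of all components is the complement of the
wave front set. -/
theorem not_inWF_iff {κ : Type*} [Fintype κ] {F : κ → 𝓓'(M, ℂ)} (hx : x ∈ M) (hξ : ξ ≠ 0) :
    ¬ InWF (toFunctional F) x ξ ↔
      ∀ k, MicroSmooth M (evalC fun θ => F k θ) x ξ := by
  have hpos : ∀ (η : E4) (N : ℕ), (0 : ℝ) < (1 + ‖η‖) ^ N := fun η N => by positivity
  constructor
  · intro h k
    simp only [InWF, hx, true_and, hξ, ne_eq, not_false_eq_true, not_not] at h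
    obtain ⟨φ, Γ, hφ, hΓ, hξΓ, hN⟩ := h
    refine microSmooth_of_locFt (isTestC_coe φ) hφ hΓ hξΓ fun N => ?_
    obtain ⟨C, hC⟩ := hN N
    refine ⟨C, fun η hη => ?_⟩
    rw [← le_div_iff₀ (hpos η N)]
    exact (norm_le_pi_norm (fun k => evalC (toFunctional F k) (fun y => φ y * waveNeg η y)) k).trans
      (hC η hη)
  · intro h hwf
    refine hwf.2.2 ?_
    choose V hV Γ hΓ hξΓ hr using h
    have hVx : interior (⋂ k, V k) ∩ M ∈ 𝓝 x :=
      Filter.inter_mem (interior_mem_nhds.2 (Filter.iInter_mem.2 hV)) (M.isOpen.mem_nhds hx)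
    obtain ⟨χ, h1, h2⟩ := exists_cutoff (M := M) (isCompact_singleton (x := x))
      (isOpen_interior.inter M.isOpen) (Set.singleton_subset_iff.2 (mem_of_mem_nhds hVx))
      Set.inter_subset_right
    rw [nhdsSet_singleton] at h1
    refine ⟨mkTest _ (isTestC_ofReal χ), ⋂ k, Γ k, ?_, IsOpenCone.iInter hΓ,
      Set.mem_iInter.2 hξΓ, fun N => ?_⟩
    · simp [h1.self_of_nhds]
    · have hs : ∀ k, tsupport (fun y => (χ y : ℂ)) ⊆ V k := fun k => by
        rw [tsupport_ofReal]
        exact (h2.trans Set.inter_subset_left).trans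
          (interior_subset.trans (Set.iInter_subset V k))
      choose C hC using fun k => hr k _ (isTestC_ofReal χ) (hs k) N
      refine ⟨∑ k, |C k|, fun η hη => ?_⟩
      refine (pi_norm_le_iff_of_nonneg (by positivity)).2 fun k => ?_
      rw [le_div_iff₀ (hpos η N)]
      exact ((hC k η (Set.mem_iInter.1 hη k)).trans (le_abs_self _)).trans
        (Finset.single_le_sum (f := fun k => |C k|) (fun _ _ => abs_nonneg _) (Finset.mem_univ k))

end MicroSmooth

/-! ### Pseudolocality -/

section Pseudolocality

variable {M : Opens E4} {ι : Type*} {m : ℝ} {K : Set (E4 × E4)} {a : ι → (E4 × E4) × E4 → ℂ}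

/-- The Fourier transform of an amplitude `a(x, y, ζ)` at `(η - ζ, ζ - τ)`. Its integral over `ζ` is
the Fourier transform in `(x, y)` of the kernel `∫ e^{i (x - y)·ζ} a(x, y, ζ) dζ`. -/
def oscFt (a : (E4 × E4) × E4 → ℂ) (η τ ζ : E4) : ℂ :=
  ampFourier a (pairCLM (η - ζ) (ζ - τ)) ζ

theorem pairCLM_line (η τ ζ v : E4) (s : ℝ) (p : E4 × E4) :
    pairCLM (η - (ζ + s • v)) (ζ + s • v - τ) p =
      pairCLM (η - ζ) (ζ - τ) p - s * inner ℝ (p.1 - p.2) v := by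
  simp only [pairCLM_apply, inner_sub_right, inner_add_right, inner_smul_right, inner_sub_left]
  ring

theorem integrable_ampFourier_integrand (h : Amp K m a) (i : ι) (θ : E4 × E4 →L[ℝ] ℝ) (ζ : E4) :
    Integrable fun p : E4 × E4 => Complex.exp (-(Complex.I * (θ p : ℝ))) * a i (p, ζ) := by
  refine Continuous.integrable_of_hasCompactSupport ?_ (h.slice_hasCompactSupport i ζ).mul_left
  exact Continuous.mul (by fun_prop) (h.slice_contDiff i ζ).continuous

/-- The product of an amplitude with `i (x - y)·v`. -/
def mulDiff (v : E4) (a : (E4 × E4) × E4 → ℂ) (q : (E4 × E4) × E4) : ℂ :=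
  Complex.I * (inner ℝ (q.1.1 - q.1.2) v : ℝ) * a q

theorem Amp.mulDiff (h : Amp K m a) (v : E4) : Amp K m (fun i => LightRay.mulDiff v (a i)) := by
  have h1 : ContDiff ℝ ∞ fun p : E4 × E4 => Complex.I * ((inner ℝ (p.1 - p.2) v : ℝ) : ℂ) :=
    contDiff_const.mul (Complex.ofRealCLM.contDiff.comp
      ((contDiff_fst.sub contDiff_snd).inner ℝ contDiff_const))
  have h2 := Amp.mul (symOn_of_contDiffOn (ι := ι) isOpen_univ (Set.subset_univ K) h.compact
    h1.contDiffOn) h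
  rw [zero_add] at h2
  exact h2

/-- The phase contributes the factor `i (x - y)·v` to the derivative in `ζ`, since it depends on `ζ`
through `(x - y)·ζ` only. -/
theorem hasLineDerivAt_oscFt (h : Amp K m a) (i : ι) (η τ ζ v : E4) :
    HasLineDerivAt ℝ (oscFt (a i) η τ)
      (oscFt (mulDiff v (a i)) η τ ζ + oscFt (dd ((0 : E4 × E4), v) (a i)) η τ ζ) ζ v := by
  let B : E4 × E4 → ℂ := fun p => Complex.I * (inner ℝ (p.1 - p.2) v : ℝ)
  let e : ℝ → E4 × E4 → ℂ := fun s p =>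
    Complex.exp (-(Complex.I * (pairCLM (η - (ζ + s • v)) (ζ + s • v - τ) p : ℝ)))
  let H : ℝ → E4 × E4 → ℂ := fun s p => e s p * a i (p, ζ + s • v)
  let H' : ℝ → E4 × E4 → ℂ := fun s p =>
    e s p * (B p * a i (p, ζ + s • v)) + e s p * dd ((0 : E4 × E4), v) (a i) (p, ζ + s • v)
  have ha := (h.smooth i).continuous
  have hda := (contDiff_dd (h.smooth i) ((0 : E4 × E4), v)).continuous
  have hB : Continuous B := by fun_prop
  have he : Continuous fun q : ℝ × (E4 × E4) => e q.1 q.2 := by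
    simp only [e, pairCLM_line]
    fun_prop
  have hH' : Continuous fun q : ℝ × (E4 × E4) => H' q.1 q.2 := by
    have h1 : Continuous fun q : ℝ × (E4 × E4) => a i (q.2, ζ + q.1 • v) :=
      ha.comp (f := fun q : ℝ × (E4 × E4) => (q.2, ζ + q.1 • v)) (by fun_prop)
    have h2 : Continuous fun q : ℝ × (E4 × E4) =>
        dd ((0 : E4 × E4), v) (a i) (q.2, ζ + q.1 • v) :=
      hda.comp (f := fun q : ℝ × (E4 × E4) => (q.2, ζ + q.1 • v)) (by fun_prop)
    exact (he.mul ((hB.comp continuous_snd).mul h1)).add (he.mul h2)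
  have hzero : ∀ s p, p ∉ K → H' s p = 0 := fun s p hp => by
    simp only [H', h.dd_zero ((0 : E4 × E4), v) i (p, ζ + s • v) hp,
      h.zero i (p, ζ + s • v) hp, mul_zero, add_zero]
  obtain ⟨C, hC⟩ := ((isCompact_Icc (a := (-1 : ℝ)) (b := 1)).prod h.compact).exists_bound_of_continuousOn
    hH'.continuousOn
  have hder := (hasDerivAt_integral_of_dominated_loc_of_deriv_le (μ := (volume : Measure (E4 × E4)))
    (F := H) (F' := H') (x₀ := (0 : ℝ)) (s := Set.Icc (-1) 1) (bound := K.indicator fun _ => C)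
    (Icc_mem_nhds (by norm_num) (by norm_num))
    (Filter.Eventually.of_forall fun s =>
      (integrable_ampFourier_integrand h i _ (ζ + s • v)).aestronglyMeasurable)
    (integrable_ampFourier_integrand h i _ (ζ + (0 : ℝ) • v))
    ((hH'.comp (f := fun p => ((0 : ℝ), p)) (by fun_prop)).aestronglyMeasurable)
    (Filter.Eventually.of_forall fun p s hs => ?_)
    ((integrable_indicator_iff h.compact.measurableSet).2
      (integrableOn_const h.compact.measure_lt_top.ne))
    (Filter.Eventually.of_forall fun p s _ => ?_)).2
  · have e0 : ∫ p, H' 0 p = oscFt (mulDiff v (a i)) η τ ζ +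
        oscFt (dd ((0 : E4 × E4), v) (a i)) η τ ζ := by
      simp only [H', e, zero_smul, add_zero]
      exact integral_add (integrable_ampFourier_integrand (h.mulDiff v) i _ ζ)
        (integrable_ampFourier_integrand (h.dz v) i _ ζ)
    rw [HasLineDerivAt, ← e0]
    exact hder
  · by_cases hp : p ∈ K
    · rw [Set.indicator_of_mem hp]
      exact hC (s, p) ⟨hs, hp⟩
    · rw [Set.indicator_of_notMem hp, hzero s p hp, norm_zero]
  · have h1 : HasDerivAt (fun s : ℝ => e s p) (e s p * B p) s := by
      simp only [e, pairCLM_line]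
      have h2 : HasDerivAt (fun s : ℝ => (pairCLM (η - ζ) (ζ - τ) p - s * inner ℝ (p.1 - p.2) v : ℝ))
          (-(1 * inner ℝ (p.1 - p.2) v)) s := ((hasDerivAt_id s).mul_const _).const_sub _
      have h3 := ((h2.ofReal_comp.const_mul Complex.I).neg).cexp
      refine h3.congr_deriv ?_
      simp only [Pi.neg_apply, one_mul, Complex.ofReal_neg, mul_neg, neg_neg, B]
    have h4 : HasDerivAt (fun s : ℝ => a i (p, ζ + s • v))
        (dd ((0 : E4 × E4), v) (a i) (p, ζ + s • v)) s := by
      have h5 : HasDerivAt (fun s : ℝ => (p, ζ + s • v)) ((0 : E4 × E4), v) s := by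
        refine (hasDerivAt_const s p).prodMk ?_
        simpa using ((hasDerivAt_id s).smul_const v).const_add ζ
      exact (((h.smooth i).differentiable (by simp)) _).hasFDerivAt.comp_hasDerivAt s h5
    refine (h1.mul h4).congr_deriv ?_
    simp only [H']
    ring

theorem norm_oscFt_le (h : Amp K m a) (N : ℕ) : ∃ C : ℝ, 0 ≤ C ∧ ∀ i η τ ζ,
    ‖oscFt (a i) η τ ζ‖ * ((1 + ‖η - ζ‖) ^ N * (1 + ‖ζ - τ‖) ^ N) ≤ C * (1 + ‖ζ‖) ^ m := by
  obtain ⟨C, hC0, hC⟩ := h.norm_ampFourier_le (2 * N)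
  exact ⟨C, hC0, fun i η τ ζ => (mul_le_mul_of_nonneg_left
    (norm_pow_mul_pow_le (η - ζ) (ζ - τ) N) (norm_nonneg _)).trans (hC i _ ζ)⟩

theorem continuous_oscFt (h : Amp K m a) (i : ι) :
    Continuous fun q : (E4 × E4) × E4 => oscFt (a i) q.1.1 q.1.2 q.2 :=
  (h.continuous_ampFourier i).comp
    (f := fun q : (E4 × E4) × E4 => (pairCLM (q.1.1 - q.2) (q.2 - q.1.2), q.2))
    ((continuous_pairCLM.comp (f := fun q : (E4 × E4) × E4 => (q.1.1 - q.2, q.2 - q.1.2))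
      (by fun_prop)).prodMk continuous_snd)

/-- For fixed `η`, the function `oscFt a η τ ζ` decreases rapidly in `ζ` and in `τ`. -/
theorem norm_oscFt_le_weight (h : Amp K m a) (i : ι) (η : E4) (N : ℕ) : ∃ C : ℝ, 0 ≤ C ∧ ∀ τ ζ,
    ‖oscFt (a i) η τ ζ‖ * ((1 + ‖τ‖) ^ N * (1 + ‖ζ‖) ^ N) ≤ C := by
  obtain ⟨C, hC0, hC⟩ := norm_oscFt_le h (2 * N + ⌈m⌉₊)
  refine ⟨C * (1 + ‖η‖) ^ (2 * N + ⌈m⌉₊), by positivity, fun τ ζ => ?_⟩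
  have h1 : 1 + ‖ζ‖ ≤ (1 + ‖η - ζ‖) * (1 + ‖η‖) := by
    rw [norm_sub_rev]; exact one_add_norm_le_mul ζ η
  have h2 : 1 + ‖τ‖ ≤ (1 + ‖ζ - τ‖) * (1 + ‖ζ‖) := by
    rw [norm_sub_rev]; exact one_add_norm_le_mul τ ζ
  have hpos : (0 : ℝ) < (1 + ‖ζ‖) ^ ⌈m⌉₊ := by positivity
  refine le_of_mul_le_mul_right ?_ hpos
  calc ‖oscFt (a i) η τ ζ‖ * ((1 + ‖τ‖) ^ N * (1 + ‖ζ‖) ^ N) * (1 + ‖ζ‖) ^ ⌈m⌉₊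
      ≤ ‖oscFt (a i) η τ ζ‖ * (((1 + ‖ζ - τ‖) * (1 + ‖ζ‖)) ^ N * (1 + ‖ζ‖) ^ N) *
          (1 + ‖ζ‖) ^ ⌈m⌉₊ := by gcongr
    _ = ‖oscFt (a i) η τ ζ‖ * ((1 + ‖ζ - τ‖) ^ N * (1 + ‖ζ‖) ^ (2 * N + ⌈m⌉₊)) := by
      rw [mul_pow]; ring
    _ ≤ ‖oscFt (a i) η τ ζ‖ * ((1 + ‖ζ - τ‖) ^ (2 * N + ⌈m⌉₊) *
          ((1 + ‖η - ζ‖) * (1 + ‖η‖)) ^ (2 * N + ⌈m⌉₊)) := by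
      gcongr
      · exact one_le_one_add_norm _
      · omega
    _ = ‖oscFt (a i) η τ ζ‖ * ((1 + ‖η - ζ‖) ^ (2 * N + ⌈m⌉₊) *
          (1 + ‖ζ - τ‖) ^ (2 * N + ⌈m⌉₊)) * (1 + ‖η‖) ^ (2 * N + ⌈m⌉₊) := by rw [mul_pow]; ring
    _ ≤ C * (1 + ‖ζ‖) ^ ⌈m⌉₊ * (1 + ‖η‖) ^ (2 * N + ⌈m⌉₊) :=
      mul_le_mul_of_nonneg_right ((hC i η τ ζ).trans
        (mul_le_mul_of_nonneg_left (rpow_le_pow_ceil m ζ) hC0)) (by positivity)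
    _ = _ := by ring

theorem integrable_oscFt (h : Amp K m a) (i : ι) (η τ : E4) :
    Integrable fun ζ => oscFt (a i) η τ ζ := by
  obtain ⟨C, hC0, hC⟩ := norm_oscFt_le_weight h i η 5
  refine integrable_of_weight (C := C) ((continuous_oscFt h i).comp
    (f := fun ζ => ((η, τ), ζ)) (by fun_prop)).aestronglyMeasurable fun ζ => ?_
  refine (mul_le_mul_of_nonneg_left ?_ (norm_nonneg _)).trans (hC τ ζ)
  exact le_mul_of_one_le_left (by positivity) (one_le_pow₀ (one_le_one_add_norm τ))

/-- Integration by parts: the factor `i (x - y)·v` may be traded for a derivative of the amplitude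
in the covector. -/
theorem integral_oscFt_mulDiff (h : Amp K m a) (i : ι) (η τ v : E4) :
    ∫ ζ, oscFt (mulDiff v (a i)) η τ ζ = -∫ ζ, oscFt (dd ((0 : E4 × E4), v) (a i)) η τ ζ := by
  have i1 := integrable_oscFt (h.mulDiff v) i η τ
  have i2 := integrable_oscFt (h.dz v) i η τ
  have h0 := integral_bilinear_hasLineDerivAt_right_eq_neg_left_of_integrable
    (μ := (volume : Measure E4)) (f := fun _ => (1 : ℂ)) (f' := fun _ => 0) (g := oscFt (a i) η τ)
    (g' := fun ζ => oscFt (mulDiff v (a i)) η τ ζ + oscFt (dd ((0 : E4 × E4), v) (a i)) η τ ζ)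
    (v := v) (B := ContinuousLinearMap.mul ℝ ℂ) (by simp) (by
      simp only [ContinuousLinearMap.mul_apply', one_mul]
      exact i1.add i2)
    (by simpa using integrable_oscFt h i η τ)
    (fun ζ _ => by rw [HasLineDerivAt]; exact hasDerivAt_const _ _)
    (fun ζ _ => hasLineDerivAt_oscFt h i η τ ζ v)
  simp only [ContinuousLinearMap.mul_apply', one_mul, zero_mul, integral_zero, neg_zero] at h0
  rw [integral_add i1 i2] at h0
  exact eq_neg_of_add_eq_zero_left h0

end Pseudolocality

section OffDiagonal

variable {M : Opens E4} {ι : Type*} {m : ℝ} {K : Set (E4 × E4)} {a : ι → (E4 × E4) × E4 → ℂ}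

/-- The functions `i (x_j - y_j) / |x - y|²`, smooth off the diagonal. -/
def offDiag (j : Fin 4) (p : E4 × E4) : ℂ :=
  Complex.I * ((inner ℝ (p.1 - p.2) (EuclideanSpace.single j 1) / ‖p.1 - p.2‖ ^ 2 : ℝ) : ℂ)

theorem Amp.offDiag (h : Amp K m a) (hK : ∀ p ∈ K, p.1 ≠ p.2) (j : Fin 4) :
    Amp K m (fun i q => LightRay.offDiag j q.1 * a i q) := by
  have hO : IsOpen {p : E4 × E4 | p.1 ≠ p.2} := isOpen_ne_fun continuous_fst continuous_snd
  have h1 : ContDiffOn ℝ ∞ (LightRay.offDiag j) {p : E4 × E4 | p.1 ≠ p.2} := by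
    have hd : ContDiff ℝ ∞ fun p : E4 × E4 => p.1 - p.2 := contDiff_fst.sub contDiff_snd
    refine contDiffOn_const.mul (Complex.ofRealCLM.contDiff.comp_contDiffOn
      (ContDiffOn.div (hd.inner ℝ contDiff_const).contDiffOn (hd.norm_sq ℝ).contDiffOn
        fun p hp => ?_))
    have : ‖p.1 - p.2‖ ≠ 0 := norm_ne_zero_iff.2 (sub_ne_zero.2 hp)
    positivity
  have h2 := (symOn_of_contDiffOn (ι := ι) hO hK h.compact h1).mul
    (h.sym.mono hO (Set.subset_univ _) subset_rfl hK)
  rw [zero_add] at h2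
  exact Amp.of_symOn h2 h.compact fun i p hp => by rw [h.zero i p hp, mul_zero]

theorem sum_mulDiff_offDiag (h : Amp K m a) (hK : ∀ p ∈ K, p.1 ≠ p.2) (i : ι)
    (q : (E4 × E4) × E4) :
    ∑ j, mulDiff (EuclideanSpace.single j 1) (fun q => offDiag j q.1 * a i q) q = -a i q := by
  by_cases hq : q.1 ∈ K
  · have hne : ‖q.1.1 - q.1.2‖ ^ 2 ≠ 0 := by
      have : ‖q.1.1 - q.1.2‖ ≠ 0 := norm_ne_zero_iff.2 (sub_ne_zero.2 (hK _ hq))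
      positivity
    have e : ∀ j : Fin 4, mulDiff (EuclideanSpace.single j 1) (fun q => offDiag j q.1 * a i q) q =
        -(((q.1.1 - q.1.2) j ^ 2 / ‖q.1.1 - q.1.2‖ ^ 2 : ℝ) : ℂ) * a i q := by
      intro j
      have hj : inner ℝ (q.1.1 - q.1.2) (EuclideanSpace.single j (1 : ℝ)) =
          (q.1.1 - q.1.2) j := by simp [EuclideanSpace.inner_single_right]
      simp only [mulDiff, offDiag, hj]
      push_cast
      linear_combination ((((q.1.1 - q.1.2) j : ℝ) : ℂ) ^ 2 / (‖q.1.1 - q.1.2‖ : ℂ) ^ 2 * a i q) *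
        Complex.I_mul_I
    simp only [e]
    rw [← Finset.sum_mul, Finset.sum_neg_distrib, ← Complex.ofReal_sum, ← Finset.sum_div,
      ← EuclideanSpace.real_norm_sq_eq, div_self hne]
    simp
  · simp [mulDiff, h.zero i q hq]

theorem oscFt_eq_neg_sum (h : Amp K m a) (hK : ∀ p ∈ K, p.1 ≠ p.2) (i : ι) (η τ ζ : E4) :
    oscFt (a i) η τ ζ = -∑ j,
      oscFt (mulDiff (EuclideanSpace.single j 1) fun q => offDiag j q.1 * a i q) η τ ζ := by
  simp only [oscFt, ampFourier]
  rw [← integral_finsetSum _ fun j _ =>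
    integrable_ampFourier_integrand ((h.offDiag hK j).mulDiff (EuclideanSpace.single j 1)) i _ ζ,
    ← integral_neg]
  refine integral_congr_ae (Filter.Eventually.of_forall fun p => ?_)
  simp only
  rw [← Finset.mul_sum, sum_mulDiff_offDiag h hK]
  ring

/-- Integration by parts lowers the order of an amplitude supported off the diagonal. -/
theorem integral_oscFt_eq (h : Amp K m a) (hK : ∀ p ∈ K, p.1 ≠ p.2) (i : ι) (η τ : E4) :
    ∫ ζ, oscFt (a i) η τ ζ = ∑ j : Fin 4, ∫ ζ, oscFt (dd ((0 : E4 × E4), EuclideanSpace.single j 1)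
      fun q => offDiag j q.1 * a i q) η τ ζ := by
  simp only [oscFt_eq_neg_sum h hK]
  rw [integral_neg, integral_finsetSum _ fun j _ =>
    integrable_oscFt ((h.offDiag hK j).mulDiff (EuclideanSpace.single j 1)) i η τ,
    ← Finset.sum_neg_distrib]
  refine Finset.sum_congr rfl fun j _ => ?_
  rw [integral_oscFt_mulDiff (h.offDiag hK j), neg_neg]

/-- The oscillatory integral of an amplitude of low order is rapidly decreasing. -/
theorem norm_integral_oscFt_le_of_le (h : Amp K m a) (N : ℕ) (hm : m ≤ -(2 * N + 5)) :
    ∃ C : ℝ, ∀ i η τ, ‖∫ ζ, oscFt (a i) η τ ζ‖ * ((1 + ‖η‖) ^ N * (1 + ‖τ‖) ^ N) ≤ C := by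
  obtain ⟨C, hC0, hC⟩ := norm_oscFt_le h N
  refine ⟨C * ∫ ζ : E4, ((1 + ‖ζ‖) ^ 5)⁻¹, fun i η τ =>
    norm_integral_le_weight_mul (by positivity) fun ζ => ?_⟩
  have h1 := one_add_norm_le_mul η ζ
  have h2 : 1 + ‖τ‖ ≤ (1 + ‖ζ - τ‖) * (1 + ‖ζ‖) := by
    rw [norm_sub_rev]; exact one_add_norm_le_mul τ ζ
  have h3 : (1 + ‖ζ‖) ^ m * (1 + ‖ζ‖) ^ (2 * N + 5) ≤ 1 := by
    rw [← Real.rpow_natCast, ← Real.rpow_add (by positivity)]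
    refine Real.rpow_le_one_of_one_le_of_nonpos (one_le_one_add_norm ζ) ?_
    push_cast
    linarith
  calc ‖oscFt (a i) η τ ζ‖ * ((1 + ‖η‖) ^ N * (1 + ‖τ‖) ^ N * (1 + ‖ζ‖) ^ 5)
      ≤ ‖oscFt (a i) η τ ζ‖ * (((1 + ‖η - ζ‖) * (1 + ‖ζ‖)) ^ N *
          ((1 + ‖ζ - τ‖) * (1 + ‖ζ‖)) ^ N * (1 + ‖ζ‖) ^ 5) := by gcongr
    _ = ‖oscFt (a i) η τ ζ‖ * ((1 + ‖η - ζ‖) ^ N * (1 + ‖ζ - τ‖) ^ N) *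
          (1 + ‖ζ‖) ^ (2 * N + 5) := by rw [mul_pow, mul_pow]; ring
    _ ≤ C * (1 + ‖ζ‖) ^ m * (1 + ‖ζ‖) ^ (2 * N + 5) :=
      mul_le_mul_of_nonneg_right (hC i η τ ζ) (by positivity)
    _ = C * ((1 + ‖ζ‖) ^ m * (1 + ‖ζ‖) ^ (2 * N + 5)) := by ring
    _ ≤ C := mul_le_of_le_one_right hC0 h3

/-- The Fourier transform of the kernel of an amplitude supported off the diagonal is rapidly
decreasing, whatever the order. The induction is on the number `n` of integrations by parts needed
to reach an order that is low enough. -/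
theorem norm_integral_oscFt_le (N n : ℕ) : ∀ {m : ℝ} {a : ι → (E4 × E4) × E4 → ℂ}, Amp K m a →
    (∀ p ∈ K, p.1 ≠ p.2) → m ≤ n - (2 * N + 5) →
      ∃ C : ℝ, ∀ i η τ, ‖∫ ζ, oscFt (a i) η τ ζ‖ * ((1 + ‖η‖) ^ N * (1 + ‖τ‖) ^ N) ≤ C := by
  induction n with
  | zero =>
    intro m a h _ hm
    refine norm_integral_oscFt_le_of_le h N ?_
    simpa using hm
  | succ n ih =>
    intro m a h hK hm
    choose C hC using fun j : Fin 4 => ih ((h.offDiag hK j).dz (EuclideanSpace.single j 1)) hK (by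
      push_cast at hm
      linarith)
    refine ⟨∑ j, C j, fun i η τ => ?_⟩
    rw [integral_oscFt_eq h hK]
    refine (mul_le_mul_of_nonneg_right (norm_sum_le _ _) (by positivity)).trans ?_
    rw [Finset.sum_mul]
    exact Finset.sum_le_sum fun j _ => hC j i η τ

/-- A pseudodifferential operator maps distributions supported in a closed set to functions that
are smooth off that set: the Fourier transform of `φ A (ψ₂ U)` decreases rapidly if the supports of
`φ` and `ψ₂` are disjoint. -/
theorem rapidOn_of_disjoint {a : E4 → E4 → ℂ} (ha : IsSymbol M m a) {U : 𝓓'(M, ℂ)} {ψ : 𝓓(M, ℝ)}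
    (hψ : IsCutoff ψ (fun θ => U θ)) {ψ₂ φ : E4 → ℂ} (hψ₂ : IsTestC M ψ₂) (hφ : IsTestC M φ)
    (hd : Disjoint (tsupport φ) (tsupport ψ₂)) :
    RapidOn Set.univ fun η => ∫ ζ, locFt U ψ₂ ζ * symFt a φ (η - ζ) ζ := by
  let α : Unit → (E4 × E4) × E4 → ℂ := fun _ q => a q.1.1 q.2 * φ q.1.1 * ψ₂ q.1.2
  have hc : IsCompact (tsupport φ ×ˢ tsupport ψ₂) := hφ.compact.prod hψ₂.compact
  have hα : Amp (tsupport φ ×ˢ tsupport ψ₂) m α := by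
    have h1 := ((ha.amp (hφ.bddTest (ι := Unit)) hφ.subset).sym.comp
      (ContinuousLinearMap.fst ℝ E4 E4)).mono isOpen_univ (by simp)
      (K' := tsupport φ ×ˢ tsupport ψ₂) (fun p hp => hp.1) (Set.subset_univ _)
    have h2 := symOn_of_contDiffOn (ι := Unit) isOpen_univ (Set.subset_univ _) hc
      (f := fun p : E4 × E4 => ψ₂ p.2) (hψ₂.smooth.comp contDiff_snd).contDiffOn
    have h3 := h1.mul h2
    rw [add_zero] at h3
    refine Amp.of_symOn h3 hc fun i p hp => ?_
    change a p.1.1 p.2 * φ p.1.1 * ψ₂ p.1.2 = 0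
    by_cases hp1 : p.1.1 ∈ tsupport φ
    · rw [image_eq_zero_of_notMem_tsupport (f := ψ₂) (fun hp2 => hp ⟨hp1, hp2⟩), mul_zero]
    · rw [image_eq_zero_of_notMem_tsupport hp1, mul_zero, zero_mul]
  have hne : ∀ p ∈ tsupport φ ×ˢ tsupport ψ₂, p.1 ≠ p.2 := fun p hp h =>
    Set.disjoint_left.1 hd hp.1 (h ▸ hp.2)
  have hosc : ∀ η τ ζ, ft ψ₂ (ζ - τ) * symFt a φ (η - ζ) ζ = oscFt (α ()) η τ ζ := by
    intro η τ ζ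
    rw [oscFt, ampFourier_pairCLM hα (), symFt_eq, ft, ft, ← integral_mul_const]
    refine integral_congr_ae (Filter.Eventually.of_forall fun y => ?_)
    simp only [α]
    rw [mul_assoc, ← integral_const_mul]
    congr 1
    refine integral_congr_ae (Filter.Eventually.of_forall fun x => ?_)
    simp only
    ring
  have hloc : ∀ ζ, locFt U ψ₂ ζ = c0 * ∫ τ, locFt U (fun y => (ψ y : ℂ)) τ * ft ψ₂ (ζ - τ) := by
    intro ζ
    rw [← locFt_mul U (isTestC_ofReal ψ) hψ₂.smooth hψ₂.compact, locFt, locFt,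
      ← evalC_cutoff_mul hψ (hψ₂.mul_waveNeg ζ)]
    simp only [mul_assoc]
  obtain ⟨C, k, hC0, hC⟩ := norm_locFt_le U (isTestC_ofReal ψ)
  have hswap : ∀ η, ∫ ζ, locFt U ψ₂ ζ * symFt a φ (η - ζ) ζ =
      c0 * ∫ τ, locFt U (fun y => (ψ y : ℂ)) τ * ∫ ζ, oscFt (α ()) η τ ζ := by
    intro η
    obtain ⟨D, hD0, hD⟩ := norm_oscFt_le_weight hα () η (k + 5)
    have hint : Integrable (fun q : E4 × E4 =>
        locFt U (fun y => (ψ y : ℂ)) q.2 * oscFt (α ()) η q.2 q.1) (volume.prod volume) := by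
      refine ((integrable_weight.mul_prod integrable_weight).const_mul (C * D)).mono' ?_
        (Filter.Eventually.of_forall fun q => ?_)
      · exact (((continuous_locFt U (isTestC_ofReal ψ)).comp continuous_snd).mul
          ((continuous_oscFt hα ()).comp (f := fun q : E4 × E4 => ((η, q.2), q.1))
            (by fun_prop))).aestronglyMeasurable
      · rw [← mul_inv, ← div_eq_mul_inv, le_div_iff₀ (by positivity), norm_mul]
        have h1 : (1 : ℝ) ≤ (1 + ‖q.1‖) ^ k := one_le_pow₀ (one_le_one_add_norm _)
        calc ‖locFt U (fun y => (ψ y : ℂ)) q.2‖ * ‖oscFt (α ()) η q.2 q.1‖ *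
              ((1 + ‖q.1‖) ^ 5 * (1 + ‖q.2‖) ^ 5)
            ≤ C * (1 + ‖q.2‖) ^ k * ‖oscFt (α ()) η q.2 q.1‖ *
              ((1 + ‖q.1‖) ^ 5 * (1 + ‖q.2‖) ^ 5) := by gcongr; exact hC _
          _ ≤ C * (1 + ‖q.2‖) ^ k * ‖oscFt (α ()) η q.2 q.1‖ *
              ((1 + ‖q.1‖) ^ 5 * (1 + ‖q.2‖) ^ 5) * (1 + ‖q.1‖) ^ k :=
            le_mul_of_one_le_right (by positivity) h1
          _ = C * (‖oscFt (α ()) η q.2 q.1‖ *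
              ((1 + ‖q.2‖) ^ (k + 5) * (1 + ‖q.1‖) ^ (k + 5))) := by ring
          _ ≤ C * D := mul_le_mul_of_nonneg_left (hD _ _) hC0
    simp only [← integral_const_mul]
    rw [← integral_integral_swap (f := fun ζ τ => c0 * (locFt U (fun y => (ψ y : ℂ)) τ *
      oscFt (α ()) η τ ζ)) (hint.const_mul c0)]
    refine integral_congr_ae (Filter.Eventually.of_forall fun ζ => ?_)
    simp only [hloc ζ, ← integral_const_mul, ← integral_mul_const, ← hosc]
    refine integral_congr_ae (Filter.Eventually.of_forall fun τ => ?_)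
    simp only
    ring
  simp only [hswap]
  refine RapidOn.const_mul (fun N => ?_) c0
  obtain ⟨n, hn⟩ := exists_nat_ge (m + (2 * (N + k + 5 : ℕ) + 5))
  obtain ⟨D, hD⟩ := norm_integral_oscFt_le (N + k + 5) n hα hne (by linarith)
  refine ⟨C * D * ∫ ζ : E4, ((1 + ‖ζ‖) ^ 5)⁻¹, fun η _ =>
    norm_integral_le_weight_mul (by positivity) fun τ => ?_⟩
  have h1 := one_le_one_add_norm η
  have h2 := one_le_one_add_norm τ
  rw [norm_mul]
  calc ‖locFt U (fun y => (ψ y : ℂ)) τ‖ * ‖∫ ζ, oscFt (α ()) η τ ζ‖ *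
        ((1 + ‖η‖) ^ N * (1 + ‖τ‖) ^ 5)
      ≤ C * (1 + ‖τ‖) ^ k * ‖∫ ζ, oscFt (α ()) η τ ζ‖ * ((1 + ‖η‖) ^ N * (1 + ‖τ‖) ^ 5) := by
        gcongr; exact hC _
    _ = C * (‖∫ ζ, oscFt (α ()) η τ ζ‖ * ((1 + ‖η‖) ^ N * (1 + ‖τ‖) ^ (k + 5))) := by ring
    _ ≤ C * (‖∫ ζ, oscFt (α ()) η τ ζ‖ *
        ((1 + ‖η‖) ^ (N + k + 5) * (1 + ‖τ‖) ^ (N + k + 5))) := by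
        gcongr <;> first | assumption | omega
    _ ≤ C * D := mul_le_mul_of_nonneg_left (hD () _ _) hC0

/-! ### Operators preserve microlocal smoothness -/

/-- If the distribution `U` is microlocally smooth at `(x, ξ)`, then so is `A U`. -/
theorem PsiDO.microSmooth_act (A : PsiDO M m) {U : 𝓓'(M, ℂ)} {ψ : 𝓓(M, ℝ)}
    (hψ : IsCutoff ψ (fun θ => U θ)) {x ξ : E4} (hx : x ∈ M)
    (hU : MicroSmooth M (evalC fun θ => U θ) x ξ) :
    MicroSmooth M (A.act U fun y => (ψ y : ℂ)) x ξ := by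
  obtain ⟨V, hV, Γ, hΓ, hξ, hr⟩ := hU
  obtain ⟨Γ', hΓ', hξ', r, hr0, hsep⟩ := hΓ.exists_subcone hξ
  have hVx : interior V ∩ M ∈ 𝓝 x :=
    Filter.inter_mem (interior_mem_nhds.2 hV) (M.isOpen.mem_nhds hx)
  obtain ⟨χ, h1, h2⟩ := exists_cutoff (M := M) (isCompact_singleton (x := x))
    (isOpen_interior.inter M.isOpen) (Set.singleton_subset_iff.2 (mem_of_mem_nhds hVx))
    Set.inter_subset_right
  rw [nhdsSet_singleton] at h1
  have hχ := isTestC_ofReal χ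
  have hψC := isTestC_ofReal ψ
  -- Split `ψ U` into a part supported near `x` and a part supported away from `x`.
  have hψ₁ : IsTestC M fun y => (χ y : ℂ) * ψ y := hψC.mul_left hχ.smooth
  have hψ₂ : IsTestC M fun y => (ψ y : ℂ) - χ y * ψ y := hψC.sub hψ₁
  have hsplit : ∀ ζ, locFt U (fun y => (ψ y : ℂ)) ζ = locFt U (fun y => (χ y : ℂ) * ψ y) ζ +
      locFt U (fun y => (ψ y : ℂ) - χ y * ψ y) ζ := by
    intro ζ
    rw [locFt, locFt, locFt, ← evalC_add U (hψ₁.mul_waveNeg ζ) (hψ₂.mul_waveNeg ζ)]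
    congr 1
    funext y
    ring
  refine ⟨{y | ∀ᶠ z in 𝓝 y, χ z = 1}, eventually_eventually_nhds.2 h1, Γ', hΓ', hξ',
    fun φ hφ hs => ?_⟩
  have hd : Disjoint (tsupport φ) (tsupport fun y => (ψ y : ℂ) - χ y * ψ y) := by
    refine Set.disjoint_left.2 fun y hy => notMem_tsupport_iff_eventuallyEq.2 ?_
    filter_upwards [hs hy] with z hz
    simp [hz]
  have e : (fun η => A.act U (fun y => (ψ y : ℂ)) fun y => φ y * waveNeg η y) = fun η =>
      (c0 * (∫ ζ, locFt U (fun y => (χ y : ℂ) * ψ y) ζ * symFt A.symbol φ (η - ζ) ζ) +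
        c0 * ∫ ζ, locFt U (fun y => (ψ y : ℂ) - χ y * ψ y) ζ * symFt A.symbol φ (η - ζ) ζ) +
      opKer A.kernel U (fun y => (ψ y : ℂ)) fun y => φ y * waveNeg η y := by
    funext η
    rw [PsiDO.act, opMain_mul_waveNeg, ← mul_add,
      ← integral_add (integrable_opMain A.isSymbol U hψ₁ hφ η)
        (integrable_opMain A.isSymbol U hψ₂ hφ η)]
    simp only [hsplit, add_mul]
  rw [e]
  refine RapidOn.add (RapidOn.add (RapidOn.const_mul ?_ c0) (RapidOn.const_mul
    ((rapidOn_of_disjoint A.isSymbol hψ hψ₂ hφ hd).mono (Set.subset_univ _)) c0)) fun N => ?_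
  · obtain ⟨C, k, hC0, hC⟩ := norm_locFt_le U hψ₁
    have hs₁ : tsupport (fun y => (χ y : ℂ) * ψ y) ⊆ V := by
      refine tsupport_mul_subset_left.trans ?_
      rw [tsupport_ofReal]
      exact (h2.trans Set.inter_subset_left).trans interior_subset
    refine rapidOn_integral (k := k + ⌈m⌉₊) (R := 0) hr0 hsep (fun N => ?_) fun N => ?_
    · obtain ⟨D, hD0, hD⟩ := norm_symFt_le A.isSymbol (hφ.bddTest (ι := Unit)) hφ.subset N
      refine ⟨C * D, fun η ζ => ?_⟩
      calc _ = ‖locFt U (fun y => (χ y : ℂ) * ψ y) ζ‖ *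
            (‖symFt A.symbol φ (η - ζ) ζ‖ * (1 + ‖η - ζ‖) ^ N) := by rw [norm_mul]; ring
        _ ≤ (C * (1 + ‖ζ‖) ^ k) * (D * (1 + ‖ζ‖) ^ ⌈m⌉₊) :=
          mul_le_mul (hC ζ) (hD () _ _) (by positivity) (by positivity)
        _ = _ := by ring
    · obtain ⟨D, hD0, hD⟩ := norm_symFt_le A.isSymbol (hφ.bddTest (ι := Unit)) hφ.subset N
      obtain ⟨B, hB⟩ := hr _ hψ₁ hs₁ (⌈m⌉₊ + N)
      refine ⟨B * D, fun η ζ hζ _ => ?_⟩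
      have hpos : (0 : ℝ) < (1 + ‖ζ‖) ^ ⌈m⌉₊ := by positivity
      refine le_of_mul_le_mul_right ?_ hpos
      calc _ = ‖locFt U (fun y => (χ y : ℂ) * ψ y) ζ‖ * (1 + ‖ζ‖) ^ (⌈m⌉₊ + N) *
            (‖symFt A.symbol φ (η - ζ) ζ‖ * (1 + ‖η - ζ‖) ^ N) := by rw [norm_mul]; ring
        _ ≤ B * (D * (1 + ‖ζ‖) ^ ⌈m⌉₊) := mul_le_mul (hB ζ hζ) (hD () _ _) (by positivity)
            ((hB ζ hζ).trans' (by positivity))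
        _ = _ := by ring
  · obtain ⟨C, hC⟩ := norm_opKer_mul_waveNeg_le A.smooth_kernel hψ hφ N
    exact ⟨C, fun η _ => hC η⟩

end OffDiagonal

/-! ### Linear operations on distributions -/

section Linear

variable {M : Opens E4}

theorem evalReal_add_left (u v : 𝓓(M, ℝ) → ℂ) (h : E4 → ℝ) :
    evalReal (fun θ => u θ + v θ) h = evalReal u h + evalReal v h := by
  unfold evalReal
  split_ifs <;> simp

theorem evalReal_const_mul_left (c : ℂ) (u : 𝓓(M, ℝ) → ℂ) (h : E4 → ℝ) :
    evalReal (fun θ => c * u θ) h = c * evalReal u h := by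
  unfold evalReal
  split_ifs <;> simp

theorem evalC_add_left (u v : 𝓓(M, ℝ) → ℂ) (h : E4 → ℂ) :
    evalC (fun θ => u θ + v θ) h = evalC u h + evalC v h := by
  simp only [evalC, evalReal_add_left]
  ring

theorem evalC_const_mul_left (c : ℂ) (u : 𝓓(M, ℝ) → ℂ) (h : E4 → ℂ) :
    evalC (fun θ => c * u θ) h = c * evalC u h := by
  simp only [evalC, evalReal_const_mul_left]
  ring

theorem evalC_sum_left {κ : Type*} (s : Finset κ) (u : κ → 𝓓(M, ℝ) → ℂ) (h : E4 → ℂ) :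
    evalC (fun θ => ∑ k ∈ s, u k θ) h = ∑ k ∈ s, evalC (u k) h := by
  classical
  induction s using Finset.induction_on with
  | empty => simp [evalC, evalReal]
  | insert k s hk ih => simp only [Finset.sum_insert hk, evalC_add_left, ih]

/-- The distributional derivative is the transpose of minus the derivative. -/
theorem evalC_lineDeriv (U : 𝓓'(M, ℂ)) (v : E4) {h : E4 → ℂ} (hh : IsTestC M h) :
    evalC (fun θ => (∂_{v} U : 𝓓'(M, ℂ)) θ) h = -evalC (fun θ => U θ) (dd v h) := by
  have key : ∀ L : ℂ →L[ℝ] ℝ, evalReal (fun θ => (∂_{v} U : 𝓓'(M, ℂ)) θ) (fun y => L (h y)) =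
      -evalReal (fun θ => U θ) (fun y => L (dd v h y)) := by
    intro L
    have ht := hh.comp_clm L
    have ht' := (hh.dd v).comp_clm L
    rw [evalReal, dif_pos ht, evalReal, dif_pos ht', Distribution.lineDerivOp_apply_apply, map_neg]
    congr 2
    ext y
    have hd : DifferentiableAt ℝ h y := hh.smooth.differentiable (by simp) y
    change fderiv ℝ (fun y => L (h y)) y v = L (fderiv ℝ h y v)
    have e : HasFDerivAt (fun y => L (h y)) (L.comp (fderiv ℝ h y)) y :=
      L.hasFDerivAt.comp y hd.hasFDerivAt
    rw [e.fderiv]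
    rfl
  have h1 := key Complex.reCLM
  have h2 := key Complex.imCLM
  simp only [Complex.reCLM_apply, Complex.imCLM_apply] at h1 h2
  rw [evalC, evalC, h1, h2]
  ring

theorem evalC_gauge (c : 𝓓'(M, ℂ)) (w : Fin 4 → 𝓓'(M, ℂ)) (p : Ix2) {h : E4 → ℂ}
    (hh : IsTestC M h) : evalC (fun θ => gauge c w p θ) h =
      mink p.1 p.2 * evalC (fun θ => c θ) h -
        (evalC (fun θ => w p.2 θ) (dd (EuclideanSpace.single p.1 1) h) +
          evalC (fun θ => w p.1 θ) (dd (EuclideanSpace.single p.2 1) h)) / 2 := by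
  have e : (fun θ => gauge c w p θ) = fun θ => (mink p.1 p.2 : ℂ) * c θ + (1 / 2 : ℂ) *
      ((∂_{(EuclideanSpace.single p.1 (1 : ℝ) : E4)} (w p.2) : 𝓓'(M, ℂ)) θ +
        (∂_{(EuclideanSpace.single p.2 (1 : ℝ) : E4)} (w p.1) : 𝓓'(M, ℂ)) θ) := by
    funext θ
    change mink p.1 p.2 • c θ + (1 / 2 : ℝ) •
      ((∂_{(EuclideanSpace.single p.1 (1 : ℝ) : E4)} (w p.2) : 𝓓'(M, ℂ)) θ +
        (∂_{(EuclideanSpace.single p.2 (1 : ℝ) : E4)} (w p.1) : 𝓓'(M, ℂ)) θ) = _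
    rw [Complex.real_smul, Complex.real_smul]
    push_cast
    rfl
  rw [e, evalC_add_left, evalC_const_mul_left, evalC_const_mul_left, evalC_add_left,
    evalC_lineDeriv _ _ hh, evalC_lineDeriv _ _ hh]
  ring

/-! ### Cutoffs -/

theorem IsCutoff.of_forall {ψ : 𝓓(M, ℝ)} {u v w : 𝓓(M, ℝ) → ℂ} (hu : IsCutoff ψ u)
    (hv : IsCutoff ψ v) (h : ∀ θ, u θ = 0 → v θ = 0 → w θ = 0) : IsCutoff ψ w := by
  obtain ⟨K, hK, hKM, h0, h1⟩ := hu
  obtain ⟨L, hL, hLM, k0, k1⟩ := hv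
  refine ⟨K ∪ L, hK.union hL, Set.union_subset hKM hLM, fun θ hθ => h θ
    (h0 θ (hθ.trans (Set.compl_subset_compl.2 Set.subset_union_left)))
    (k0 θ (hθ.trans (Set.compl_subset_compl.2 Set.subset_union_right))), ?_⟩
  rw [nhdsSet_union]
  exact Filter.eventually_sup.2 ⟨h1, k1⟩

theorem IsCutoff.compactlySupported {ψ : 𝓓(M, ℝ)} {u : 𝓓(M, ℝ) → ℂ} (hu : IsCutoff ψ u) :
    CompactlySupported u := by
  obtain ⟨K, hK, hKM, h0, -⟩ := hu
  exact ⟨K, hK, hKM, h0⟩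

theorem IsCutoff.lineDeriv {ψ : 𝓓(M, ℝ)} {U : 𝓓'(M, ℂ)} (hU : IsCutoff ψ fun θ => U θ) (v : E4) :
    IsCutoff ψ fun θ => (∂_{v} U : 𝓓'(M, ℂ)) θ := by
  obtain ⟨K, hK, hKM, h0, h1⟩ := hU
  exact ⟨K, hK, hKM, IsVanishingOn.lineDerivOp h0 v, h1⟩

theorem IsCutoff.gauge {ψ : 𝓓(M, ℝ)} {c : 𝓓'(M, ℂ)} {w : Fin 4 → 𝓓'(M, ℂ)}
    (hc : IsCutoff ψ fun θ => c θ) (hw : ∀ i, IsCutoff ψ fun θ => w i θ) (p : Ix2) :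
    IsCutoff ψ fun θ => LightRay.gauge c w p θ := by
  refine hc.of_forall (((hw p.2).lineDeriv (EuclideanSpace.single p.1 1)).of_forall
    ((hw p.1).lineDeriv (EuclideanSpace.single p.2 1))
    (w := fun θ => symDiff w p θ) fun θ h1 h2 => ?_) fun θ h1 h2 => ?_
  · change (1 / 2 : ℝ) •
      ((∂_{(EuclideanSpace.single p.1 (1 : ℝ) : E4)} (w p.2) : 𝓓'(M, ℂ)) θ +
        (∂_{(EuclideanSpace.single p.2 (1 : ℝ) : E4)} (w p.1) : 𝓓'(M, ℂ)) θ) = 0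
    rw [h1, h2, add_zero, smul_zero]
  · change mink p.1 p.2 • c θ + symDiff w p θ = 0
    rw [h1, h2, smul_zero, add_zero]

/-- Finitely many compactly supported functionals have a common cutoff. -/
theorem exists_common_cutoff {κ : Type*} [Finite κ] {u : κ → 𝓓(M, ℝ) → ℂ}
    (hu : ∀ k, CompactlySupported (u k)) : ∃ ψ : 𝓓(M, ℝ), ∀ k, IsCutoff ψ (u k) := by
  choose K hK hKM h0 using hu
  obtain ⟨ψ, h1, -⟩ := exists_cutoff (M := M) (isCompact_iUnion hK) M.isOpen
    (Set.iUnion_subset hKM) subset_rfl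
  exact ⟨ψ, fun k => ⟨K k, hK k, hKM k, h0 k, h1.filter_mono
    (nhdsSet_mono (Set.subset_iUnion K k))⟩⟩

theorem locFt_lineDeriv {ψ : 𝓓(M, ℝ)} {U : 𝓓'(M, ℂ)} (hU : IsCutoff ψ fun θ => U θ) (v ζ : E4) :
    locFt (∂_{v} U) (fun y => (ψ y : ℂ)) ζ =
      Complex.I * (inner ℝ v ζ : ℝ) * locFt U (fun y => (ψ y : ℂ)) ζ := by
  have hψ := isTestC_ofReal ψ
  have h0 : evalC (fun θ => U θ) (fun y => dd v (fun y => (ψ y : ℂ)) y * waveNeg ζ y) = 0 := by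
    obtain ⟨K, -, -, hv, h1⟩ := hU
    refine evalC_eq_zero hv ((hψ.dd v).mul_waveNeg ζ) fun y hy hyK => ?_
    refine notMem_tsupport_iff_eventuallyEq.2 ?_ hy
    have h2 : (fun y => (ψ y : ℂ)) =ᶠ[𝓝 y] fun _ => 1 := by
      filter_upwards [(eventually_nhdsSet_iff_forall.1 h1) y hyK] with z hz
      simp [hz]
    filter_upwards [h2.fderiv (𝕜 := ℝ)] with z hz
    simp [dd, hz]
  rw [locFt, evalC_lineDeriv U v (hψ.mul_waveNeg ζ), dd_mul_waveNeg hψ.smooth]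
  have h1 := evalC_add U ((hψ.dd v).mul_waveNeg ζ)
    ((hψ.mul_waveNeg ζ).mul_left (k := fun _ => -(Complex.I * (inner ℝ v ζ : ℝ))) contDiff_const)
  rw [h0, evalC_const_mul U _ (hψ.mul_waveNeg ζ), zero_add] at h1
  rw [show ((fun y => dd v (fun y => (ψ y : ℂ)) y * waveNeg ζ y) + fun y =>
    -(Complex.I * (inner ℝ v ζ : ℝ)) * ((ψ y : ℂ) * waveNeg ζ y)) = fun y =>
      dd v (fun y => (ψ y : ℂ)) y * waveNeg ζ y +
        -(Complex.I * (inner ℝ v ζ : ℝ)) * ((ψ y : ℂ) * waveNeg ζ y) from rfl, h1, locFt]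
  ring

/-- The symbol of the gauge operator `(c, w) ↦ c g + d^s w`. -/
def gaugeSymbol (ζ : E4) (c : ℂ) (w : Fin 4 → ℂ) (p : Ix2) : ℂ :=
  mink p.1 p.2 * c + Complex.I / 2 * (ζ p.1 * w p.2 + ζ p.2 * w p.1)

theorem locFt_gauge {ψ : 𝓓(M, ℝ)} {c : 𝓓'(M, ℂ)} {w : Fin 4 → 𝓓'(M, ℂ)}
    (hw : ∀ i, IsCutoff ψ fun θ => w i θ) (p : Ix2) (ζ : E4) :
    locFt (gauge c w p) (fun y => (ψ y : ℂ)) ζ =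
      gaugeSymbol ζ (locFt c (fun y => (ψ y : ℂ)) ζ)
        (fun i => locFt (w i) (fun y => (ψ y : ℂ)) ζ) p := by
  have hψ := (isTestC_ofReal ψ).mul_waveNeg ζ
  have h1 := locFt_lineDeriv (hw p.2) (EuclideanSpace.single p.1 1) ζ
  have h2 := locFt_lineDeriv (hw p.1) (EuclideanSpace.single p.2 1) ζ
  simp only [EuclideanSpace.inner_single_left, map_one, one_mul] at h1 h2
  rw [locFt, evalC_lineDeriv _ _ hψ, neg_eq_iff_eq_neg] at h1 h2
  rw [locFt, evalC_gauge c w p hψ, h1, h2, gaugeSymbol]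
  simp only [locFt]
  ring

/-! ### Matrices of operators -/

variable {m : ℝ}

theorem PsiDO.act_linear (A : PsiDO M m) {U U₁ U₂ : 𝓓'(M, ℂ)} (c : ℂ)
    (hU : ∀ h, IsTestC M h → evalC (fun θ => U θ) h =
      evalC (fun θ => U₁ θ) h + c * evalC (fun θ => U₂ θ) h) {ψ h : E4 → ℂ} (hψ : IsTestC M ψ)
    (hh : IsTestC M h) : A.act U ψ h = A.act U₁ ψ h + c * A.act U₂ ψ h := by
  have h1 : ∀ ζ, locFt U ψ ζ = locFt U₁ ψ ζ + c * locFt U₂ ψ ζ := fun ζ => hU _ (hψ.mul_waveNeg ζ)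
  have i1 := integrable_opMain A.isSymbol U₁ hψ hh 0
  have i2 := (integrable_opMain A.isSymbol U₂ hψ hh 0).const_mul c
  simp only [zero_sub] at i1 i2
  simp only [PsiDO.act, opMain, opKer, h1, hU _ (isTestC_kernel A.smooth_kernel hψ hh), add_mul,
    mul_assoc]
  rw [integral_add i1 i2, integral_const_mul]
  ring

theorem exists_applyMatrix {κ ι : Type*} [Fintype ι] (A : κ → ι → PsiDO M m) {u : ι → 𝓓'(M, ℂ)}
    {ψ : 𝓓(M, ℝ)} (hψ : ∀ i, IsCutoff ψ fun θ => u i θ) :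
    ∃ V : κ → 𝓓'(M, ℂ), applyMatrix A (toFunctional u) = toFunctional V ∧
      ∀ k h, IsTestC M h → evalC (fun θ => V k θ) h =
        ∑ i, (A k i).act (u i) (fun y => (ψ y : ℂ)) h := by
  choose V h1 h2 using fun k i => (A k i).exists_apply (hψ i)
  have hsum : ∀ k (θ : 𝓓(M, ℝ)), (∑ i, V k i) θ = ∑ i, V k i θ := fun k θ =>
    _root_.sum_apply Finset.univ (fun i => (V k i : 𝓓(M, ℝ) →L[ℝ] ℂ)) θ
  refine ⟨fun k => ∑ i, V k i, ?_, fun k h hh => ?_⟩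
  · funext k θ
    simp only [applyMatrix, toFunctional, hsum]
    exact Finset.sum_congr rfl fun i _ => (h1 k i θ).symm
  · simp only [hsum]
    rw [evalC_sum_left]
    exact Finset.sum_congr rfl fun i _ => h2 k i h hh

theorem microSmooth_matrix {κ ι : Type*} [Fintype ι] (A : κ → ι → PsiDO M m) {u : ι → 𝓓'(M, ℂ)}
    {ψ : 𝓓(M, ℝ)} (hψ : ∀ i, IsCutoff ψ fun θ => u i θ) {x ξ : E4} (hx : x ∈ M)
    (hu : ∀ i, MicroSmooth M (evalC fun θ => u i θ) x ξ) (k : κ) :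
    MicroSmooth M (fun h => ∑ i, (A k i).act (u i) (fun y => (ψ y : ℂ)) h) x ξ :=
  MicroSmooth.sum fun i => (A k i).microSmooth_act (hψ i) hx (hu i)

end Linear

/-! ### Algebra of the projection -/

section Algebra

theorem sum_etaUp_mul_etaLow {ζ : E4} (hζ : Spacelike ζ) : ∑ i, etaUp ζ i * etaLow ζ i = 1 := by
  have h0 : minkSq ζ = -(ζ 0 * ζ 0) + ζ 1 * ζ 1 + ζ 2 * ζ 2 + ζ 3 * ζ 3 := by
    simp [minkSq, mink, Fin.sum_univ_four]
  have hs : Real.sqrt (minkSq ζ) ≠ 0 := (Real.sqrt_pos.2 hζ).ne'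
  have hs2 : Real.sqrt (minkSq ζ) * Real.sqrt (minkSq ζ) = minkSq ζ := Real.mul_self_sqrt hζ.le
  simp only [etaUp, etaLow, mink, Fin.sum_univ_four]
  simp
  field_simp
  rw [sq (Real.sqrt _), hs2, h0]
  ring

theorem etaUp_zero (ζ : E4) : etaUp ζ 0 = -etaLow ζ 0 := by
  simp [etaUp, mink]

theorem etaUp_one (ζ : E4) : etaUp ζ 1 = etaLow ζ 1 := by
  simp [etaUp, mink]

theorem etaUp_two (ζ : E4) : etaUp ζ 2 = etaLow ζ 2 := by
  simp [etaUp, mink]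

theorem etaUp_three (ζ : E4) : etaUp ζ 3 = etaLow ζ 3 := by
  simp [etaUp, mink]

theorem etaLow_rel {ζ : E4} (hζ : Spacelike ζ) :
    -etaLow ζ 0 ^ 2 + etaLow ζ 1 ^ 2 + etaLow ζ 2 ^ 2 + etaLow ζ 3 ^ 2 = 1 := by
  have h := sum_etaUp_mul_etaLow hζ
  simp only [Fin.sum_univ_four, etaUp_zero, etaUp_one, etaUp_two, etaUp_three] at h
  linarith

theorem sum_kappa_mul_etaLow {ζ : E4} (hζ : Spacelike ζ) (k : Fin 4) :
    ∑ i, kappa ζ i k * etaLow ζ i = 0 := by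
  have h := sum_etaUp_mul_etaLow hζ
  have e : ∀ i, kappa ζ i k * etaLow ζ i =
      (if i = k then etaLow ζ i else 0) - etaLow ζ k * (etaUp ζ i * etaLow ζ i) := by
    intro i
    rw [kappa]
    split_ifs <;> ring
  simp only [e]
  rw [Finset.sum_sub_distrib, ← Finset.mul_sum, h]
  simp

theorem hUp_comm (ζ : E4) (i j : Fin 4) : hUp ζ i j = hUp ζ j i := by
  by_cases h : i = j
  · rw [h]
  · simp only [hUp, mink, if_neg h, if_neg (Ne.symm h)]
    ring

theorem sum_hUp_mul_etaLow {ζ : E4} (hζ : Spacelike ζ) (i : Fin 4) :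
    ∑ j, hUp ζ i j * etaLow ζ j = 0 := by
  simp only [hUp, sub_mul, mul_assoc]
  rw [Finset.sum_sub_distrib, ← Finset.mul_sum, sum_etaUp_mul_etaLow hζ, mul_one, etaUp, sub_self]

theorem mink_comm (i j : Fin 4) : mink i j = mink j i := by
  by_cases h : i = j
  · rw [h]
  · rw [mink, mink, if_neg h, if_neg (Ne.symm h)]

theorem sum_etaUp_mul_mink (ζ : E4) (l : Fin 4) : ∑ i, etaUp ζ i * mink i l = etaLow ζ l := by
  simp only [Fin.sum_univ_four, etaUp_zero, etaUp_one, etaUp_two, etaUp_three]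
  fin_cases l <;> simp [mink]

theorem sum_kappa_mul_mink (ζ : E4) (k l : Fin 4) :
    ∑ i, kappa ζ i k * mink i l = muLow ζ k l := by
  have e : ∀ i, kappa ζ i k * mink i l =
      (if i = k then mink i l else 0) - etaLow ζ k * (etaUp ζ i * mink i l) := by
    intro i
    rw [kappa]
    split_ifs <;> ring
  simp only [e]
  rw [Finset.sum_sub_distrib, ← Finset.mul_sum, sum_etaUp_mul_mink]
  simp [muLow]

theorem sum_lam_mul_mink {ζ : E4} (hζ : Spacelike ζ) (k l : Fin 4) :
    ∑ ij : Ix2, lam ζ ij.1 ij.2 k l * mink ij.1 ij.2 = muLow ζ k l := by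
  have e : ∀ i, ∑ j, lam ζ i j k l * mink i j =
      kappa ζ i k * mink i l - etaLow ζ l * (kappa ζ i k * etaLow ζ i) := by
    intro i
    simp only [lam, mul_assoc, ← Finset.mul_sum, mink_comm i, sum_kappa_mul_mink]
    rw [muLow]
    ring
  rw [Fintype.sum_prod_type]
  simp only [e]
  rw [Finset.sum_sub_distrib, ← Finset.mul_sum, sum_kappa_mul_etaLow hζ, sum_kappa_mul_mink]
  ring

theorem sum_hUp_mul_mink {ζ : E4} (hζ : Spacelike ζ) :
    ∑ ij : Ix2, hUp ζ ij.1 ij.2 * mink ij.1 ij.2 = 3 := by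
  have h := etaLow_rel hζ
  rw [Fintype.sum_prod_type]
  simp only [hUp, Fin.sum_univ_four, etaUp_zero, etaUp_one, etaUp_two, etaUp_three]
  simp [mink]
  linear_combination -h

theorem coe_eq_sqrt_mul_etaLow {ζ : E4} (hζ : Spacelike ζ) (k : Fin 4) :
    ζ k = Real.sqrt (minkSq ζ) * etaLow ζ k := by
  have hs : Real.sqrt (minkSq ζ) ≠ 0 := (Real.sqrt_pos.2 hζ).ne'
  rw [etaLow, mul_div_cancel₀ _ hs]

/-- The projection annihilates the range of the gauge symbol. -/
theorem sum_projSymbol_mul_gaugeSymbol {ζ : E4} (hζ : Spacelike ζ) (c : ℂ) (w : Fin 4 → ℂ)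
    (kl : Ix2) : ∑ ij, (projSymbol ζ kl ij : ℂ) * gaugeSymbol ζ c w ij = 0 := by
  have h1 := sum_lam_mul_mink hζ kl.1 kl.2
  have h2 := sum_hUp_mul_mink hζ
  have hz : ∀ k, ((ζ k : ℝ) : ℂ) = (Real.sqrt (minkSq ζ) : ℂ) * (etaLow ζ k : ℂ) := fun k => by
    rw [← Complex.ofReal_mul, ← coe_eq_sqrt_mul_etaLow hζ]
  have hk : ∀ k, ∑ i, (kappa ζ i k : ℂ) * (etaLow ζ i : ℂ) = 0 := fun k => by
    have := sum_kappa_mul_etaLow hζ k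
    exact_mod_cast this
  have hh : ∀ i, ∑ j, (hUp ζ i j : ℂ) * (etaLow ζ j : ℂ) = 0 := fun i => by
    have := sum_hUp_mul_etaLow hζ i
    exact_mod_cast this
  have h3 : ∑ ij : Ix2, (projSymbol ζ kl ij : ℂ) * (mink ij.1 ij.2 : ℂ) = 0 := by
    have e : ∑ ij : Ix2, projSymbol ζ kl ij * mink ij.1 ij.2 = 0 := by
      have e' : ∀ ij : Ix2, projSymbol ζ kl ij * mink ij.1 ij.2 =
          lam ζ ij.1 ij.2 kl.1 kl.2 * mink ij.1 ij.2 -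
            muLow ζ kl.1 kl.2 / 3 * (hUp ζ ij.1 ij.2 * mink ij.1 ij.2) := fun ij => by
        rw [projSymbol]; ring
      simp only [e']
      rw [Finset.sum_sub_distrib, h1, ← Finset.mul_sum, h2]
      ring
    exact_mod_cast e
  have h4 : ∑ ij : Ix2, (projSymbol ζ kl ij : ℂ) * ((etaLow ζ ij.1 : ℂ) * w ij.2) = 0 := by
    rw [Fintype.sum_prod_type_right]
    refine Finset.sum_eq_zero fun j _ => ?_
    have e : ∀ i, (projSymbol ζ kl (i, j) : ℂ) * ((etaLow ζ i : ℂ) * w j) =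
        (kappa ζ j kl.2 * w j) * ((kappa ζ i kl.1 : ℂ) * (etaLow ζ i : ℂ)) -
          (muLow ζ kl.1 kl.2 / 3 * w j) * ((hUp ζ j i : ℂ) * (etaLow ζ i : ℂ)) := by
      intro i
      rw [projSymbol, lam, hUp_comm ζ i j]
      push_cast
      ring
    simp only [e]
    rw [Finset.sum_sub_distrib, ← Finset.mul_sum, ← Finset.mul_sum, hk, hh]
    ring
  have h5 : ∑ ij : Ix2, (projSymbol ζ kl ij : ℂ) * ((etaLow ζ ij.2 : ℂ) * w ij.1) = 0 := by
    rw [Fintype.sum_prod_type]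
    refine Finset.sum_eq_zero fun i _ => ?_
    have e : ∀ j, (projSymbol ζ kl (i, j) : ℂ) * ((etaLow ζ j : ℂ) * w i) =
        (kappa ζ i kl.1 * w i) * ((kappa ζ j kl.2 : ℂ) * (etaLow ζ j : ℂ)) -
          (muLow ζ kl.1 kl.2 / 3 * w i) * ((hUp ζ i j : ℂ) * (etaLow ζ j : ℂ)) := by
      intro j
      rw [projSymbol, lam]
      push_cast
      ring
    simp only [e]
    rw [Finset.sum_sub_distrib, ← Finset.mul_sum, ← Finset.mul_sum, hk, hh]
    ring
  have e : ∀ ij : Ix2, (projSymbol ζ kl ij : ℂ) * gaugeSymbol ζ c w ij =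
      c * ((projSymbol ζ kl ij : ℂ) * (mink ij.1 ij.2 : ℂ)) +
        Complex.I / 2 * Real.sqrt (minkSq ζ) *
          ((projSymbol ζ kl ij : ℂ) * ((etaLow ζ ij.1 : ℂ) * w ij.2) +
            (projSymbol ζ kl ij : ℂ) * ((etaLow ζ ij.2 : ℂ) * w ij.1)) := by
    intro ij
    rw [gaugeSymbol, hz, hz]
    ring
  simp only [e]
  rw [Finset.sum_add_distrib, ← Finset.mul_sum, ← Finset.mul_sum, Finset.sum_add_distrib, h3, h4,
    h5]
  ring

/-- The coefficients of the scalar `c` in the decomposition `f = P f + (c g + d^s w)` on the symbol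
level: `c = h^{ij} f_{ij} / 3`. -/
def scalarCoef (ζ : E4) (ij : Ix2) : ℝ := hUp ζ ij.1 ij.2 / 3

/-- The coefficients of the covector `w` in the decomposition `f = P f + (c g + d^s w)` on the
symbol level, up to the factor `2 / i`: with `a_l = η^i f_{il}` and `s = η^i η^j f_{ij}`, the
covector is `(a_l - η_l (s + c) / 2) / √g(ζ, ζ)`. -/
def covectorCoef (ζ : E4) (l : Fin 4) (ij : Ix2) : ℝ :=
  ((if ij.2 = l then etaUp ζ ij.1 else 0) -
    etaLow ζ l * (etaUp ζ ij.1 * etaUp ζ ij.2 + hUp ζ ij.1 ij.2 / 3) / 2) *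
      (Real.sqrt (minkSq ζ))⁻¹

/-- On the symbol level, a symmetric tensor is the sum of its projection and a gauge field. -/
theorem projSymbol_add_gaugeSymbol {ζ : E4} (hζ : Spacelike ζ) {f : Ix2 → ℂ}
    (hf : ∀ i j, f (i, j) = f (j, i)) (kl : Ix2) :
    ∑ ij, (projSymbol ζ kl ij : ℂ) * f ij + gaugeSymbol ζ (∑ ij, (scalarCoef ζ ij : ℂ) * f ij)
      (fun l => ∑ ij, (2 / Complex.I * (covectorCoef ζ l ij : ℂ)) * f ij) kl = f kl := by
  obtain ⟨k, l⟩ := kl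
  have hs : (Real.sqrt (minkSq ζ) : ℂ) ≠ 0 := by
    exact_mod_cast (Real.sqrt_pos.2 hζ).ne'
  have hz : ∀ k, ((ζ k : ℝ) : ℂ) = (Real.sqrt (minkSq ζ) : ℂ) * (etaLow ζ k : ℂ) := fun k => by
    rw [← Complex.ofReal_mul, ← coe_eq_sqrt_mul_etaLow hζ]
  have hw : ∀ k l, Complex.I / 2 * (((ζ k : ℝ) : ℂ) *
      ∑ ij, (2 / Complex.I * (covectorCoef ζ l ij : ℂ)) * f ij) = (etaLow ζ k : ℂ) *
        ∑ ij : Ix2, (((if ij.2 = l then etaUp ζ ij.1 else 0 : ℝ) : ℂ) - etaLow ζ l *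
          (etaUp ζ ij.1 * etaUp ζ ij.2 + hUp ζ ij.1 ij.2 / 3) / 2) * f ij := by
    intro k l
    rw [hz, Finset.mul_sum, Finset.mul_sum, Finset.mul_sum]
    refine Finset.sum_congr rfl fun ij _ => ?_
    rw [covectorCoef]
    push_cast
    field_simp [Complex.I_ne_zero]
  set S : Fin 4 → ℂ := fun l => ∑ i, (etaUp ζ i : ℂ) * f (i, l) with hS
  set s : ℂ := ∑ ij : Ix2, (etaUp ζ ij.1 : ℂ) * etaUp ζ ij.2 * f ij with hs'
  set t : ℂ := ∑ ij : Ix2, (hUp ζ ij.1 ij.2 : ℂ) * f ij with ht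
  have hS1 : ∀ l, ∑ ij : Ix2, (if ij.2 = l then (etaUp ζ ij.1 : ℂ) * f ij else 0) = S l := by
    intro l
    rw [Fintype.sum_prod_type]
    simp [hS]
  have hS2 : ∀ k, ∑ ij : Ix2, (if ij.1 = k then (etaUp ζ ij.2 : ℂ) * f ij else 0) = S k := by
    intro k
    rw [Fintype.sum_prod_type_right]
    simp [hS, hf k]
  have hδ : ∑ ij : Ix2, (if ij = (k, l) then f ij else 0) = f (k, l) := by simp
  have hcov : ∀ l, ∑ ij : Ix2, (((if ij.2 = l then etaUp ζ ij.1 else 0 : ℝ) : ℂ) - etaLow ζ l *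
      (etaUp ζ ij.1 * etaUp ζ ij.2 + hUp ζ ij.1 ij.2 / 3) / 2) * f ij =
        S l - etaLow ζ l / 2 * s - etaLow ζ l / 6 * t := by
    intro l
    rw [← hS1, hs', ht, Finset.mul_sum, Finset.mul_sum, ← Finset.sum_sub_distrib,
      ← Finset.sum_sub_distrib]
    refine Finset.sum_congr rfl fun ij _ => ?_
    split_ifs <;> push_cast <;> ring
  have hproj : ∑ ij, (projSymbol ζ (k, l) ij : ℂ) * f ij =
      f (k, l) - etaLow ζ l * S k - etaLow ζ k * S l + etaLow ζ k * etaLow ζ l * s -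
        muLow ζ k l / 3 * t := by
    rw [← hδ, ← hS1 l, ← hS2 k, hs', ht, Finset.mul_sum, Finset.mul_sum, Finset.mul_sum,
      Finset.mul_sum, ← Finset.sum_sub_distrib, ← Finset.sum_sub_distrib, ← Finset.sum_add_distrib,
      ← Finset.sum_sub_distrib]
    refine Finset.sum_congr rfl fun ij _ => ?_
    obtain ⟨i, j⟩ := ij
    simp only [projSymbol, lam, kappa, Prod.mk.injEq]
    by_cases hi : i = k <;> by_cases hj : j = l <;> simp [hi, hj] <;> ring
  have hsc : ∑ ij, (scalarCoef ζ ij : ℂ) * f ij = t / 3 := by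
    rw [ht, Finset.sum_div]
    refine Finset.sum_congr rfl fun ij _ => ?_
    rw [scalarCoef]
    push_cast
    ring
  rw [gaugeSymbol, mul_add, hw, hw, hcov, hcov, hproj, hsc, muLow]
  push_cast
  ring

end Algebra

/-! ### Polynomially bounded multipliers -/

section Multipliers

variable {M : Opens E4} {m : ℝ}

/-- The function `F` is bounded by a polynomial on the set `S`. -/
def PolyBddOn (S : Set E4) (F : E4 → ℂ) : Prop :=
  ∃ (C : ℝ) (k : ℕ), 0 ≤ C ∧ ∀ ζ ∈ S, ‖F ζ‖ ≤ C * (1 + ‖ζ‖) ^ k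

namespace PolyBddOn

variable {S : Set E4} {F G : E4 → ℂ}

theorem const (c : ℂ) : PolyBddOn S fun _ => c := ⟨‖c‖, 0, norm_nonneg c, fun ζ _ => by simp⟩

theorem mul (hF : PolyBddOn S F) (hG : PolyBddOn S G) : PolyBddOn S fun ζ => F ζ * G ζ := by
  obtain ⟨C, k, hC0, hC⟩ := hF
  obtain ⟨D, l, hD0, hD⟩ := hG
  refine ⟨C * D, k + l, by positivity, fun ζ hζ => ?_⟩
  rw [norm_mul]
  calc ‖F ζ‖ * ‖G ζ‖ ≤ (C * (1 + ‖ζ‖) ^ k) * (D * (1 + ‖ζ‖) ^ l) :=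
        mul_le_mul (hC ζ hζ) (hD ζ hζ) (norm_nonneg _) (by positivity)
    _ = _ := by ring

theorem add (hF : PolyBddOn S F) (hG : PolyBddOn S G) : PolyBddOn S fun ζ => F ζ + G ζ := by
  obtain ⟨C, k, hC0, hC⟩ := hF
  obtain ⟨D, l, hD0, hD⟩ := hG
  refine ⟨C + D, k + l, by positivity, fun ζ hζ => ?_⟩
  have h1 := one_le_one_add_norm ζ
  calc ‖F ζ + G ζ‖ ≤ C * (1 + ‖ζ‖) ^ k + D * (1 + ‖ζ‖) ^ l :=
        (norm_add_le _ _).trans (add_le_add (hC ζ hζ) (hD ζ hζ))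
    _ ≤ C * (1 + ‖ζ‖) ^ (k + l) + D * (1 + ‖ζ‖) ^ (k + l) := by
        gcongr <;> first | assumption | omega
    _ = _ := by ring

theorem sub (hF : PolyBddOn S F) (hG : PolyBddOn S G) : PolyBddOn S fun ζ => F ζ - G ζ := by
  have h := hF.add ((const (-1)).mul hG)
  simpa only [neg_mul, one_mul, ← sub_eq_add_neg] using h

theorem sum {κ : Type*} (s : Finset κ) {F : κ → E4 → ℂ} (h : ∀ k, PolyBddOn S (F k)) :
    PolyBddOn S fun ζ => ∑ k ∈ s, F k ζ := by
  classical
  induction s using Finset.induction_on with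
  | empty => simpa using const 0
  | insert k s hk ih =>
    simp only [Finset.sum_insert hk]
    exact (h k).add ih

theorem mono {S' : Set E4} (h : PolyBddOn S F) (hS : S' ⊆ S) : PolyBddOn S' F := by
  obtain ⟨C, k, hC0, hC⟩ := h
  exact ⟨C, k, hC0, fun ζ hζ => hC ζ (hS hζ)⟩

theorem indicator (h : PolyBddOn S F) : PolyBddOn Set.univ (S.indicator F) := by
  obtain ⟨C, k, hC0, hC⟩ := h
  refine ⟨C, k, hC0, fun ζ _ => ?_⟩
  by_cases hζ : ζ ∈ S
  · rw [Set.indicator_of_mem hζ]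
    exact hC ζ hζ
  · rw [Set.indicator_of_notMem hζ, norm_zero]
    positivity

theorem coord (k : Fin 4) : PolyBddOn S fun ζ => (ζ k : ℂ) :=
  ⟨1, 1, zero_le_one, fun ζ _ => by
    rw [one_mul, pow_one, Complex.norm_real]
    have := PiLp.norm_apply_le ζ k
    linarith⟩

end PolyBddOn

theorem polyBddOn_locFt (U : 𝓓'(M, ℂ)) {ψ : E4 → ℂ} (hψ : IsTestC M ψ) :
    PolyBddOn Set.univ (locFt U ψ) := by
  obtain ⟨C, k, hC0, hC⟩ := norm_locFt_le U hψ
  exact ⟨C, k, hC0, fun ζ _ => hC ζ⟩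

theorem isSymbol_one : IsSymbol M 0 fun _ _ => 1 := by
  refine ⟨contDiffOn_const, fun K _ _ j l => ⟨1, fun x _ ξ => ?_⟩⟩
  rcases Nat.eq_zero_or_pos j with rfl | hj
  · rcases Nat.eq_zero_or_pos l with rfl | hl
    · simp
    · rw [iteratedFDeriv_const_of_ne hl.ne']
      simp
  · rw [iteratedFDeriv_const_of_ne hj.ne']
    simp only [Pi.zero_apply, norm_zero]
    positivity

theorem symFt_one (φ : E4 → ℂ) (θ ζ : E4) : symFt (fun _ _ => 1) φ θ ζ = ft φ θ := by
  simp only [symFt_eq, one_mul]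

/-- If the symbols `a_j` and the multipliers `u_j` satisfy `∑ u_j a_j = 0` near `(x, ξ)`, then
`∑ a_j(x, D) u_j` is microlocally negligible there. -/
theorem rapidOn_integral_sum {J : Type*} [Fintype J] {a : J → E4 → E4 → ℂ}
    (ha : ∀ j, IsSymbol M m (a j)) {u : J → E4 → ℂ} (hu : ∀ j, PolyBddOn Set.univ (u j))
    {Γ Γ' O : Set E4} {r R : ℝ} (hr : 0 < r) (hsep : ∀ η ∈ Γ', ∀ ζ ∉ Γ, r * ‖η‖ ≤ ‖η - ζ‖)
    (hvan : ∀ y ∈ O, ∀ ζ ∈ Γ, R ≤ ‖ζ‖ → ∑ j, u j ζ * a j y ζ = 0) {φ : E4 → ℂ}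
    (hφ : IsTestC M φ) (hO : tsupport φ ⊆ O) :
    RapidOn Γ' fun η => ∫ ζ, ∑ j, u j ζ * symFt (a j) φ (η - ζ) ζ := by
  choose C k hC0 hC using hu
  refine rapidOn_integral (k := ∑ j, k j + ⌈m⌉₊) (R := R) hr hsep (fun N => ?_) fun N => ?_
  · choose D hD0 hD using fun j =>
      norm_symFt_le (ha j) (hφ.bddTest (ι := Unit)) hφ.subset N
    refine ⟨∑ j, C j * D j, fun η ζ => ?_⟩
    have h1 := one_le_one_add_norm ζ
    refine (mul_le_mul_of_nonneg_right (norm_sum_le _ _) (by positivity)).trans ?_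
    rw [Finset.sum_mul, Finset.sum_mul]
    refine Finset.sum_le_sum fun j _ => ?_
    calc _ = ‖u j ζ‖ * (‖symFt (a j) φ (η - ζ) ζ‖ * (1 + ‖η - ζ‖) ^ N) := by rw [norm_mul]; ring
      _ ≤ (C j * (1 + ‖ζ‖) ^ k j) * (D j * (1 + ‖ζ‖) ^ ⌈m⌉₊) :=
        mul_le_mul (hC j ζ trivial) (hD j () _ _) (by positivity)
          (mul_nonneg (hC0 j) (by positivity))
      _ = C j * D j * (1 + ‖ζ‖) ^ (k j + ⌈m⌉₊) := by ring
      _ ≤ _ := by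
        refine mul_le_mul_of_nonneg_left (pow_le_pow_right₀ h1 ?_) (mul_nonneg (hC0 j) (hD0 j))
        have := Finset.single_le_sum (f := k) (fun _ _ => Nat.zero_le _) (Finset.mem_univ j)
        omega
  · refine ⟨0, fun η ζ hζ hR => ?_⟩
    have e : ∑ j, u j ζ * symFt (a j) φ (η - ζ) ζ = 0 := by
      simp only [symFt_eq, ft, ← integral_const_mul]
      rw [← integral_finsetSum _ fun j _ =>
        (integrable_symFt_integrand (ha j) hφ (η - ζ) ζ).const_mul (u j ζ)]
      refine integral_eq_zero_of_ae (Filter.Eventually.of_forall fun y => ?_)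
      simp only [Pi.zero_apply]
      by_cases hy : y ∈ tsupport φ
      · have h1 : ∑ j, u j ζ * (waveNeg (η - ζ) y * (a j y ζ * φ y)) =
            waveNeg (η - ζ) y * φ y * ∑ j, u j ζ * a j y ζ := by
          rw [Finset.mul_sum]
          exact Finset.sum_congr rfl fun j _ => by ring
        rw [h1, hvan y (hO hy) ζ hζ hR, mul_zero]
      · simp [image_eq_zero_of_notMem_tsupport hy]
    rw [e, norm_zero, zero_mul]

/-- The distribution with the Fourier multiplier `F`, cut off by `χ`. -/
theorem exists_multiplier {F : E4 → ℂ} (hF : Measurable F) (hb : PolyBddOn Set.univ F)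
    (χ : 𝓓(M, ℝ)) : ∃ U : 𝓓'(M, ℂ), CompactlySupported (fun θ => U θ) ∧ ∀ h, IsTestC M h →
      evalC (fun θ => U θ) h = c0 * ∫ ζ, F ζ * ft (fun y => (χ y : ℂ) * h y) (-ζ) := by
  obtain ⟨C, k, hC0, hC⟩ := hb
  have hχ := isTestC_ofReal χ
  have hint : ∀ h, IsTestC M h → Integrable fun ζ => F ζ * ft (fun y => (χ y : ℂ) * h y) (-ζ) :=
    fun h hh => integrable_mul_ft hF.aestronglyMeasurable (fun ζ => hC ζ trivial)
      (hh.mul_left hχ.smooth).smooth (hh.mul_left hχ.smooth).compact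
  have hftint : ∀ h, IsTestC M h → ∀ ζ, Integrable fun y => waveNeg ζ y * ((χ y : ℂ) * h y) :=
    fun h hh ζ => ((contDiff_waveNeg_right ζ).continuous.mul
      (hh.mul_left hχ.smooth).smooth.continuous).integrable_of_hasCompactSupport
        (hh.mul_left hχ.smooth).compact.mul_left
  obtain ⟨U, h1, h2⟩ := exists_distribution (M := M)
    (fun h => c0 * ∫ ζ, F ζ * ft (fun y => (χ y : ℂ) * h y) (-ζ))
    (fun h g hh hg => by
      have e : ∀ ζ, ft (fun y => (χ y : ℂ) * (h y + g y)) ζ =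
          ft (fun y => (χ y : ℂ) * h y) ζ + ft (fun y => (χ y : ℂ) * g y) ζ := fun ζ => by
        simp only [ft]
        rw [← integral_add (hftint h hh ζ) (hftint g hg ζ)]
        simp only [mul_add]
      simp only [e]
      simp only [mul_add]
      rw [integral_add (hint h hh) (hint g hg), mul_add])
    (fun c h _ => by
      simp only [mul_left_comm _ c, ft, integral_const_mul])
    (fun ι K h hK hb => by
      have hA : Amp K 0 fun (i : ι) (p : E4 × E4) => (χ p.1 : ℂ) * h i p.1 := by
        have hs := (symOn_of_contDiffOn (ι := ι) isOpen_univ (Set.subset_univ K) hb.compact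
          hχ.smooth.contDiffOn).mul (hb.symOn isOpen_univ (Set.subset_univ K))
        rw [add_zero] at hs
        exact Amp.of_symOn hs hb.compact fun i p hp => by
          rw [hb.zero i p.1 hp, mul_zero]
      obtain ⟨D, hD0, hD⟩ := hA.norm_ampFourier_le (k + 0 + 5)
      refine ⟨‖c0‖ * (C * D * ∫ ζ : E4, ((1 + ‖ζ‖) ^ 5)⁻¹), fun i => ?_⟩
      rw [norm_mul]
      refine mul_le_mul_of_nonneg_left (norm_integral_le_weight
        (locFt_weight (l := 0) (fun ζ => hC ζ trivial) fun ζ => ?_)) (norm_nonneg _)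
      have h3 := hD i (innerSL ℝ (-ζ)) 0
      rw [innerSL_apply_norm, norm_neg, Real.rpow_zero] at h3
      rw [pow_zero, ft_eq_ampFourier _ (-ζ) 0]
      exact h3)
  refine ⟨U, ⟨tsupport χ, χ.hasCompactSupport, χ.tsupport_subset, fun θ hθ => ?_⟩, h2⟩
  have h3 : ∀ y, (χ y : ℂ) * (θ y : ℂ) = 0 := fun y => by
    by_cases hy : y ∈ tsupport χ
    · have : θ y = 0 := by
        by_contra hne
        exact hθ (subset_tsupport θ hne) hy
      simp [this]
    · simp [image_eq_zero_of_notMem_tsupport hy]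
  simp [h1, h3, ft]

end Multipliers

/-! ### The projection modulo gauge fields -/

section Projection

variable {M : Opens E4} {x ξ : E4} {m : ℝ}

theorem continuous_minkSq : Continuous minkSq := by
  unfold minkSq
  fun_prop

theorem minkSq_smul (t : ℝ) (ζ : E4) : minkSq (t • ζ) = t ^ 2 * minkSq ζ := by
  simp only [minkSq, PiLp.smul_apply, smul_eq_mul, Finset.mul_sum]
  refine Finset.sum_congr rfl fun i _ => Finset.sum_congr rfl fun j _ => ?_
  ring

theorem isOpenCone_minkSq (ε : ℝ) : IsOpenCone {ζ : E4 | ε * ‖ζ‖ ^ 2 < minkSq ζ} := by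
  refine ⟨isOpen_lt (by fun_prop) continuous_minkSq, fun η hη t ht => ?_⟩
  simp only [Set.mem_ofPred_eq] at hη ⊢
  rw [minkSq_smul, norm_smul, Real.norm_of_nonneg ht.le]
  have : 0 < t ^ 2 := by positivity
  nlinarith

theorem Spacelike.ne_zero (hξ : Spacelike ξ) : ξ ≠ 0 := by
  rintro rfl
  simp [Spacelike, minkSq] at hξ

theorem Spacelike.exists_mem_cone (hξ : Spacelike ξ) : ∃ ε : ℝ, 0 < ε ∧ ε * ‖ξ‖ ^ 2 < minkSq ξ := by
  have h0 : 0 < ‖ξ‖ := norm_pos_iff.2 hξ.ne_zero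
  have h1 : 0 < minkSq ξ := hξ
  refine ⟨minkSq ξ / (2 * ‖ξ‖ ^ 2), by positivity, ?_⟩
  have e : minkSq ξ / (2 * ‖ξ‖ ^ 2) * ‖ξ‖ ^ 2 = minkSq ξ / 2 := by field_simp
  rw [e]
  linarith

theorem sum_act_mul_waveNeg {ι : Type*} [Fintype ι] (A : ι → PsiDO M m) (u : ι → 𝓓'(M, ℂ))
    {ψ φ : E4 → ℂ} (hψ : IsTestC M ψ) (hφ : IsTestC M φ) (η : E4) :
    ∑ i, (A i).act (u i) ψ (fun y => φ y * waveNeg η y) =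
      c0 * (∫ ζ, ∑ i, locFt (u i) ψ ζ * symFt (A i).symbol φ (η - ζ) ζ) +
        ∑ i, opKer (A i).kernel (u i) ψ fun y => φ y * waveNeg η y := by
  rw [integral_finsetSum _ fun i _ => integrable_opMain (A i).isSymbol (u i) hψ hφ η,
    Finset.mul_sum, ← Finset.sum_add_distrib]
  exact Finset.sum_congr rfl fun i _ => by rw [PsiDO.act, opMain_mul_waveNeg]

/-- The projection annihilates gauge fields microlocally. -/
theorem microSmooth_projection_gauge (hξ : Spacelike ξ) {P : Ix2 → Ix2 → PsiDO M 0}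
    (hP : RealizesProjection P x ξ) {c : 𝓓'(M, ℂ)} {w : Fin 4 → 𝓓'(M, ℂ)} {ψ : 𝓓(M, ℝ)}
    (hc : IsCutoff ψ fun θ => c θ) (hw : ∀ i, IsCutoff ψ fun θ => w i θ) (kl : Ix2) :
    MicroSmooth M (fun h => ∑ ij, (P kl ij).act (gauge c w ij) (fun y => (ψ y : ℂ)) h) x ξ := by
  obtain ⟨O, hO, Γ, hΓ, hξΓ, R, hR⟩ := hP
  have hψ := isTestC_ofReal ψ
  have hΓ₀ := hΓ.inter (isOpenCone_minkSq 0)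
  obtain ⟨Γ', hΓ', hξ', r, hr0, hsep⟩ := hΓ₀.exists_subcone (ξ := ξ)
    ⟨hξΓ, by rw [Set.mem_ofPred_eq, zero_mul]; exact hξ⟩
  refine ⟨O, hO, Γ', hΓ', hξ', fun φ hφ hs => ?_⟩
  simp only [sum_act_mul_waveNeg _ _ hψ hφ]
  refine ((rapidOn_integral_sum (R := R) (fun ij => (P kl ij).isSymbol)
    (fun ij => polyBddOn_locFt (gauge c w ij) hψ) hr0 hsep (fun y hy ζ hζ hRζ => ?_)
      hφ hs).const_mul c0).add (RapidOn.sum _ fun ij _ N => ?_)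
  · have hζ' : Spacelike ζ := by
      have := hζ.2
      rwa [Set.mem_ofPred_eq, zero_mul] at this
    rw [← sum_projSymbol_mul_gaugeSymbol hζ' (locFt c (fun y => (ψ y : ℂ)) ζ)
      (fun i => locFt (w i) (fun y => (ψ y : ℂ)) ζ) kl]
    refine Finset.sum_congr rfl fun ij _ => ?_
    rw [hR y hy ζ hζ.1 hRζ, locFt_gauge hw, mul_comm]
  · obtain ⟨C, hC⟩ := norm_opKer_mul_waveNeg_le (P kl ij).smooth_kernel (hc.gauge hw ij) hφ N
    exact ⟨C, fun η _ => hC η⟩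

/-! ### The gauge field that corrects the projection -/

theorem measurable_etaLow (k : Fin 4) : Measurable fun ζ => etaLow ζ k := by
  unfold etaLow
  exact Measurable.div (by fun_prop) continuous_minkSq.measurable.sqrt

theorem measurable_etaUp (k : Fin 4) : Measurable fun ζ => etaUp ζ k := by
  unfold etaUp
  exact Finset.measurable_sum _ fun j _ => (measurable_etaLow j).const_mul _

theorem measurable_hUp (i j : Fin 4) : Measurable fun ζ => hUp ζ i j := by
  unfold hUp
  exact measurable_const.sub ((measurable_etaUp i).mul (measurable_etaUp j))

theorem measurable_scalarCoef (ij : Ix2) : Measurable fun ζ => scalarCoef ζ ij :=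
  (measurable_hUp _ _).div_const _

theorem measurable_covectorCoef (l : Fin 4) (ij : Ix2) :
    Measurable fun ζ => covectorCoef ζ l ij := by
  unfold covectorCoef
  refine Measurable.mul (Measurable.sub ?_ ?_) continuous_minkSq.measurable.sqrt.inv
  · split_ifs
    · exact measurable_etaUp _
    · exact measurable_const
  · exact ((measurable_etaLow l).mul (((measurable_etaUp _).mul (measurable_etaUp _)).add
      ((measurable_hUp _ _).div_const _))).div_const _

theorem polyBddOn_inv_sqrt :
    PolyBddOn {ζ | 1 ≤ minkSq ζ} fun ζ => (((Real.sqrt (minkSq ζ))⁻¹ : ℝ) : ℂ) := by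
  refine ⟨1, 0, zero_le_one, fun ζ hζ => ?_⟩
  rw [Complex.norm_real, norm_inv, Real.norm_of_nonneg (Real.sqrt_nonneg _), pow_zero, mul_one]
  exact inv_le_one_of_one_le₀ (Real.one_le_sqrt.2 hζ)

theorem polyBddOn_etaLow (k : Fin 4) :
    PolyBddOn {ζ | 1 ≤ minkSq ζ} fun ζ => (etaLow ζ k : ℂ) := by
  have h := (PolyBddOn.coord (S := {ζ | 1 ≤ minkSq ζ}) k).mul polyBddOn_inv_sqrt
  simpa only [etaLow, div_eq_mul_inv, Complex.ofReal_mul] using h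

theorem polyBddOn_etaUp (k : Fin 4) :
    PolyBddOn {ζ | 1 ≤ minkSq ζ} fun ζ => (etaUp ζ k : ℂ) := by
  have h := PolyBddOn.sum Finset.univ fun j =>
    (PolyBddOn.const (mink k j : ℂ)).mul (polyBddOn_etaLow j)
  simpa only [etaUp, Complex.ofReal_sum, Complex.ofReal_mul] using h

theorem polyBddOn_hUp (i j : Fin 4) :
    PolyBddOn {ζ | 1 ≤ minkSq ζ} fun ζ => (hUp ζ i j : ℂ) := by
  have h := (PolyBddOn.const (mink i j : ℂ)).sub ((polyBddOn_etaUp i).mul (polyBddOn_etaUp j))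
  simpa only [hUp, Complex.ofReal_sub, Complex.ofReal_mul] using h

theorem polyBddOn_scalarCoef (ij : Ix2) :
    PolyBddOn {ζ | 1 ≤ minkSq ζ} fun ζ => (scalarCoef ζ ij : ℂ) := by
  have h := (polyBddOn_hUp ij.1 ij.2).mul (PolyBddOn.const ((3 : ℝ)⁻¹ : ℂ))
  simpa only [scalarCoef, div_eq_mul_inv, Complex.ofReal_mul, Complex.ofReal_inv] using h

theorem polyBddOn_covectorCoef (l : Fin 4) (ij : Ix2) :
    PolyBddOn {ζ | 1 ≤ minkSq ζ} fun ζ => (covectorCoef ζ l ij : ℂ) := by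
  have h1 : PolyBddOn {ζ | 1 ≤ minkSq ζ}
      fun ζ => ((if ij.2 = l then etaUp ζ ij.1 else 0 : ℝ) : ℂ) := by
    split_ifs
    · exact polyBddOn_etaUp _
    · simpa using PolyBddOn.const 0
  have h2 := (h1.sub (((polyBddOn_etaLow l).mul (((polyBddOn_etaUp ij.1).mul
    (polyBddOn_etaUp ij.2)).add (polyBddOn_scalarCoef ij))).mul
      (PolyBddOn.const ((2 : ℝ)⁻¹ : ℂ)))).mul polyBddOn_inv_sqrt
  simpa only [covectorCoef, scalarCoef, div_eq_mul_inv, Complex.ofReal_mul, Complex.ofReal_inv,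
    Complex.ofReal_sub, Complex.ofReal_add] using h2

/-- The action of a gauge field given by Fourier multipliers. -/
theorem evalC_gauge_multiplier {c : 𝓓'(M, ℂ)} {w : Fin 4 → 𝓓'(M, ℂ)} {χ : 𝓓(M, ℝ)} {F : E4 → ℂ}
    {G : Fin 4 → E4 → ℂ} (hFm : Measurable F) (hF : PolyBddOn Set.univ F)
    (hGm : ∀ l, Measurable (G l)) (hG : ∀ l, PolyBddOn Set.univ (G l))
    (hc : ∀ h, IsTestC M h →
      evalC (fun θ => c θ) h = c0 * ∫ ζ, F ζ * ft (fun y => (χ y : ℂ) * h y) (-ζ))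
    (hw : ∀ l h, IsTestC M h →
      evalC (fun θ => w l θ) h = c0 * ∫ ζ, G l ζ * ft (fun y => (χ y : ℂ) * h y) (-ζ))
    (p : Ix2) {h : E4 → ℂ} (hh : IsTestC M h) (hχ : ∀ y ∈ tsupport h, χ y = 1) :
    (Integrable fun ζ => gaugeSymbol ζ (F ζ) (fun l => G l ζ) p * ft h (-ζ)) ∧
      evalC (fun θ => gauge c w p θ) h =
        c0 * ∫ ζ, gaugeSymbol ζ (F ζ) (fun l => G l ζ) p * ft h (-ζ) := by
  have hχh : ∀ g : E4 → ℂ, tsupport g ⊆ tsupport h → (fun y => (χ y : ℂ) * g y) = g := by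
    intro g hg
    funext y
    by_cases hy : y ∈ tsupport g
    · rw [hχ y (hg hy), Complex.ofReal_one, one_mul]
    · rw [image_eq_zero_of_notMem_tsupport hy, mul_zero]
  have hder : ∀ v, tsupport (dd v h) ⊆ tsupport h := fun v => tsupport_dds_subset [v] h
  have hft : ∀ (k : Fin 4) ζ, ft (dd (EuclideanSpace.single k (1 : ℝ)) h) (-ζ) =
      -(Complex.I * ζ k) * ft h (-ζ) := by
    intro k ζ
    rw [ft_dd hh.smooth hh.compact, inner_neg_right, EuclideanSpace.inner_single_left]
    simp
  obtain ⟨C, n, hC0, hC⟩ := hF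
  choose D n' hD0 hD using hG
  have i1 := integrable_mul_ft hFm.aestronglyMeasurable (fun ζ => hC ζ trivial) hh.smooth
    hh.compact
  have i2 : ∀ l k, Integrable fun ζ => G l ζ * (-(Complex.I * ζ k) * ft h (-ζ)) := fun l k => by
    simpa only [hft] using integrable_mul_ft (hGm l).aestronglyMeasurable
      (fun ζ => hD l ζ trivial) (hh.dd (EuclideanSpace.single k 1)).smooth
      (hh.dd (EuclideanSpace.single k 1)).compact
  have e : ∀ ζ, gaugeSymbol ζ (F ζ) (fun l => G l ζ) p * ft h (-ζ) =
      (mink p.1 p.2 : ℂ) * (F ζ * ft h (-ζ)) - 1 / 2 *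
        (G p.2 ζ * (-(Complex.I * ζ p.1) * ft h (-ζ)) +
          G p.1 ζ * (-(Complex.I * ζ p.2) * ft h (-ζ))) := by
    intro ζ
    rw [gaugeSymbol]
    ring
  simp only [e]
  have i3 : Integrable fun ζ => 1 / 2 * (G p.2 ζ * (-(Complex.I * ζ p.1) * ft h (-ζ)) +
      G p.1 ζ * (-(Complex.I * ζ p.2) * ft h (-ζ))) :=
    ((i2 p.2 p.1).add (i2 p.1 p.2)).const_mul (1 / 2 : ℂ)
  refine ⟨(i1.const_mul _).sub i3, ?_⟩
  rw [evalC_gauge c w p hh, hc h hh, hw _ _ (hh.dd _), hw _ _ (hh.dd _), hχh h subset_rfl,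
    hχh _ (hder _), hχh _ (hder _)]
  simp only [hft]
  rw [integral_sub (i1.const_mul _) i3, integral_const_mul, integral_const_mul]
  have i4 := integral_add (i2 p.2 p.1) (i2 p.1 p.2)
  rw [i4]
  ring

/-- The projection of `f` differs from `f` by a gauge field, microlocally. -/
theorem exists_gauge_correction (hx : x ∈ M) (hξ : Spacelike ξ) {P : Ix2 → Ix2 → PsiDO M 0}
    (hP : RealizesProjection P x ξ) {f : Ix2 → 𝓓'(M, ℂ)} (hsym : IsSymTensor f) {ψ : 𝓓(M, ℝ)}
    (hψf : ∀ p, IsCutoff ψ fun θ => f p θ) :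
    ∃ (c : 𝓓'(M, ℂ)) (w : Fin 4 → 𝓓'(M, ℂ)), CompactlySupported (fun θ => c θ) ∧
      (∀ i, CompactlySupported fun θ => w i θ) ∧ ∀ kl,
        MicroSmooth M (fun h => ∑ ij, (P kl ij).act (f ij) (fun y => (ψ y : ℂ)) h -
          evalC (fun θ => f kl θ) h + evalC (fun θ => gauge c w kl θ) h) x ξ := by
  obtain ⟨O, hO, Γ, hΓ, hξΓ, R, hR⟩ := hP
  obtain ⟨ε, hε, hξε⟩ := hξ.exists_mem_cone
  have hψ := isTestC_ofReal ψ
  obtain ⟨χ, h1, -⟩ := exists_cutoff (M := M) (isCompact_singleton (x := x)) M.isOpen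
    (Set.singleton_subset_iff.2 hx) subset_rfl
  rw [nhdsSet_singleton] at h1
  have hloc := fun ij => polyBddOn_locFt (f ij) hψ
  have hlocm : ∀ ij, Measurable (locFt (f ij) fun y => (ψ y : ℂ)) := fun ij =>
    (continuous_locFt (f ij) hψ).measurable
  set S : Set E4 := {ζ | 1 ≤ minkSq ζ} with hS
  have hSm : MeasurableSet S := measurableSet_le measurable_const continuous_minkSq.measurable
  -- The multipliers are cut off sharply to `S`: no smoothness in `ζ` is required of them.
  let F : E4 → ℂ := S.indicator fun ζ =>
    ∑ ij, (scalarCoef ζ ij : ℂ) * locFt (f ij) (fun y => (ψ y : ℂ)) ζ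
  let G : Fin 4 → E4 → ℂ := fun l => S.indicator fun ζ =>
    ∑ ij, (2 / Complex.I * (covectorCoef ζ l ij : ℂ)) * locFt (f ij) (fun y => (ψ y : ℂ)) ζ
  have hF : PolyBddOn Set.univ F := (PolyBddOn.sum _ fun ij =>
    (polyBddOn_scalarCoef ij).mul ((hloc ij).mono (Set.subset_univ _))).indicator
  have hG : ∀ l, PolyBddOn Set.univ (G l) := fun l => (PolyBddOn.sum _ fun ij =>
    ((PolyBddOn.const (2 / Complex.I)).mul (polyBddOn_covectorCoef l ij)).mul
      ((hloc ij).mono (Set.subset_univ _))).indicator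
  have hFm : Measurable F := (Finset.measurable_sum _ fun ij _ =>
    (Complex.measurable_ofReal.comp (measurable_scalarCoef ij)).mul (hlocm ij)).indicator hSm
  have hGm : ∀ l, Measurable (G l) := fun l => (Finset.measurable_sum _ fun ij _ =>
    ((Complex.measurable_ofReal.comp (measurable_covectorCoef l ij)).const_mul _).mul
      (hlocm ij)).indicator hSm
  obtain ⟨c, hcs, hc⟩ := exists_multiplier hFm hF χ
  choose w hws hw using fun l => exists_multiplier (hGm l) (hG l) χ
  refine ⟨c, w, hcs, hws, fun kl => ?_⟩
  have hΓ₀ := hΓ.inter (isOpenCone_minkSq ε)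
  obtain ⟨Γ', hΓ', hξ', r, hr0, hsep⟩ := hΓ₀.exists_subcone (ξ := ξ) ⟨hξΓ, hξε⟩
  refine ⟨O ∩ {y | ∀ᶠ z in 𝓝 y, χ z = 1}, Filter.inter_mem hO (eventually_eventually_nhds.2 h1),
    Γ', hΓ', hξ', fun φ hφ hs => ?_⟩
  let a : Option Ix2 → E4 → E4 → ℂ := fun j => j.elim (fun _ _ => 1) fun ij => (P kl ij).symbol
  let u : Option Ix2 → E4 → ℂ := fun j => j.elim
    (fun ζ => gaugeSymbol ζ (F ζ) (fun l => G l ζ) kl - locFt (f kl) (fun y => (ψ y : ℂ)) ζ)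
    fun ij => locFt (f ij) fun y => (ψ y : ℂ)
  have ha : ∀ j, IsSymbol M 0 (a j) := by
    rintro (_ | ij)
    · exact isSymbol_one
    · exact (P kl ij).isSymbol
  have hu : ∀ j, PolyBddOn Set.univ (u j) := by
    rintro (_ | ij)
    · refine PolyBddOn.sub (((PolyBddOn.const _).mul hF).add ((PolyBddOn.const _).mul ?_)) (hloc kl)
      exact ((PolyBddOn.coord _).mul (hG _)).add ((PolyBddOn.coord _).mul (hG _))
    · exact hloc ij
  have hvan : ∀ y ∈ O, ∀ ζ ∈ Γ ∩ {ζ : E4 | ε * ‖ζ‖ ^ 2 < minkSq ζ},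
      max R (max 1 (1 / ε)) ≤ ‖ζ‖ → ∑ j, u j ζ * a j y ζ = 0 := by
    intro y hy ζ hζ hRζ
    have hR1 : R ≤ ‖ζ‖ := (le_max_left _ _).trans hRζ
    have hR2 : 1 ≤ ‖ζ‖ := ((le_max_left _ _).trans (le_max_right _ _)).trans hRζ
    have hR3 : 1 / ε ≤ ‖ζ‖ := ((le_max_right _ _).trans (le_max_right _ _)).trans hRζ
    have hm : 1 ≤ minkSq ζ := by
      have h2 : ε * ‖ζ‖ ^ 2 < minkSq ζ := hζ.2
      rw [div_le_iff₀ hε] at hR3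
      nlinarith
    have hsp : Spacelike ζ := lt_of_lt_of_le one_pos hm
    have h3 := projSymbol_add_gaugeSymbol hsp
      (f := fun ij => locFt (f ij) (fun y => (ψ y : ℂ)) ζ) (fun i j => by rw [hsym i j]) kl
    have hF' : F ζ = ∑ ij, (scalarCoef ζ ij : ℂ) * locFt (f ij) (fun y => (ψ y : ℂ)) ζ :=
      Set.indicator_of_mem (show ζ ∈ S from hm) _
    have hG' : ∀ l, G l ζ = ∑ ij, (2 / Complex.I * (covectorCoef ζ l ij : ℂ)) *
        locFt (f ij) (fun y => (ψ y : ℂ)) ζ := fun l =>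
      Set.indicator_of_mem (show ζ ∈ S from hm) _
    have h4 : ∀ ij, u (some ij) ζ * a (some ij) y ζ =
        (projSymbol ζ kl ij : ℂ) * locFt (f ij) (fun y => (ψ y : ℂ)) ζ := fun ij => by
      change locFt (f ij) (fun y => (ψ y : ℂ)) ζ * (P kl ij).symbol y ζ = _
      rw [hR y hy ζ hζ.1 hR1, mul_comm]
    have h5 : u none ζ * a none y ζ = gaugeSymbol ζ (F ζ) (fun l => G l ζ) kl -
        locFt (f kl) (fun y => (ψ y : ℂ)) ζ := mul_one _
    rw [Fintype.sum_option, h5]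
    simp only [h4, hF', hG']
    linear_combination h3
  have hmain := rapidOn_integral_sum ha hu hr0 hsep hvan hφ (hs.trans Set.inter_subset_left)
  have e : (fun η => ∑ ij, (P kl ij).act (f ij) (fun y => (ψ y : ℂ))
      (fun y => φ y * waveNeg η y) - evalC (fun θ => f kl θ) (fun y => φ y * waveNeg η y) +
      evalC (fun θ => gauge c w kl θ) fun y => φ y * waveNeg η y) = fun η =>
        c0 * (∫ ζ, ∑ j, u j ζ * symFt (a j) φ (η - ζ) ζ) +
          ∑ ij, opKer (P kl ij).kernel (f ij) (fun y => (ψ y : ℂ)) fun y => φ y * waveNeg η y := by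
    funext η
    have hφη := hφ.mul_waveNeg η
    obtain ⟨i1, g1⟩ := evalC_gauge_multiplier hFm hF hGm hG hc hw kl hφη fun y hy =>
      (hs (tsupport_mul_waveNeg η hy)).2.self_of_nhds
    have g2 : evalC (fun θ => f kl θ) (fun y => φ y * waveNeg η y) =
        c0 * ∫ ζ, locFt (f kl) (fun y => (ψ y : ℂ)) ζ * ft φ (η - ζ) := by
      rw [← locFt_mul (f kl) hψ hφ.smooth hφ.compact, locFt, ← evalC_cutoff_mul (hψf kl) hφη]
      simp only [mul_assoc]
    simp only [ft_mul_waveNeg, ← sub_eq_add_neg] at i1 g1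
    have i2 : Integrable fun ζ => locFt (f kl) (fun y => (ψ y : ℂ)) ζ * ft φ (η - ζ) := by
      simpa only [symFt_one] using integrable_opMain isSymbol_one (f kl) hψ hφ η
    have i3 : Integrable fun ζ => ∑ ij, locFt (f ij) (fun y => (ψ y : ℂ)) ζ *
        symFt (P kl ij).symbol φ (η - ζ) ζ := integrable_finsetSum _ fun ij _ =>
      integrable_opMain (P kl ij).isSymbol (f ij) hψ hφ η
    have e1 : ∀ ζ, ∑ j, u j ζ * symFt (a j) φ (η - ζ) ζ =
        (gaugeSymbol ζ (F ζ) (fun l => G l ζ) kl * ft φ (η - ζ) -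
          locFt (f kl) (fun y => (ψ y : ℂ)) ζ * ft φ (η - ζ)) +
        ∑ ij, locFt (f ij) (fun y => (ψ y : ℂ)) ζ * symFt (P kl ij).symbol φ (η - ζ) ζ := by
      intro ζ
      rw [Fintype.sum_option]
      simp only [u, a, Option.elim, symFt_one]
      ring
    simp only [e1]
    have i12 : Integrable fun ζ => gaugeSymbol ζ (F ζ) (fun l => G l ζ) kl * ft φ (η - ζ) -
        locFt (f kl) (fun y => (ψ y : ℂ)) ζ * ft φ (η - ζ) := i1.sub i2
    rw [integral_add i12 i3, integral_sub i1 i2, g1, g2,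
      sum_act_mul_waveNeg _ _ hψ hφ]
    ring
  change RapidOn Γ' fun η => ∑ ij, (P kl ij).act (f ij) (fun y => (ψ y : ℂ))
      (fun y => φ y * waveNeg η y) - evalC (fun θ => f kl θ) (fun y => φ y * waveNeg η y) +
      evalC (fun θ => gauge c w kl θ) fun y => φ y * waveNeg η y
  rw [e]
  refine (hmain.const_mul c0).add (RapidOn.sum _ fun ij _ N => ?_)
  obtain ⟨C, hC⟩ := norm_opKer_mul_waveNeg_le (P kl ij).smooth_kernel (hψf ij) hφ N
  exact ⟨C, fun η _ => hC η⟩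

end Projection

/-! ### Passing to the wave front sets -/

section WaveFront

variable {M : Opens E4} {x ξ : E4} {m : ℝ}

/-- Microlocal smoothness at `(x, ξ)` depends on test functions supported near `x` only. -/
theorem MicroSmooth.congr_nhds {G G' : (E4 → ℂ) → ℂ} (h : MicroSmooth M G x ξ) {O : Set E4}
    (hO : O ∈ 𝓝 x) (hG : ∀ φ, IsTestC M φ → tsupport φ ⊆ O → G' φ = G φ) :
    MicroSmooth M G' x ξ := by
  obtain ⟨V, hV, Γ, hΓ, hξ, hr⟩ := h
  exact ⟨V ∩ O, Filter.inter_mem hV hO, Γ, hΓ, hξ, fun φ hφ hs =>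
    (hr φ hφ (hs.trans Set.inter_subset_left)).congr fun η _ => hG _ (hφ.mul_waveNeg η)
      ((tsupport_mul_waveNeg η).trans (hs.trans Set.inter_subset_right))⟩

/-- The product of a distribution and a test function is a compactly supported distribution. -/
theorem exists_cutMul (φ : 𝓓(M, ℝ)) (U : 𝓓'(M, ℂ)) : ∃ V : 𝓓'(M, ℂ),
    CompactlySupported (fun θ => V θ) ∧ (∀ θ, V θ = cutMul φ (fun θ => U θ) θ) ∧
      ∀ h, IsTestC M h →
        evalC (fun θ => V θ) h = evalC (fun θ => U θ) fun y => (φ y : ℂ) * h y := by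
  have hφ := isTestC_ofReal φ
  obtain ⟨χ, h1, -⟩ := exists_cutoff (M := M) φ.hasCompactSupport.isCompact M.isOpen
    φ.tsupport_subset subset_rfl
  obtain ⟨V, hV, h2⟩ := exists_multiplier (continuous_locFt U hφ).measurable
    (polyBddOn_locFt U hφ) χ
  have h3 : ∀ h, IsTestC M h →
      evalC (fun θ => V θ) h = evalC (fun θ => U θ) fun y => (φ y : ℂ) * h y := fun h hh => by
    have e : (fun y => (φ y : ℂ) * h y) = fun y => (φ y : ℂ) * ((χ y : ℂ) * h y) := by
      funext y
      by_cases hy : y ∈ tsupport φ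
      · rw [((eventually_nhdsSet_iff_forall.1 h1) y hy).self_of_nhds]
        simp
      · simp [image_eq_zero_of_notMem_tsupport hy]
    have ht := hh.mul_left (isTestC_ofReal χ).smooth
    rw [h2 h hh, e, evalC_mul_eq_integral U hφ ht.smooth ht.compact]
    rfl
  refine ⟨V, hV, fun θ => ?_, h3⟩
  rw [← evalC_ofReal V θ, h3 _ (isTestC_ofReal θ), cutMul, evalC]
  simp only [← Complex.ofReal_mul, Complex.ofReal_re, Complex.ofReal_im]
  rw [evalReal_zero, mul_zero, add_zero]

theorem evalC_add_apply (U V : 𝓓'(M, ℂ)) (h : E4 → ℂ) :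
    evalC (fun θ => (U + V) θ) h = evalC (fun θ => U θ) h + evalC (fun θ => V θ) h :=
  evalC_add_left _ _ h

theorem IsCutoff.add {ψ : 𝓓(M, ℝ)} {U V : 𝓓'(M, ℂ)} (hU : IsCutoff ψ fun θ => U θ)
    (hV : IsCutoff ψ fun θ => V θ) : IsCutoff ψ fun θ => (U + V) θ :=
  hU.of_forall hV fun θ h1 h2 => by
    change U θ + V θ = 0
    rw [h1, h2, add_zero]

/-- A common cutoff for a tensor field and the two potentials of a gauge field. -/
theorem exists_common_cutoff_gauge {ι : Type*} [Finite ι] {f : ι → 𝓓'(M, ℂ)} {c : 𝓓'(M, ℂ)}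
    {w : Fin 4 → 𝓓'(M, ℂ)} (hf : ∀ p, CompactlySupported fun θ => f p θ)
    (hc : CompactlySupported fun θ => c θ) (hw : ∀ i, CompactlySupported fun θ => w i θ) :
    ∃ ψ : 𝓓(M, ℝ), (∀ p, IsCutoff ψ fun θ => f p θ) ∧ (IsCutoff ψ fun θ => c θ) ∧
      ∀ i, IsCutoff ψ fun θ => w i θ := by
  obtain ⟨ψ, h⟩ := exists_common_cutoff
    (u := fun k : ι ⊕ Option (Fin 4) => k.elim (fun p θ => f p θ)
      fun o => o.elim (fun θ => c θ) fun i θ => w i θ)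
    (by rintro (p | _ | i) <;> [exact hf p; exact hc; exact hw i])
  exact ⟨ψ, fun p => h (Sum.inl p), h (Sum.inr none), fun i => h (Sum.inr (some i))⟩

/-- If `f` is smooth modulo a gauge field, then `P f` is smooth. -/
theorem microSmooth_projection (hx : x ∈ M) (hξ : Spacelike ξ) {P : Ix2 → Ix2 → PsiDO M 0}
    (hP : RealizesProjection P x ξ) {f : Ix2 → 𝓓'(M, ℂ)} {c : 𝓓'(M, ℂ)} {w : Fin 4 → 𝓓'(M, ℂ)}
    {ψ : 𝓓(M, ℝ)} (hf : ∀ p, IsCutoff ψ fun θ => f p θ) (hc : IsCutoff ψ fun θ => c θ)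
    (hw : ∀ i, IsCutoff ψ fun θ => w i θ)
    (h : ∀ p, MicroSmooth M (evalC fun θ => (f + gauge c w) p θ) x ξ) (kl : Ix2) :
    MicroSmooth M (fun h => ∑ ij, (P kl ij).act (f ij) (fun y => (ψ y : ℂ)) h) x ξ := by
  have h1 := microSmooth_matrix P (fun p => (hf p).add (hc.gauge hw p)) hx h kl
  refine (h1.sub (microSmooth_projection_gauge hξ hP hc hw kl)).congr fun φ hφ => ?_
  rw [← Finset.sum_sub_distrib]
  refine Finset.sum_congr rfl fun ij _ => ?_
  rw [(P kl ij).act_linear (U := f ij + gauge c w ij) (U₁ := f ij) (U₂ := gauge c w ij) 1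
    (fun h _ => by rw [evalC_add_apply, one_mul]) (isTestC_ofReal ψ) hφ]
  ring

/-- An operator that annihilates gauge fields cannot distinguish, microlocally, two tensor fields
that differ by a gauge field modulo a smooth field. -/
theorem microSmooth_sub_of_annihilatesGauge {n : ℕ} (hx : x ∈ M) {A : Fin n → Ix2 → PsiDO M m}
    (hA : AnnihilatesGauge A) {f q : Ix2 → 𝓓'(M, ℂ)} {c : 𝓓'(M, ℂ)} {w : Fin 4 → 𝓓'(M, ℂ)}
    {ψ : 𝓓(M, ℝ)} (hf : ∀ p, IsCutoff ψ fun θ => f p θ) (hq : ∀ p, IsCutoff ψ fun θ => q p θ)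
    (hc : IsCutoff ψ fun θ => c θ) (hw : ∀ i, IsCutoff ψ fun θ => w i θ)
    (h : ∀ p, MicroSmooth M (fun h => evalC (fun θ => q p θ) h - evalC (fun θ => f p θ) h +
      evalC (fun θ => gauge c w p θ) h) x ξ) (k : Fin n) :
    MicroSmooth M (fun h => ∑ i, (A k i).act (q i) (fun y => (ψ y : ℂ)) h -
      ∑ i, (A k i).act (f i) (fun y => (ψ y : ℂ)) h) x ξ := by
  have hg : ∀ p, IsCutoff ψ fun θ => gauge c w p θ := fun p => hc.gauge hw p
  have hg0 : ∀ φ, IsTestC M φ →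
      ∑ i, (A k i).act (gauge c w i) (fun y => (ψ y : ℂ)) φ = 0 := fun φ hφ => by
    obtain ⟨V, e, hV⟩ := exists_applyMatrix A hg
    rw [← hV k φ hφ]
    have e0 : (fun θ => V k θ) = fun _ => 0 := by
      rw [hA c w hc.compactlySupported fun i => (hw i).compactlySupported] at e
      exact (congrFun e k).symm
    rw [e0]
    simp [evalC, evalReal]
  have hev : ∀ p h, IsTestC M h → evalC (fun θ => (q p - f p + gauge c w p) θ) h =
      evalC (fun θ => q p θ) h - evalC (fun θ => f p θ) h + evalC (fun θ => gauge c w p θ) h := by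
    intro p h _
    rw [evalC_add_apply, add_left_inj]
    have e : (fun θ => (q p - f p) θ) = fun θ => q p θ + (-1 : ℂ) * f p θ := by
      funext θ
      change q p θ - f p θ = _
      ring
    rw [e, evalC_add_left, evalC_const_mul_left]
    ring
  have hcut : ∀ p, IsCutoff ψ fun θ => (q p - f p + gauge c w p) θ := fun p =>
    IsCutoff.add (U := q p - f p) ((hq p).of_forall (hf p) fun θ h1 h2 => by
      change q p θ - f p θ = 0
      rw [h1, h2, sub_zero]) (hg p)
  have h1 := microSmooth_matrix A hcut hx (fun p => (h p).congr (hev p)) k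
  refine h1.congr fun φ hφ => ?_
  have h2 : ∀ i, (A k i).act (q i - f i + gauge c w i) (fun y => (ψ y : ℂ)) φ =
      (A k i).act (q i) (fun y => (ψ y : ℂ)) φ - (A k i).act (f i) (fun y => (ψ y : ℂ)) φ +
        (A k i).act (gauge c w i) (fun y => (ψ y : ℂ)) φ := fun i => by
    rw [(A k i).act_linear (U := q i - f i + gauge c w i) (U₁ := q i - f i)
        (U₂ := gauge c w i) 1 (fun h _ => by rw [evalC_add_apply, one_mul])
        (isTestC_ofReal ψ) hφ,
      (A k i).act_linear (U := q i - f i) (U₁ := q i) (U₂ := f i) (-1) (fun h _ => ?_)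
        (isTestC_ofReal ψ) hφ]
    · ring
    · rw [← evalC_const_mul_left, ← evalC_add_left]
      congr 1
      funext θ
      change q i θ - f i θ = _
      ring
  simp only [h2, Finset.sum_add_distrib, Finset.sum_sub_distrib, hg0 φ hφ, add_zero]

end WaveFront

end LightRay

end

open LightRay in
theorem lemma9p3 (M : Opens E4) (x ξ : E4) (hx : x ∈ M) (hξ : Spacelike ξ)
    (P : Ix2 → Ix2 → PsiDO M 0) (hP : RealizesProjection P x ξ)
    (f : Ix2 → 𝓓'(M, ℂ)) (hsym : IsSymTensor f)
    (hf : ∀ p, CompactlySupported (fun φ => f p φ)) :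
    (InWF (applyMatrix P (toFunctional f)) x ξ ↔
      ∀ (c : 𝓓'(M, ℂ)) (w : Fin 4 → 𝓓'(M, ℂ)), CompactlySupported (fun φ => c φ) →
        (∀ i, CompactlySupported (fun φ => w i φ)) →
          InWF (toFunctional (f + gauge c w)) x ξ) ∧
    ∀ (n : ℕ) (m : ℝ) (A : Fin n → Ix2 → PsiDO M m), AnnihilatesGauge A →
      ∀ φ : 𝓓(M, ℝ), (∀ᶠ y in 𝓝 x, φ y = 1) →
        (InWF (applyMatrix A (fun p => cutMul φ (applyMatrix P (toFunctional f) p))) x ξ ↔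
          InWF (applyMatrix A (toFunctional f)) x ξ) := by
  have hξ0 := hξ.ne_zero
  obtain ⟨ψ₀, hψ₀⟩ := exists_common_cutoff hf
  obtain ⟨V, eV, hV⟩ := exists_applyMatrix P hψ₀
  obtain ⟨c₁, w₁, hc₁, hw₁, hsm⟩ := exists_gauge_correction hx hξ hP hsym hψ₀
  refine ⟨?_, fun n m A hA φ hφ => ?_⟩
  · refine not_iff_not.1 ⟨fun h => ?_, fun h => ?_⟩
    · rw [eV, not_inWF_iff hx hξ0] at h
      -- `d^s` and multiplication by `g` are linear, so `-c₁` and `-w₁` give the opposite field.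
      refine fun hall => (not_inWF_iff hx hξ0).2 (fun p => ?_) (hall (-c₁) (fun i => -w₁ i) ?_ ?_)
      · refine ((h p).sub (hsm p)).congr fun θ hθ => ?_
        have e : ∀ U : 𝓓'(M, ℂ), ∀ g, evalC (fun θ => (-U) θ) g = -evalC (fun θ => U θ) g := by
          intro U g
          rw [neg_eq_neg_one_mul, ← evalC_const_mul_left]
          congr 1
          funext θ
          change -U θ = _
          ring
        change evalC (fun θ => (f p + gauge (-c₁) (fun i => -w₁ i) p) θ) θ = _
        rw [evalC_add_apply, evalC_gauge _ _ _ hθ, evalC_gauge _ _ _ hθ, hV p θ hθ]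
        simp only [e]
        ring
      · obtain ⟨K, hK, hKM, h0⟩ := hc₁
        exact ⟨K, hK, hKM, fun θ hθ => neg_eq_zero.2 (h0 θ hθ)⟩
      · intro i
        obtain ⟨K, hK, hKM, h0⟩ := hw₁ i
        exact ⟨K, hK, hKM, fun θ hθ => neg_eq_zero.2 (h0 θ hθ)⟩
    · simp only [not_forall] at h
      obtain ⟨c, w, hc, hw, h⟩ := h
      rw [not_inWF_iff hx hξ0] at h
      obtain ⟨ψ, hψf, hψc, hψw⟩ := exists_common_cutoff_gauge hf hc hw
      obtain ⟨V', eV', hV'⟩ := exists_applyMatrix P hψf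
      rw [eV', not_inWF_iff hx hξ0]
      exact fun kl => (microSmooth_projection hx hξ hP hψf hψc hψw h kl).congr (hV' kl)
  · choose q hq1 hq2 hq3 using fun p => exists_cutMul φ (V p)
    have eq : (fun p => cutMul φ (applyMatrix P (toFunctional f) p)) = toFunctional q := by
      funext p θ
      rw [eV]
      exact (hq2 p θ).symm
    obtain ⟨ψ, hψ, hψc, hψw⟩ := exists_common_cutoff_gauge
      (f := fun p : Ix2 ⊕ Ix2 => p.elim f q)
      (by rintro (p | p) <;> [exact hf p; exact hq1 p]) hc₁ hw₁
    have hψf : ∀ p, IsCutoff ψ fun θ => f p θ := fun p => hψ (Sum.inl p)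
    have hψq : ∀ p, IsCutoff ψ fun θ => q p θ := fun p => hψ (Sum.inr p)
    obtain ⟨B, eB, hB⟩ := exists_applyMatrix A hψf
    obtain ⟨D, eD, hD⟩ := exists_applyMatrix A hψq
    have hdiff := microSmooth_sub_of_annihilatesGauge hx hA hψf hψq hψc hψw fun p => by
      refine (hsm p).congr_nhds hφ fun h hh hs => ?_
      have e : (fun y => (φ y : ℂ) * h y) = h := by
        funext y
        by_cases hy : y ∈ tsupport h
        · have : φ y = 1 := hs hy
          simp [this]
        · simp [image_eq_zero_of_notMem_tsupport hy]
      rw [hq3 p h hh, e, hV p h hh]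
    rw [eq, eB, eD]
    refine not_iff_not.1 ?_
    rw [not_inWF_iff hx hξ0, not_inWF_iff hx hξ0]
    refine forall_congr' fun k => ⟨fun h => ?_, fun h => ?_⟩
    · refine (h.sub (hdiff k)).congr fun θ hθ => ?_
      rw [hB k θ hθ, hD k θ hθ]
      ring
    · refine (h.add (hdiff k)).congr fun θ hθ => ?_
      rw [hB k θ hθ, hD k θ hθ]
      ring
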